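/- Let $M$ be a smooth paracompact manifold of dimension $n\ge 3$, let $\tau:T^\circ M\to M$ be its slit tangent bundle with Liouville field $\Delta$, and let a projective class of sprays on $T^\circ M$ be given, represented by the spray $\Gamma$. (A spray is a smooth vector field with $\tau_*\Gamma_{(x,y)}=y$ and $[\Delta,\Gamma]=\Gamma$; two sprays are projectively equivalent if their geodesics, i.e. base integral curves, agree up to orientation-preserving reparametrization.) Let $\mathcal D$ be the distribution spanned by $\Delta$ and $\Gamma$, and assume that path space exists: there is a smooth manifold $P_{\mathcal D}$ and a surjective submersion $\pi:T^\circ M\to P_{\mathcal D}$ whose fibres are the leaves of $\mathcal D$ (so $\dim P_{\mathcal D}=2n-2$). For $x\in M$ put $\hat x=\pi(T^\circ_xM)$. A Finsler function over an open set $U\subset M$ is a smooth positive function $F$ on $T^\circ U$, positively homogeneous of degree one, with $\big(\partial^2F^2/\partial y^i\partial y^j\big)$ positive definite; its geodesic class is the set of sprays on $T^\circ U$ whose geodesics satisfy the Euler–Lagrange equations of $F$; its Hilbert $2$-form is $d\theta$ with $\theta=(\partial F/\partial y^i)\,dx^i$. The projective class is said to be the geodesic class of a local Finsler function if every $x\in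 M$ has an open neighbourhood $U_x$ carrying a Finsler function $F_x$ whose geodesic class is the restriction of the projective class to $T^\circ U_x$, where for all $x,x'$ the functions $F_x$ and $F_{x'}$ have the same Hilbert $2$-form on $T^\circ(U_x\cap U_{x'})$ (equivalently, they differ locally by a total derivative $y^i\,\partial f/\partial x^i$). Given a geodesic $\gamma$ of $\Gamma$, a Jacobi field along $\gamma$ is $\zeta=\tau_*Z$ for a vector field $Z$ along $\bar\gamma=(\gamma,\dot\gamma)$ with $\mathcal L_\Gamma Z=0$; it determines the element $\pi_*Z(0)$, again denoted $\zeta$, of $T_pP_{\mathcal D}$, $p=\pi(\bar\gamma(0))$. Write $\nabla\zeta^i=\dot\zeta^i+\Gamma^i_j\zeta^j$, where $\Gamma=y^i\partial_{x^i}-2\Gamma^i\partial_{y^i}$ and $\Gamma^i_j=\partial\Gamma^i/\partial y^j$. **Statement.** The projective class is the geodesic class of a local Finsler function if and only if there is a symplectic $2$-form $\Omega$ on $P_{\mathcal D}$ such that 1. for every $x\in M$, $\hat x$ is Lagrangian for $\Omega$ (that is, for every $y\in T^\circ_xM$ the image under $\pi_*$ of the vertical subspace at $(x,y)$ is a Lagrangian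 subspace of $T_{\pi(x,y)}P_{\mathcal D}$); and 2. for every geodesic $\gamma$ of $\Gamma$ defined on an open interval containing $0$ and every $v\in T_{\gamma(0)}M$, if $\zeta_1,\zeta_2$ are the Jacobi fields along $\gamma$ with $\zeta_1(0)=v,\ \nabla\zeta_1(0)=0$ and $\zeta_2(0)=0,\ \nabla\zeta_2(0)=v$, and the corresponding elements $\zeta_1,\zeta_2\in T_pP_{\mathcal D}$ are non-zero, then $\Omega_p(\zeta_1,\zeta_2)>0$. -/

import Mathlib

open Set
open scoped Manifold ContDiff Topology

noncomputable section

namespace PathSpace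

/-! ## Differential forms on a manifold without boundary -/

section Forms

variable {V : Type*} [NormedAddCommGroup V] [NormedSpace ℝ V]
  {H : Type*} [TopologicalSpace H] (I : ModelWithCorners ℝ V H)
  {N : Type*} [TopologicalSpace N] [ChartedSpace H N]

/-- A (not necessarily continuous) field of alternating `k`-forms on the manifold `N`. -/
abbrev FormField (N : Type*) [TopologicalSpace N] [ChartedSpace H N] (k : ℕ) : Type _ :=
  (p : N) → TangentSpace I p [⋀^Fin k]→L[ℝ] ℝ

variable {I} in
/-- The coordinate expression of a form in the preferred chart at `p₀`: the pullback of the form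
by the inverse of the chart. It is meaningful on the target of the chart. -/
def formInChart {k : ℕ} (α : FormField I N k) (p₀ : N) (z : V) : V [⋀^Fin k]→L[ℝ] ℝ :=
  (α ((extChartAt I p₀).symm z)).compContinuousLinearMap
    (mfderiv 𝓘(ℝ, V) I (extChartAt I p₀).symm z)

variable {I} in
/-- Smoothness: all coordinate expressions are smooth. -/
def IsSmoothForm {k : ℕ} (α : FormField I N k) : Prop :=
  ∀ p₀ : N, ContDiffOn ℝ ∞ (formInChart α p₀) (extChartAt I p₀).target

variable {I} in
/-- The exterior derivative of a form on a manifold without boundary, computed at `p` in the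
preferred chart at `p` (for smooth forms any other chart gives the same result). -/
def extD {k : ℕ} (α : FormField I N k) : FormField I N (k + 1) := fun p =>
  (extDeriv (formInChart α p) (extChartAt I p p)).compContinuousLinearMap
    (mfderiv I 𝓘(ℝ, V) (extChartAt I p) p)

variable {I} in
/-- A symplectic form: a smooth, closed, nondegenerate 2-form. -/
structure IsSymplectic (Ω : FormField I N 2) : Prop where
  smooth : IsSmoothForm Ω
  closed : ∀ p, extD Ω p = 0
  nondegenerate : ∀ (p : N) (ξ : TangentSpace I p),
    (∀ η : TangentSpace I p, Ω p ![ξ, η] = 0) → ξ = 0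

end Forms

/-! ## Sprays -/

section Sprays

variable {E : Type*} [NormedAddCommGroup E] [NormedSpace ℝ E]
  {M : Type*} [TopologicalSpace M] [ChartedSpace E M] [IsManifold 𝓘(ℝ, E) ∞ M]

variable (E M) in
/-- Vector fields on the total space `TM` of the tangent bundle. -/
abbrev FieldOnTM : Type _ :=
  (p : TangentBundle 𝓘(ℝ, E) M) → TangentSpace 𝓘(ℝ, E).tangent p

variable (E) in
/-- The part `T°U` of the slit tangent bundle over `U ⊆ M`: non-zero tangent vectors based at points
of `U`. The slit tangent bundle of `M` itself is `slit E univ`. -/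
def slit (U : Set M) : Set (TangentBundle 𝓘(ℝ, E) M) := {p | p.proj ∈ U ∧ p.2 ≠ 0}

/-- The differential `τ_*` at `p` of the bundle projection `τ : TM → M`. -/
def dτ (p : TangentBundle 𝓘(ℝ, E) M) :
    TangentSpace 𝓘(ℝ, E).tangent p →L[ℝ] TangentSpace 𝓘(ℝ, E) p.proj :=
  mfderiv 𝓘(ℝ, E).tangent 𝓘(ℝ, E) (fun q : TangentBundle 𝓘(ℝ, E) M => q.proj) p

/-- The vertical lift of `v ∈ T_xM` to `p = (x, y)`: the image of `v` under the differential at `y` of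
the inclusion `T_xM → TM`. -/
def vlift (p : TangentBundle 𝓘(ℝ, E) M) (v : TangentSpace 𝓘(ℝ, E) p.proj) :
    TangentSpace 𝓘(ℝ, E).tangent p :=
  mfderiv 𝓘(ℝ, E) 𝓘(ℝ, E).tangent
    (fun w : E => (⟨p.proj, w⟩ : TangentBundle 𝓘(ℝ, E) M)) (p.2 : E) v

variable (E M) in
/-- The Liouville field `Δ`. -/
def liouville : FieldOnTM E M := fun p => vlift p p.2

/-- `Γ` is a spray over the open set `U ⊆ M`, that is, on `T°U`: a smooth vector field there with
`τ_* Γ_{(x,y)} = y` and `[Δ, Γ] = Γ`. (Values of `Γ` outside `T°U` are irrelevant.) -/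
structure IsSpray (U : Set M) (Γ : FieldOnTM E M) : Prop where
  smooth : ContMDiffOn 𝓘(ℝ, E).tangent 𝓘(ℝ, E).tangent.tangent ∞
    (fun p => (⟨p, Γ p⟩ : TangentBundle 𝓘(ℝ, E).tangent (TangentBundle 𝓘(ℝ, E) M))) (slit E U)
  secondOrder : ∀ p ∈ slit E U, dτ p (Γ p) = p.2
  homogeneous : ∀ p ∈ slit E U,
    VectorField.mlieBracket 𝓘(ℝ, E).tangent (liouville E M) Γ p = Γ p

/-- `J` is an open interval of `ℝ` (bounded or not). -/
def IsOpenInterval (J : Set ℝ) : Prop := IsOpen J ∧ J.OrdConnected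

/-- `σ` is an integral curve of `Γ` inside `T°U`, defined on the open interval `J`. -/
structure IsLiftedGeodesic (U : Set M) (Γ : FieldOnTM E M) (J : Set ℝ)
    (σ : ℝ → TangentBundle 𝓘(ℝ, E) M) : Prop where
  interval : IsOpenInterval J
  mem : ∀ t ∈ J, σ t ∈ slit E U
  integral : IsMIntegralCurveOn (I := 𝓘(ℝ, E).tangent) σ Γ J

/-- `γ` is a geodesic of `Γ` in `U` defined on the open interval `J`: a base integral curve. -/
def IsGeodesic (U : Set M) (Γ : FieldOnTM E M) (J : Set ℝ) (γ : ℝ → M) : Prop :=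
  ∃ σ : ℝ → TangentBundle 𝓘(ℝ, E) M, IsLiftedGeodesic U Γ J σ ∧ ∀ t ∈ J, (σ t).proj = γ t

/-- Every geodesic of `Γ` in `U` becomes a geodesic of `Γ'` after an orientation-preserving
reparametrization. -/
def GeodesicsReparametrize (U : Set M) (Γ Γ' : FieldOnTM E M) : Prop :=
  ∀ (J : Set ℝ) (γ : ℝ → M), IsGeodesic U Γ J γ →
    ∃ (J' : Set ℝ) (φ : ℝ → ℝ), ContDiffOn ℝ ∞ φ J' ∧ (∀ t ∈ J', 0 < deriv φ t) ∧ φ '' J' = J ∧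
      IsGeodesic U Γ' J' (γ ∘ φ)

/-- Projective equivalence over `U`: the two sprays have the same geodesics in `U` up to
orientation-preserving reparametrization. -/
def ProjectivelyEquivalent (U : Set M) (Γ Γ' : FieldOnTM E M) : Prop :=
  GeodesicsReparametrize U Γ Γ' ∧ GeodesicsReparametrize U Γ' Γ

/-! ## Finsler functions -/

/-- A Finsler function over the open set `U`: a smooth function on `T°U` which is positive,
positively homogeneous of degree one, and for which the fibre Hessian of `F²` is positive definite.
(Values outside `T°U` are irrelevant.) -/
structure IsFinsler (U : Set M) (F : TangentBundle 𝓘(ℝ, E) M → ℝ) : Prop where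
  smooth : ContMDiffOn 𝓘(ℝ, E).tangent 𝓘(ℝ, ℝ) ∞ F (slit E U)
  pos : ∀ p ∈ slit E U, 0 < F p
  homogeneous : ∀ p ∈ slit E U, ∀ c : ℝ, 0 < c → F ⟨p.proj, c • p.2⟩ = c * F p
  convex : ∀ p ∈ slit E U, ∀ v : E, v ≠ 0 →
    0 < fderiv ℝ (fun w : E => fderiv ℝ (fun w' : E => F ⟨p.proj, w'⟩ ^ 2) w v) (p.2 : E) v

/-- The Hilbert 1-form `θ = (∂F/∂yⁱ) dxⁱ`: at `p = (x, y)`, `θ(ξ)` is the derivative at `y` of the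
restriction of `F` to `T_xM`, in the direction `τ_* ξ`. -/
def hilbertForm (F : TangentBundle 𝓘(ℝ, E) M → ℝ) :
    FormField 𝓘(ℝ, E).tangent (TangentBundle 𝓘(ℝ, E) M) 1 := fun p =>
  ContinuousAlternatingMap.ofSubsingleton ℝ (TangentSpace 𝓘(ℝ, E).tangent p) ℝ (0 : Fin 1)
    (ContinuousLinearMap.comp (σ₁₂ := RingHom.id ℝ) (M₂ := TangentSpace 𝓘(ℝ, E) p.proj)
      (fderiv ℝ (fun w : E => F ⟨p.proj, w⟩) (p.2 : E)) (dτ p))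

/-- The expression of a function on `TM` in the coordinates `(x, y)` of `TM` induced by the
preferred chart `φ` of `M` at `x₀`. -/
def inCoords (F : TangentBundle 𝓘(ℝ, E) M → ℝ) (x₀ : M) (x y : E) : ℝ :=
  F ⟨(extChartAt 𝓘(ℝ, E) x₀).symm x, mfderiv 𝓘(ℝ, E) 𝓘(ℝ, E) (extChartAt 𝓘(ℝ, E) x₀).symm x y⟩

/-- The Euler–Lagrange equations `d/dt (∂F/∂yⁱ) = ∂F/∂xⁱ` for the curve `γ` at every time in `J`,
in every preferred chart of `M`. -/
def SatisfiesEulerLagrange (F : TangentBundle 𝓘(ℝ, E) M → ℝ) (J : Set ℝ) (γ : ℝ → M) : Prop :=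
  ∀ t ∈ J, ∀ x₀ : M, γ t ∈ (extChartAt 𝓘(ℝ, E) x₀).source →
    let c : ℝ → E := fun s => extChartAt 𝓘(ℝ, E) x₀ (γ s)
    ∀ u : E, HasDerivAt (fun s => fderiv ℝ (fun y => inCoords F x₀ (c s) y) (deriv c s) u)
      (fderiv ℝ (fun x => inCoords F x₀ x (deriv c t)) (c t) u) t

/-- The spray `Γ` over `U` is a geodesic spray of `F`: its geodesics in `U` satisfy the
Euler–Lagrange equations of `F`. -/
def IsGeodesicSpray (U : Set M) (F : TangentBundle 𝓘(ℝ, E) M → ℝ) (Γ : FieldOnTM E M) : Prop :=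
  IsSpray U Γ ∧ ∀ (J : Set ℝ) (γ : ℝ → M), IsGeodesic U Γ J γ → SatisfiesEulerLagrange F J γ

/-- Over `U`, the projective class of `Γ` is the geodesic class of `F`: the sprays over `U`
that are projectively equivalent to `Γ` are exactly the geodesic sprays of `F`. -/
def IsGeodesicClass (U : Set M) (F : TangentBundle 𝓘(ℝ, E) M → ℝ) (Γ : FieldOnTM E M) : Prop :=
  ∀ Γ' : FieldOnTM E M, IsSpray U Γ' →
    (ProjectivelyEquivalent U Γ Γ' ↔ IsGeodesicSpray U F Γ')

/-- The projective class of the spray `Γ` is the geodesic class of a local Finsler function: there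
is a family of Finsler functions, each given over an open neighbourhood of a point of `M` and having
the projective class, restricted to that neighbourhood, for its geodesic class; on
overlaps the members of the family have the same Hilbert 2-form (equivalently, they
differ locally by a total derivative `yⁱ ∂f/∂xⁱ`). -/
def IsGeodesicClassOfLocalFinsler (Γ : FieldOnTM E M) : Prop :=
  ∃ (U : M → Set M) (F : M → TangentBundle 𝓘(ℝ, E) M → ℝ),
    (∀ x, IsOpen (U x) ∧ x ∈ U x ∧ IsFinsler (U x) (F x) ∧ IsGeodesicClass (U x) (F x) Γ) ∧
    ∀ x x' : M, ∀ p ∈ slit E (U x ∩ U x'), extD (hilbertForm (F x)) p = extD (hilbertForm (F x')) p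

/-! ## Path space -/

/-- The distribution `𝒟`, spanned by `Δ` and the spray `Γ`. -/
def distD (Γ : FieldOnTM E M) (p : TangentBundle 𝓘(ℝ, E) M) :
    Submodule ℝ (TangentSpace 𝓘(ℝ, E).tangent p) :=
  Submodule.span ℝ {liouville E M p, Γ p}

/-- `p` and `q` lie on the same leaf of `𝒟`: a smooth curve in the slit tangent bundle, everywhere
tangent to `𝒟`, joins `p` to `q`. -/
def SameLeaf (Γ : FieldOnTM E M) (p q : TangentBundle 𝓘(ℝ, E) M) : Prop :=
  ∃ c : ℝ → TangentBundle 𝓘(ℝ, E) M, ContMDiff 𝓘(ℝ, ℝ) 𝓘(ℝ, E).tangent ∞ c ∧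
    (∀ t, c t ∈ slit E univ) ∧
    (∀ t, mfderiv 𝓘(ℝ, ℝ) 𝓘(ℝ, E).tangent c t (1 : ℝ) ∈ distD Γ (c t)) ∧ c 0 = p ∧ c 1 = q

variable {E' : Type*} [NormedAddCommGroup E'] [NormedSpace ℝ E']
  {P : Type*} [TopologicalSpace P] [ChartedSpace E' P]

/-- The differential `π_*` at `p`. -/
def dπ (π : TangentBundle 𝓘(ℝ, E) M → P) (p : TangentBundle 𝓘(ℝ, E) M) :
    TangentSpace 𝓘(ℝ, E).tangent p →L[ℝ] TangentSpace 𝓘(ℝ, E') (π p) :=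
  mfderiv 𝓘(ℝ, E).tangent 𝓘(ℝ, E') π p

variable (E') in
/-- The manifold `P`, with the projection `π`, is the path space of the projective class of `Γ`:
`π` restricts to a smooth surjective submersion of the slit tangent bundle onto `P` whose fibres
are the leaves of `𝒟`. (Values of `π` on the zero section are irrelevant. As `𝒟` has rank two, the
dimension of `P` is `2 dim M - 2`.) -/
structure IsPathSpace (Γ : FieldOnTM E M) (π : TangentBundle 𝓘(ℝ, E) M → P) : Prop where
  smooth : ContMDiffOn 𝓘(ℝ, E).tangent 𝓘(ℝ, E') ∞ π (slit E univ)
  surjective : SurjOn π (slit E univ) univ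
  submersion : ∀ p ∈ slit E (univ : Set M), Function.Surjective (dπ (E' := E') π p)
  ker_eq : ∀ p ∈ slit E (univ : Set M),
    LinearMap.ker (dπ (E' := E') π p).toLinearMap = distD Γ p
  fibre_eq_leaf : ∀ p ∈ slit E (univ : Set M), ∀ q ∈ slit E (univ : Set M),
    π p = π q ↔ SameLeaf Γ p q

/-- The tangent space at `π(p)`, `p = (x, y)`, to the submanifold `x̂ = π(T°_xM)` of `P` (to the
branch of it through `p`): the image under `π_*` of the vertical subspace `ker τ_*` at `p`. -/
def tangentHat (π : TangentBundle 𝓘(ℝ, E) M → P) (p : TangentBundle 𝓘(ℝ, E) M) :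
    Submodule ℝ (TangentSpace 𝓘(ℝ, E') (π p)) :=
  (LinearMap.ker (dτ p).toLinearMap).map (dπ (E' := E') π p).toLinearMap

/-- The submanifold `x̂` is Lagrangian for `Ω`: each of its tangent spaces coincides with
its `Ω`-orthogonal complement. -/
def IsLagrangianHat (π : TangentBundle 𝓘(ℝ, E) M → P) (Ω : FormField 𝓘(ℝ, E') P 2) (x : M) : Prop :=
  ∀ p ∈ slit E {x}, ∀ ξ : TangentSpace 𝓘(ℝ, E') (π p),
    ξ ∈ tangentHat (E' := E') π p ↔ ∀ η ∈ tangentHat (E' := E') π p, Ω (π p) ![ξ, η] = 0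

/-! ## Jacobi fields -/

/-- The expression of the vector field `Γ` in the coordinates of `TM` induced by the preferred
chart of `M` at the base point of `p₀`. -/
def fieldInCoords (Γ : FieldOnTM E M) (p₀ : TangentBundle 𝓘(ℝ, E) M) (z : E × E) : E × E :=
  mfderiv 𝓘(ℝ, E).tangent 𝓘(ℝ, E × E) (extChartAt 𝓘(ℝ, E).tangent p₀)
    ((extChartAt 𝓘(ℝ, E).tangent p₀).symm z) (Γ ((extChartAt 𝓘(ℝ, E).tangent p₀).symm z))

/-- The vector field `Z` along the integral curve `σ` of `Γ` satisfies `ℒ_Γ Z = 0` on `J`. In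
coordinates on `TM` this is the linearization `dZ/dt = DΓ(σ(t)) Z` of the equation of
integral curves. -/
def IsLieTransported (Γ : FieldOnTM E M) (J : Set ℝ) (σ : ℝ → TangentBundle 𝓘(ℝ, E) M)
    (Z : (t : ℝ) → TangentSpace 𝓘(ℝ, E).tangent (σ t)) : Prop :=
  ∀ t ∈ J,
    let Zc : ℝ → E × E := fun s =>
      mfderiv 𝓘(ℝ, E).tangent 𝓘(ℝ, E × E) (extChartAt 𝓘(ℝ, E).tangent (σ t)) (σ s) (Z s)
    HasDerivAt Zc
      (fderiv ℝ (fieldInCoords Γ (σ t)) (extChartAt 𝓘(ℝ, E).tangent (σ t) (σ t)) (Zc t)) t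

/-- The connection coefficients `Γⁱⱼ = ∂Γⁱ/∂yʲ` of the spray `yⁱ ∂/∂xⁱ - 2 Γⁱ ∂/∂yⁱ` at `p`, in the
preferred chart of `M` at the base point of `p`, applied to `u`: `Γⁱⱼ uʲ`. -/
def connCoeff (Γ : FieldOnTM E M) (p : TangentBundle 𝓘(ℝ, E) M) (u : E) : E :=
  let z := extChartAt 𝓘(ℝ, E).tangent p p
  fderiv ℝ (fun y : E => -(1 / 2 : ℝ) • (fieldInCoords Γ p (z.1, y)).2) z.2 u

/-- The dynamical covariant derivative at time `t` of a vector field `ζ` along the geodesic `τ ∘ σ`: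
`(∇ζ)ⁱ = dζⁱ/dt + Γⁱⱼ ζʲ`. -/
def covDeriv (Γ : FieldOnTM E M) (σ : ℝ → TangentBundle 𝓘(ℝ, E) M)
    (ζ : (t : ℝ) → TangentSpace 𝓘(ℝ, E) (σ t).proj) (t : ℝ) :
    TangentSpace 𝓘(ℝ, E) (σ t).proj :=
  let φ := extChartAt 𝓘(ℝ, E) (σ t).proj
  let ζc : ℝ → E := fun s => mfderiv 𝓘(ℝ, E) 𝓘(ℝ, E) φ (σ s).proj (ζ s)
  (mfderiv 𝓘(ℝ, E) 𝓘(ℝ, E) φ.symm (φ (σ t).proj) (deriv ζc t + connCoeff Γ (σ t) (ζc t)) : E)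

/-- The Jacobi field `ζ = τ_* Z` along the geodesic `τ ∘ σ` determined by a field `Z` along `σ`
with `ℒ_Γ Z = 0` has initial data `(ζ(0), ∇ζ(0)) = (v, w)`. -/
structure IsJacobiLift (Γ : FieldOnTM E M) (J : Set ℝ) (σ : ℝ → TangentBundle 𝓘(ℝ, E) M)
    (Z : (t : ℝ) → TangentSpace 𝓘(ℝ, E).tangent (σ t))
    (v w : TangentSpace 𝓘(ℝ, E) (σ 0).proj) : Prop where
  transported : IsLieTransported Γ J σ Z
  initial : dτ (σ 0) (Z 0) = v
  initialDeriv : covDeriv Γ σ (fun t => dτ (σ t) (Z t)) 0 = w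

/-- The positivity condition: for every lifted geodesic `σ = (γ, γ')` with `0` in its domain and
every `v ∈ T_{γ(0)}M`, if `ζ₁`, `ζ₂` are the Jacobi fields along `γ` with initial data `(v, 0)` and
`(0, v)` and the corresponding elements `π_* Z₁`, `π_* Z₂` of the tangent space of `P` are
non-zero, then `Ω(π_* Z₁, π_* Z₂) > 0`. -/
def IsPositiveOnJacobi (Γ : FieldOnTM E M) (π : TangentBundle 𝓘(ℝ, E) M → P)
    (Ω : FormField 𝓘(ℝ, E') P 2) : Prop :=
  ∀ (J : Set ℝ) (σ : ℝ → TangentBundle 𝓘(ℝ, E) M), IsLiftedGeodesic univ Γ J σ → (0 : ℝ) ∈ J →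
    ∀ (v : TangentSpace 𝓘(ℝ, E) (σ 0).proj)
      (Z₁ Z₂ : (t : ℝ) → TangentSpace 𝓘(ℝ, E).tangent (σ t)),
      IsJacobiLift Γ J σ Z₁ v 0 → IsJacobiLift Γ J σ Z₂ 0 v →
      dπ (E' := E') π (σ 0) (Z₁ 0) ≠ 0 → dπ (E' := E') π (σ 0) (Z₂ 0) ≠ 0 →
      0 < Ω (π (σ 0)) ![dπ (E' := E') π (σ 0) (Z₁ 0), dπ (E' := E') π (σ 0) (Z₂ 0)]

end Sprays

end PathSpace

end

/-!
The two sides of the equivalence correspond under `π^*Ω = -dθ`, where `θ` is the Hilbert form.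
Everything is done in the preferred charts, where a function `L(x, y)` has Hilbert 2-form
`(a, b) ↦ D(∂L/∂y)(a) b₁ - D(∂L/∂y)(b) a₁` (`extD_hilbertForm_apply`).

The notions which refer to curves are first turned into pointwise ones. Two sprays are projectively
equivalent exactly if one lies in the distribution `𝒟` spanned by the Liouville field and the other
(`projectivelyEquivalent_iff`), and a spray is a geodesic spray of `F` exactly if it is annihilated by
the Hilbert 2-form of `F` (`isGeodesicSpray_iff`). A Jacobi field with data `(0, v)` starts with
the vertical lift of `v`, and one with data `(v, 0)` starts with a vector over `v`, of which, as
the fibres are isotropic, only `v` matters; so positivity on Jacobi fields says that `π^*Ω` pairs any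
vector over `v` positively with the vertical lift of `v`, unless `v` is proportional to `y`
(`IsSpray.isJacobiLift_iff`, `IsPositiveOnJacobi.apply_vlift_pos`).

Given a local Finsler function, the Hilbert 2-forms of its members make up a closed 2-form on the slit
tangent bundle. It is annihilated by `𝒟`, by homogeneity and the Euler-Lagrange equations, and the
leaves of `𝒟` are connected, so it descends to path space (`exists_local_descent`,
`exists_descended_form`). The fibre Hessian of `F` is positive off the line of `y`
(`IsFinsler.fibre_hessian_pos`), which makes the descended form nondegenerate, the `x̂` Lagrangian and
the values on Jacobi fields positive.

Conversely, the pullback `β` of a symplectic form as in the theorem is, in coordinates, a closed form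
with isotropic fibres which is annihilated by `𝒟` and positive off the line of `y`
(`isFinslerTwoForm_pullBilin`). Its mixed part is, for each `x`, a closed 1-form in `y` on the
punctured fibre, hence exact (`exists_fibre_potential`). Correcting the potential by a 1-form on the
base, which is a matter of the Poincaré lemma, gives a semibasic `θ` with `dθ = -β`
(`IsFinslerTwoForm.exists_semibasic_potential`). Then `L = θ(y)` is homogeneous with fibre derivative
`θ`. It need not be positive, but it is strictly convex off the lines through the origin,
so that subtracting a constant covector from `θ` makes it positive over a neighbourhood of a given
point (`IsFinslerTwoForm.exists_lagrangian`). The assumption `dim M ≥ 3` is used for the fibre minus a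
line to be connected. Nondegeneracy of `Ω` identifies the geodesic class of `L`
(`isGeodesicClass_of_hilbertForm_eq`).
-/

set_option linter.unusedSectionVars false

noncomputable section

namespace PathSpace

lemma minSmoothness_two_le : minSmoothness ℝ 2 ≤ (∞ : WithTop ℕ∞) := by
  rw [minSmoothness_of_isRCLikeNormedField]
  exact WithTop.coe_le_coe.2 le_top

/-! ### Smooth families of alternating forms -/

section AlternatingForms

variable {X V W : Type*} [NormedAddCommGroup X] [NormedSpace ℝ X] [NormedAddCommGroup V]
  [NormedSpace ℝ V] [NormedAddCommGroup W] [NormedSpace ℝ W]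

/-- Evaluation of alternating forms on all tuples of basis vectors. -/
def evalOnBasis (k : ℕ) {ι : Type*} (b : Module.Basis ι ℝ V) :
    (V [⋀^Fin k]→L[ℝ] ℝ) →ₗ[ℝ] ((Fin k → ι) → ℝ) where
  toFun f := fun s => f (fun i => b (s i))
  map_add' _ _ := rfl
  map_smul' _ _ := rfl

lemma evalOnBasis_injective (k : ℕ) {ι : Type*} [Finite ι] (b : Module.Basis ι ℝ V) :
    Function.Injective (evalOnBasis k b) := by
  intro f g h
  have : f.toAlternatingMap = g.toAlternatingMap :=
    Module.Basis.ext_alternating b fun v _ => congrFun h v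
  exact ContinuousAlternatingMap.toAlternatingMap_injective this

instance instFiniteDimensionalForms [FiniteDimensional ℝ V] (k : ℕ) :
    FiniteDimensional ℝ (V [⋀^Fin k]→L[ℝ] ℝ) :=
  FiniteDimensional.of_injective _ (evalOnBasis_injective k (Module.finBasis ℝ V))

/-- In finite dimension smoothness of a family of forms can be tested on fixed vectors, since a form is
determined by finitely many of its values. -/
lemma contDiffAt_form_iff [FiniteDimensional ℝ V] {k : ℕ} {n : WithTop ℕ∞}
    {f : X → V [⋀^Fin k]→L[ℝ] ℝ} {x : X} :
    ContDiffAt ℝ n f x ↔ ∀ m : Fin k → V, ContDiffAt ℝ n (fun y => f y m) x := by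
  refine ⟨fun h m => ?_, fun h => ?_⟩
  · let L : (V [⋀^Fin k]→L[ℝ] ℝ) →ₗ[ℝ] ℝ :=
      { toFun := fun f => f m, map_add' := fun _ _ => rfl, map_smul' := fun _ _ => rfl }
    exact L.toContinuousLinearMap.contDiff.contDiffAt.comp x h
  · let b := Module.finBasis ℝ V
    obtain ⟨g, hg⟩ := (evalOnBasis k b).exists_leftInverse_of_injective
      (LinearMap.ker_eq_bot.2 (evalOnBasis_injective k b))
    have h1 : ContDiffAt ℝ n (fun y => evalOnBasis k b (f y)) x :=
      contDiffAt_pi.2 fun s => h _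
    have h2 := g.toContinuousLinearMap.contDiff.contDiffAt.comp x h1
    refine h2.congr_of_eventuallyEq (Filter.Eventually.of_forall fun y => ?_)
    exact (LinearMap.congr_fun hg (f y)).symm

lemma contDiffAt_pullbackForm [FiniteDimensional ℝ V] {k : ℕ} {n : WithTop ℕ∞}
    {f : X → W [⋀^Fin k]→L[ℝ] ℝ} {A : X → V →L[ℝ] W} {x : X} (hf : ContDiffAt ℝ n f x)
    (hA : ContDiffAt ℝ n A x) :
    ContDiffAt ℝ n (fun y => (f y).compContinuousLinearMap (A y)) x := by
  rw [contDiffAt_form_iff]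
  intro m
  have h1 : ContDiffAt ℝ n (fun y => (f y).toContinuousMultilinearMap) x :=
    (ContinuousAlternatingMap.toContinuousMultilinearMapLI (𝕜 := ℝ) (E := W) (F := ℝ)
      (ι := Fin k)).toContinuousLinearMap.contDiff.contDiffAt.comp x hf
  have h2 : ContDiffAt ℝ n (fun y =>
      ContinuousMultilinearMap.compContinuousLinearMapContinuousMultilinear ℝ
        (fun _ : Fin k => V) (fun _ : Fin k => W) ℝ (fun _ => A y)) x :=
    (ContinuousMultilinearMap.contDiff _).contDiffAt.comp x (contDiffAt_pi.2 fun _ => hA)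
  have h3 := h2.clm_apply h1
  exact (ContinuousMultilinearMap.apply ℝ (fun _ : Fin k => V) ℝ m).contDiff.contDiffAt.comp x h3

end AlternatingForms

/-! ### Charts and their coordinate changes -/

section Generic

variable {V : Type*} [NormedAddCommGroup V] [NormedSpace ℝ V]
  {H : Type*} [TopologicalSpace H] (I : ModelWithCorners ℝ V H)
  {N : Type*} [TopologicalSpace N] [ChartedSpace H N]

/-- The differential at `p` of the preferred chart at `q`, as an endomorphism of the model space. -/
def dchart (q p : N) : V →L[ℝ] V := mfderiv I 𝓘(ℝ, V) (extChartAt I q) p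

/-- The differential at `z` of the inverse of the preferred chart at `q`. -/
def dchartSymm (q : N) (z : V) : V →L[ℝ] V := mfderiv 𝓘(ℝ, V) I (extChartAt I q).symm z

/-- The coordinate change from the preferred chart at `q` to the preferred chart at `q'`. -/
def chartChange (q q' : N) (z : V) : V := extChartAt I q' ((extChartAt I q).symm z)

variable {I}

lemma eventually_mem_chart [I.Boundaryless] {q q' : N} {z : V} (hz : z ∈ (extChartAt I q).target)
    (hz' : (extChartAt I q).symm z ∈ (extChartAt I q').source) :
    ∀ᶠ w in 𝓝 z, w ∈ (extChartAt I q).target ∧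
      (extChartAt I q).symm w ∈ (extChartAt I q').source :=
  Filter.Eventually.and ((isOpen_extChartAt_target q).mem_nhds hz)
    ((continuousAt_extChartAt_symm'' hz).preimage_mem_nhds
      ((isOpen_extChartAt_source q').mem_nhds hz'))

variable [IsManifold I ∞ N]

lemma mdifferentiableAt_chart {q p : N} (hp : p ∈ (extChartAt I q).source) :
    MDifferentiableAt I 𝓘(ℝ, V) (extChartAt I q) p :=
  mdifferentiableAt_extChartAt (by rwa [extChartAt_source] at hp)

variable [I.Boundaryless]

lemma mdifferentiableAt_chart_symm {q : N} {z : V} (hz : z ∈ (extChartAt I q).target) :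
    MDifferentiableAt 𝓘(ℝ, V) I (extChartAt I q).symm z := by
  have := mdifferentiableWithinAt_extChartAt_symm hz
  rwa [I.range_eq_univ, mdifferentiableWithinAt_univ] at this

lemma dchart_dchartSymm {q : N} {z : V} (hz : z ∈ (extChartAt I q).target) (v : V) :
    dchart I q ((extChartAt I q).symm z) (dchartSymm I q z v) = v := by
  have := mfderiv_extChartAt_comp_mfderivWithin_extChartAt_symm hz
  rw [I.range_eq_univ, mfderivWithin_univ] at this
  exact DFunLike.congr_fun this v

lemma dchartSymm_dchart {q p : N} (hp : p ∈ (extChartAt I q).source) (v : V) :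
    dchartSymm I q (extChartAt I q p) (dchart I q p v) = v := by
  have := mfderivWithin_extChartAt_symm_comp_mfderiv_extChartAt' hp
  rw [I.range_eq_univ, mfderivWithin_univ] at this
  exact DFunLike.congr_fun this v

lemma dchart_dchartSymm' {q p : N} (hp : p ∈ (extChartAt I q).source) (v : V) :
    dchart I q p (dchartSymm I q (extChartAt I q p) v) = v := by
  have := dchart_dchartSymm ((extChartAt I q).map_source hp) v
  rwa [(extChartAt I q).left_inv hp] at this

lemma dchart_injective {q p : N} (hp : p ∈ (extChartAt I q).source) :
    Function.Injective (dchart I q p) :=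
  Function.LeftInverse.injective (dchartSymm_dchart hp)

lemma contDiffAt_chartChange {q q' : N} {z : V} (hz : z ∈ (extChartAt I q).target)
    (hz' : (extChartAt I q).symm z ∈ (extChartAt I q').source) :
    ContDiffAt ℝ ∞ (chartChange I q q') z := by
  have := contDiffWithinAt_ext_coord_change (n := ∞) (I := I) q' q (y := z) (by
    simp only [PartialEquiv.trans_source, PartialEquiv.symm_source]
    exact ⟨hz, hz'⟩)
  rw [I.range_eq_univ, contDiffWithinAt_univ] at this
  exact this

lemma fderiv_chartChange {q q' : N} {z : V} (hz : z ∈ (extChartAt I q).target)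
    (hz' : (extChartAt I q).symm z ∈ (extChartAt I q').source) :
    fderiv ℝ (chartChange I q q') z =
      (dchart I q' ((extChartAt I q).symm z)).comp (dchartSymm I q z) := by
  rw [← mfderiv_eq_fderiv]
  exact mfderiv_comp z (mdifferentiableAt_chart hz') (mdifferentiableAt_chart_symm hz)

/-! ### Exterior derivative in an arbitrary chart -/

lemma form_eq_formInChart {k : ℕ} (α : FormField I N k) {q p : N}
    (hp : p ∈ (extChartAt I q).source) (m : Fin k → V) :
    (α p : V [⋀^Fin k]→L[ℝ] ℝ) m =
      formInChart α q (extChartAt I q p) (fun i => dchart I q p (m i)) := by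
  have h : formInChart α q (extChartAt I q p) (fun i => dchart I q p (m i)) =
      (α ((extChartAt I q).symm (extChartAt I q p)) : V [⋀^Fin k]→L[ℝ] ℝ)
      (fun i => dchartSymm I q (extChartAt I q p) (dchart I q p (m i))) := rfl
  rw [h]
  simp only [dchartSymm_dchart hp]
  have h2 : ∀ p' : N, p' = p → (α p : V [⋀^Fin k]→L[ℝ] ℝ) m = (α p' : V [⋀^Fin k]→L[ℝ] ℝ) m := by
    rintro _ rfl; rfl
  exact h2 _ ((extChartAt I q).left_inv hp)

lemma formInChart_chartChange {k : ℕ} (α : FormField I N k) {q q' : N} {z : V}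
    (hz : z ∈ (extChartAt I q).target)
    (hz' : (extChartAt I q).symm z ∈ (extChartAt I q').source) :
    formInChart α q z = (formInChart α q' (chartChange I q q' z)).compContinuousLinearMap
      (fderiv ℝ (chartChange I q q') z) := by
  ext m
  have h := form_eq_formInChart α hz' (fun i => dchartSymm I q z (m i))
  rw [fderiv_chartChange hz hz']
  exact h

variable (I) in
/-- The form `α` is smooth at `p`: its expression in the preferred chart at `p` is smooth there. -/
def SmoothFormAt {k : ℕ} (α : FormField I N k) (p : N) : Prop :=
  ContDiffAt ℝ ∞ (formInChart α p) (extChartAt I p p)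

lemma contDiffAt_formInChart_of_chart [FiniteDimensional ℝ V] {k : ℕ} {α : FormField I N k}
    {q q' p : N} (hq : p ∈ (extChartAt I q).source) (hq' : p ∈ (extChartAt I q').source)
    (h : ContDiffAt ℝ ∞ (formInChart α q') (extChartAt I q' p)) :
    ContDiffAt ℝ ∞ (formInChart α q) (extChartAt I q p) := by
  have hz : extChartAt I q p ∈ (extChartAt I q).target := (extChartAt I q).map_source hq
  have hz' : (extChartAt I q).symm (extChartAt I q p) ∈ (extChartAt I q').source := by
    rwa [(extChartAt I q).left_inv hq]
  have hc := contDiffAt_chartChange hz hz'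
  have hv : chartChange I q q' (extChartAt I q p) = extChartAt I q' p := by
    rw [chartChange, (extChartAt I q).left_inv hq]
  have h1 : ContDiffAt ℝ ∞ (fun z => (formInChart α q' (chartChange I q q' z))) (extChartAt I q p) :=
    ContDiffAt.comp (g := formInChart α q') _ (by rwa [hv]) hc
  have h2 : ContDiffAt ℝ ∞ (fderiv ℝ (chartChange I q q')) (extChartAt I q p) :=
    hc.fderiv_right (by simp)
  refine (contDiffAt_pullbackForm h1 h2).congr_of_eventuallyEq ?_
  filter_upwards [eventually_mem_chart hz hz'] with w hw
  exact formInChart_chartChange α hw.1 hw.2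

lemma SmoothFormAt.contDiffAt_formInChart [FiniteDimensional ℝ V] {k : ℕ} {α : FormField I N k}
    {q p : N} (h : SmoothFormAt I α p) (hq : p ∈ (extChartAt I q).source) :
    ContDiffAt ℝ ∞ (formInChart α q) (extChartAt I q p) :=
  contDiffAt_formInChart_of_chart hq (mem_extChartAt_source p) h

lemma smoothFormAt_of_contDiffAt [FiniteDimensional ℝ V] {k : ℕ} {α : FormField I N k}
    {q p : N} (hq : p ∈ (extChartAt I q).source)
    (h : ContDiffAt ℝ ∞ (formInChart α q) (extChartAt I q p)) : SmoothFormAt I α p :=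
  contDiffAt_formInChart_of_chart (mem_extChartAt_source p) hq h

lemma isSmoothForm_iff [FiniteDimensional ℝ V] {k : ℕ} {α : FormField I N k} :
    IsSmoothForm α ↔ ∀ p, SmoothFormAt I α p := by
  refine ⟨fun h p => (h p).contDiffAt
    ((isOpen_extChartAt_target p).mem_nhds (mem_extChartAt_target p)), fun h p z hz => ?_⟩
  have := (h ((extChartAt I p).symm z)).contDiffAt_formInChart ((extChartAt I p).map_target hz)
  rw [(extChartAt I p).right_inv hz] at this
  exact this.contDiffWithinAt

/-- The exterior derivative may be computed in any preferred chart. -/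
lemma extD_eq_extDeriv {k : ℕ} {α : FormField I N k} {q p : N}
    (hq : p ∈ (extChartAt I q).source)
    (h : ContDiffAt ℝ ∞ (formInChart α q) (extChartAt I q p)) :
    (extD α p : V [⋀^Fin (k + 1)]→L[ℝ] ℝ) =
      (extDeriv (formInChart α q) (extChartAt I q p)).compContinuousLinearMap (dchart I q p) := by
  have hz : extChartAt I p p ∈ (extChartAt I p).target := mem_extChartAt_target p
  have hl : (extChartAt I p).symm (extChartAt I p p) = p :=
    (extChartAt I p).left_inv (mem_extChartAt_source p)
  have hz' : (extChartAt I p).symm (extChartAt I p p) ∈ (extChartAt I q).source := by rwa [hl]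
  have hv : chartChange I p q (extChartAt I p p) = extChartAt I q p := by
    rw [chartChange, hl]
  have h1 : formInChart α p =ᶠ[𝓝 (extChartAt I p p)] fun z =>
      (formInChart α q (chartChange I p q z)).compContinuousLinearMap
      (fderiv ℝ (chartChange I p q) z) := by
    filter_upwards [eventually_mem_chart hz hz'] with w hw
    exact formInChart_chartChange α hw.1 hw.2
  have h2 := extDeriv_pullback (f := chartChange I p q)
    (x := extChartAt I p p) (r := ∞) (hv.symm ▸ h.differentiableAt (by simp))
    (contDiffAt_chartChange hz hz') minSmoothness_two_le
  rw [hv] at h2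
  have h3 : (extD α p : V [⋀^Fin (k + 1)]→L[ℝ] ℝ) =
    (extDeriv (formInChart α p) (extChartAt I p p)).compContinuousLinearMap (dchart I p p) := rfl
  rw [h3, h1.extDeriv_eq, h2, fderiv_chartChange hz hz']
  ext m
  simp only [ContinuousAlternatingMap.compContinuousLinearMap_apply, Function.comp_def,
    ContinuousLinearMap.comp_apply, dchartSymm_dchart (mem_extChartAt_source p), hl]

lemma formInChart_extD [FiniteDimensional ℝ V] {k : ℕ} {α : FormField I N k} {q : N} {z : V}
    (hz : z ∈ (extChartAt I q).target) (h : ContDiffAt ℝ ∞ (formInChart α q) z) :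
    formInChart (extD α) q z = extDeriv (formInChart α q) z := by
  have hp := (extChartAt I q).map_target hz
  have hr := (extChartAt I q).right_inv hz
  have h1 := extD_eq_extDeriv (α := α) hp (by rwa [hr])
  rw [hr] at h1
  ext m
  refine (DFunLike.congr_fun h1 (fun i => dchartSymm I q z (m i))).trans ?_
  exact congrArg _ (funext fun i => dchart_dchartSymm hz (m i))

end Generic

/-! ### Vector fields and curves in charts -/

section Generic

lemma comp_one_smulRight {V W : Type*} [NormedAddCommGroup V] [NormedSpace ℝ V]
    [NormedAddCommGroup W] [NormedSpace ℝ W] (A : V →L[ℝ] W) (v : V) :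
    A.comp ((1 : ℝ →L[ℝ] ℝ).smulRight v) = (1 : ℝ →L[ℝ] ℝ).smulRight (A v) := by
  ext; simp

variable {V : Type*} [NormedAddCommGroup V] [NormedSpace ℝ V]
  {H : Type*} [TopologicalSpace H] (I : ModelWithCorners ℝ V H)
  {N : Type*} [TopologicalSpace N] [ChartedSpace H N]

/-- The expression of the vector field `X` in the preferred chart at `q`. -/
def coordField (X : (p : N) → TangentSpace I p) (q : N) (z : V) : V :=
  dchart I q ((extChartAt I q).symm z) (X ((extChartAt I q).symm z))

variable {I}

lemma coordField_extChartAt (X : (p : N) → TangentSpace I p) {q p : N}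
    (hp : p ∈ (extChartAt I q).source) :
    coordField I X q (extChartAt I q p) = dchart I q p (X p) := by
  rw [coordField, (extChartAt I q).left_inv hp]

variable [IsManifold I ∞ N]

lemma hasDerivAt_chart_of_hasMFDerivAt {σ : ℝ → N} {t : ℝ} {ξ : TangentSpace I (σ t)} {q : N}
    (hq : σ t ∈ (extChartAt I q).source)
    (h : HasMFDerivAt 𝓘(ℝ, ℝ) I σ t ((1 : ℝ →L[ℝ] ℝ).smulRight ξ)) :
    HasDerivAt (fun s => extChartAt I q (σ s)) (dchart I q (σ t) ξ) t := by
  have h1 := (mdifferentiableAt_chart hq).hasMFDerivAt.comp t h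
  have h2 : HasFDerivAt (fun s => extChartAt I q (σ s))
      ((1 : ℝ →L[ℝ] ℝ).smulRight (dchart I q (σ t) ξ)) t :=
    h1.hasFDerivAt.congr_fderiv (comp_one_smulRight (dchart I q (σ t)) ξ)
  simpa using h2.hasDerivAt

variable [I.Boundaryless]

lemma dchartSymm_coordField (X : (p : N) → TangentSpace I p) {q : N} {z : V}
    (hz : z ∈ (extChartAt I q).target) :
    dchartSymm I q z (coordField I X q z) = X ((extChartAt I q).symm z) := by
  have h := dchartSymm_dchart (I := I) ((extChartAt I q).map_target hz)
    (X ((extChartAt I q).symm z))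
  rwa [(extChartAt I q).right_inv hz] at h

lemma coordField_chartChange (X : (p : N) → TangentSpace I p) {q q' : N} {z : V}
    (hz : z ∈ (extChartAt I q).target)
    (hz' : (extChartAt I q).symm z ∈ (extChartAt I q').source) :
    coordField I X q' (chartChange I q q' z) =
      fderiv ℝ (chartChange I q q') z (coordField I X q z) := by
  rw [fderiv_chartChange hz hz', ContinuousLinearMap.comp_apply, dchartSymm_coordField X hz,
    chartChange, coordField_extChartAt X hz']

lemma contDiffAt_coordField {X : (p : N) → TangentSpace I p} {q p : N}
    (hp : p ∈ (extChartAt I q).source)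
    (hX : ContMDiffAt I I.tangent ∞ (fun p => (⟨p, X p⟩ : TangentBundle I N)) p) :
    ContDiffAt ℝ ∞ (coordField I X q) (extChartAt I q p) := by
  have hp' : p ∈ (chartAt H q).source := by rwa [extChartAt_source] at hp
  have h1 := ((trivializationAt V (TangentSpace I) q).contMDiffAt_section_iff (IB := I)
    (s := X) (n := ∞) hp').1 hX
  have h2 : ContMDiffAt I 𝓘(ℝ, V) ∞ (fun p => dchart I q p (X p)) p := by
    refine h1.congr_of_eventuallyEq ?_
    filter_upwards [(chartAt H q).open_source.mem_nhds hp'] with x hx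
    have := DFunLike.congr_fun
      (TangentBundle.continuousLinearMapAt_trivializationAt (I := I) hx) (X x)
    refine Eq.trans this.symm ?_
    rw [TangentBundle.continuousLinearMapAt_trivializationAt_eq_core hx]
    rfl
  have h3 : ContMDiffAt 𝓘(ℝ, V) I ∞ (extChartAt I q).symm (extChartAt I q p) := by
    have := (contMDiffOn_extChartAt_symm (I := I) (n := ∞) q)
    exact this.contMDiffAt ((isOpen_extChartAt_target q).mem_nhds ((extChartAt I q).map_source hp))
  have h4 : ContMDiffAt 𝓘(ℝ, V) 𝓘(ℝ, V) ∞ (coordField I X q) (extChartAt I q p) :=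
    ContMDiffAt.comp (extChartAt I q p) (g := fun p => dchart I q p (X p))
      (by rwa [(extChartAt I q).left_inv hp]) h3
  exact contMDiffAt_iff_contDiffAt.1 h4

lemma hasMFDerivAt_chart_symm {z : ℝ → V} {t : ℝ} {v : V} {q : N}
    (hq : z t ∈ (extChartAt I q).target) (h : HasDerivAt z v t) :
    HasMFDerivAt 𝓘(ℝ, ℝ) I (fun s => (extChartAt I q).symm (z s)) t
      ((1 : ℝ →L[ℝ] ℝ).smulRight (dchartSymm I q (z t) v : TangentSpace I ((extChartAt I q).symm (z t)))) := by
  have h1 := (mdifferentiableAt_chart_symm (I := I) hq).hasMFDerivAt.comp t h.hasFDerivAt.hasMFDerivAt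
  have h2 : (dchartSymm I q (z t)).comp ((1 : ℝ →L[ℝ] ℝ).smulRight v) =
    (1 : ℝ →L[ℝ] ℝ).smulRight (dchartSymm I q (z t) v) := comp_one_smulRight _ _
  have h3 : HasMFDerivAt 𝓘(ℝ, ℝ) I (fun s => (extChartAt I q).symm (z s)) t
    ((dchartSymm I q (z t)).comp ((1 : ℝ →L[ℝ] ℝ).smulRight v)) := h1
  exact h3.congr_mfderiv h2

/-- The linearisation `dZ/dt = DX(z) Z` of the equation `dz/dt = X(z)` has the same form in all
charts: it is preserved by the coordinate change `χ`, because second derivatives of `χ` are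
symmetric. -/
lemma hasDerivAt_linearisation_chartChange {X : V → V} {X' : V → V} {χ : V → V} {z Z : ℝ → V} {t : ℝ}
    (hχ : ContDiffAt ℝ ∞ χ (z t)) (hX : DifferentiableAt ℝ X (z t))
    (hX' : DifferentiableAt ℝ X' (χ (z t)))
    (hXX' : ∀ᶠ w in 𝓝 (z t), X' (χ w) = fderiv ℝ χ w (X w))
    (hz : HasDerivAt z (X (z t)) t) (hZ : HasDerivAt Z (fderiv ℝ X (z t) (Z t)) t) :
    HasDerivAt (fun s => fderiv ℝ χ (z s) (Z s))
      (fderiv ℝ X' (χ (z t)) (fderiv ℝ χ (z t) (Z t))) t := by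
  have hdχ : DifferentiableAt ℝ (fderiv ℝ χ) (z t) :=
    (hχ.fderiv_right (m := 1) (WithTop.coe_le_coe.2 le_top)).differentiableAt (by simp)
  have h1 := (hdχ.hasFDerivAt.comp_hasDerivAt t hz).clm_apply hZ
  have h2 : fderiv ℝ (fun w => X' (χ w)) (z t) = fderiv ℝ (fun w => fderiv ℝ χ w (X w)) (z t) :=
    Filter.EventuallyEq.fderiv_eq hXX'
  have h3 : HasFDerivAt (fun w => X' (χ w)) ((fderiv ℝ X' (χ (z t))).comp (fderiv ℝ χ (z t))) (z t) :=
    hX'.hasFDerivAt.comp (z t) (hχ.differentiableAt (by simp)).hasFDerivAt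
  have h4 := hdχ.hasFDerivAt.clm_apply hX.hasFDerivAt
  rw [h3.fderiv, h4.fderiv] at h2
  have h5 := DFunLike.congr_fun h2 (Z t)
  simp only [ContinuousLinearMap.comp_apply, add_apply,
    ContinuousLinearMap.flip_apply] at h5
  rw [h5]
  have h6 := (hχ.isSymmSndFDerivAt minSmoothness_two_le) (Z t) (X (z t))
  rw [h6]
  exact h1.congr_deriv (add_comm _ _)

end Generic

/-! ### Coordinates of the tangent bundle -/

section TangentCoordinates

variable {E : Type*} [NormedAddCommGroup E] [NormedSpace ℝ E]
  {M : Type*} [TopologicalSpace M] [ChartedSpace E M] [IsManifold 𝓘(ℝ, E) ∞ M]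

variable (E) in
/-- The preferred chart of the base manifold at `x₀`. -/
abbrev bchart (x₀ : M) : PartialEquiv M E := extChartAt 𝓘(ℝ, E) x₀

variable (E) in
/-- The chart of the tangent bundle induced by the preferred chart of the base at `x₀`. All preferred
charts of the tangent bundle are of this form. -/
abbrev tchart (x₀ : M) : PartialEquiv (TangentBundle 𝓘(ℝ, E) M) (E × E) :=
  extChartAt 𝓘(ℝ, E).tangent (⟨x₀, 0⟩ : TangentBundle 𝓘(ℝ, E) M)

variable (E) in
/-- The differential of `bchart`. -/
abbrev dbchart (x₀ x : M) : E →L[ℝ] E := dchart 𝓘(ℝ, E) x₀ x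

variable (E) in
/-- The differential of the inverse of `bchart`. -/
abbrev dbchartSymm (x₀ : M) (x : E) : E →L[ℝ] E := dchartSymm 𝓘(ℝ, E) x₀ x

/-- The differential of `tchart`. -/
abbrev dtchart (x₀ : M) (p : TangentBundle 𝓘(ℝ, E) M) : E × E →L[ℝ] E × E :=
  dchart 𝓘(ℝ, E).tangent (⟨x₀, 0⟩ : TangentBundle 𝓘(ℝ, E) M) p

variable (E) in
/-- The differential of the inverse of `tchart`. -/
abbrev dtchartSymm (x₀ : M) (z : E × E) : E × E →L[ℝ] E × E :=
  dchartSymm 𝓘(ℝ, E).tangent (⟨x₀, 0⟩ : TangentBundle 𝓘(ℝ, E) M) z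

lemma mem_tchart_source {x₀ : M} {p : TangentBundle 𝓘(ℝ, E) M} :
    p ∈ (tchart E x₀).source ↔ p.proj ∈ (bchart E x₀).source := by
  simp [tchart, bchart]

lemma mem_tchart_target {x₀ : M} {z : E × E} :
    z ∈ (tchart E x₀).target ↔ z.1 ∈ (bchart E x₀).target := by
  simp only [tchart, bchart, extChartAt, OpenPartialHomeomorph.extend, PartialEquiv.trans_target,
    mem_inter_iff, mem_preimage]
  rw [show (z ∈ (𝓘(ℝ,E).tangent).target) ↔ True by simp,
    show (z.1 ∈ (𝓘(ℝ,E)).target) ↔ True by simp]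
  simp only [true_and]
  exact TangentBundle.mem_chart_target_iff _ _

lemma tchart_apply {x₀ : M} {p : TangentBundle 𝓘(ℝ, E) M} (hp : p.proj ∈ (bchart E x₀).source) :
    tchart E x₀ p = (bchart E x₀ p.proj, dbchart E x₀ p.proj p.2) := by
  have hp' : p.proj ∈ (chartAt E x₀).source := by simpa [bchart] using hp
  have h := TangentBundle.continuousLinearMapAt_trivializationAt (I := 𝓘(ℝ, E)) hp'
  have h2 := DFunLike.congr_fun h p.2
  refine Prod.ext rfl ?_
  refine Eq.trans ?_ h2
  rw [TangentBundle.continuousLinearMapAt_trivializationAt_eq_core hp']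
  rfl

lemma tchart_symm_apply {x₀ : M} {z : E × E} (hz : z.1 ∈ (bchart E x₀).target) :
    (tchart E x₀).symm z = ⟨(bchart E x₀).symm z.1, dbchartSymm E x₀ z.1 z.2⟩ := by
  have hx : (bchart E x₀).symm z.1 ∈ (bchart E x₀).source := (bchart E x₀).map_target hz
  have : tchart E x₀ ⟨(bchart E x₀).symm z.1, dbchartSymm E x₀ z.1 z.2⟩ = z := by
    rw [tchart_apply hx]
    exact Prod.ext ((bchart E x₀).right_inv hz) (dchart_dchartSymm hz z.2)
  have h := (tchart E x₀).left_inv (mem_tchart_source.2 hx :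
    (⟨(bchart E x₀).symm z.1, dbchartSymm E x₀ z.1 z.2⟩ :
      TangentBundle 𝓘(ℝ, E) M) ∈ (tchart E x₀).source)
  exact (congrArg _ this.symm).trans h

lemma proj_tchart_symm {x₀ : M} {z : E × E} (hz : z.1 ∈ (bchart E x₀).target) :
    ((tchart E x₀).symm z).proj = (bchart E x₀).symm z.1 := by
  rw [tchart_symm_apply hz]

lemma tchart_symm_mk {x₀ : M} {p : TangentBundle 𝓘(ℝ, E) M}
    (hp : p.proj ∈ (bchart E x₀).source) :
    (tchart E x₀).symm (bchart E x₀ p.proj, dbchart E x₀ p.proj p.2) = p :=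
  (congrArg _ (tchart_apply hp).symm).trans ((tchart E x₀).left_inv (mem_tchart_source.2 hp))

lemma mdifferentiableAt_proj (p : TangentBundle 𝓘(ℝ, E) M) :
    MDifferentiableAt 𝓘(ℝ, E).tangent 𝓘(ℝ, E)
      (fun q : TangentBundle 𝓘(ℝ, E) M => q.proj) p :=
  Bundle.mdifferentiable_proj (TangentSpace 𝓘(ℝ, E)) p

/-- In the coordinates `(x, y)` the differential `τ_*` is the projection to the first factor. -/
lemma fst_dtchart {x₀ : M} {p : TangentBundle 𝓘(ℝ, E) M}
    (hp : p.proj ∈ (bchart E x₀).source) (ξ : TangentSpace 𝓘(ℝ, E).tangent p) :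
    (dtchart x₀ p ξ).1 = dbchart E x₀ p.proj (dτ p ξ) := by
  have hd := mdifferentiableAt_chart (I := 𝓘(ℝ, E).tangent) (mem_tchart_source.2 hp)
  have h1 := (ContinuousLinearMap.fst ℝ E E).hasMFDerivAt.comp p hd.hasMFDerivAt
  have h2 := mfderiv_comp p (I := 𝓘(ℝ, E).tangent) (I' := 𝓘(ℝ, E)) (I'' := 𝓘(ℝ, E))
    (g := bchart E x₀) (f := fun q : TangentBundle 𝓘(ℝ, E) M => q.proj)
    (mdifferentiableAt_chart hp) (mdifferentiableAt_proj p)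
  exact DFunLike.congr_fun (h1.mfderiv.symm.trans h2) ξ

lemma hasMFDerivAt_fibre {x₀ x : M} (hx : x ∈ (bchart E x₀).source) (y : E) :
    HasMFDerivAt 𝓘(ℝ, E) 𝓘(ℝ, E).tangent
      (fun w : E => (⟨x, w⟩ : TangentBundle 𝓘(ℝ, E) M)) y
      ((dtchartSymm E x₀ (tchart E x₀ (⟨x, y⟩ : TangentBundle 𝓘(ℝ, E) M))).comp
        ((ContinuousLinearMap.inr ℝ E E).comp (dbchart E x₀ x))) := by
  have h0 (A : E →L[ℝ] E) (x' : E) : HasFDerivAt (fun w : E => (x', A w))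
      ((ContinuousLinearMap.inr ℝ E E).comp A) y :=
    (hasFDerivAt_const x' y).prodMk A.hasFDerivAt
  have h1 : tchart E x₀ (⟨x, y⟩ : TangentBundle 𝓘(ℝ, E) M) =
    ((bchart E x₀ x : E), dbchart E x₀ x y) := tchart_apply (p := ⟨x, y⟩) hx
  have h2 := (mdifferentiableAt_chart_symm (I := 𝓘(ℝ, E).tangent)
    (q := (⟨x₀, 0⟩ : TangentBundle 𝓘(ℝ, E) M))
    ((tchart E x₀).map_source ((mem_tchart_source (p := ⟨x, y⟩)).2 hx))).hasMFDerivAt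
  rw [h1] at h2 ⊢
  have h3 := HasMFDerivAt.comp y h2 (h0 (dbchart E x₀ x) (bchart E x₀ x)).hasMFDerivAt
  refine h3.congr_of_eventuallyEq (Filter.Eventually.of_forall fun w => ?_)
  exact (tchart_symm_mk (p := ⟨x, w⟩) hx).symm

/-- In the coordinates `(x, y)` vertical lifts are the vectors with vanishing first component. -/
lemma dtchart_vlift {x₀ : M} {p : TangentBundle 𝓘(ℝ, E) M}
    (hp : p.proj ∈ (bchart E x₀).source) (v : TangentSpace 𝓘(ℝ, E) p.proj) :
    dtchart x₀ p (vlift p v) = (0, dbchart E x₀ p.proj v) := by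
  have h : vlift p v = dtchartSymm E x₀ (tchart E x₀ p) (0, dbchart E x₀ p.proj v) :=
    DFunLike.congr_fun (hasMFDerivAt_fibre hp p.2).mfderiv v
  rw [h]
  exact dchart_dchartSymm' (I := 𝓘(ℝ, E).tangent) (mem_tchart_source.2 hp) _

lemma dtchart_liouville {x₀ : M} {p : TangentBundle 𝓘(ℝ, E) M}
    (hp : p.proj ∈ (bchart E x₀).source) :
    dtchart x₀ p (liouville E M p) = (0, (tchart E x₀ p).2) := by
  rw [liouville, dtchart_vlift hp, tchart_apply hp]

lemma dbchart_ne_zero {x₀ x : M} (hx : x ∈ (bchart E x₀).source) {v : E} (hv : v ≠ 0) :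
    dbchart E x₀ x v ≠ 0 := fun h => hv (dchart_injective hx (by rw [h, map_zero]))

lemma mem_slit_iff {x₀ : M} {p : TangentBundle 𝓘(ℝ, E) M}
    (hp : p.proj ∈ (bchart E x₀).source) {U : Set M} :
    p ∈ slit E U ↔ p.proj ∈ U ∧ (tchart E x₀ p).2 ≠ 0 := by
  rw [tchart_apply hp]
  refine and_congr_right fun _ => ⟨fun h => dbchart_ne_zero hp h, fun h h0 => h ?_⟩
  show dbchart E x₀ p.proj p.2 = 0
  rw [h0]; exact map_zero _

lemma tchart_symm_mem_slit {x₀ : M} {z : E × E} (hz : z.1 ∈ (bchart E x₀).target) {U : Set M} :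
    (tchart E x₀).symm z ∈ slit E U ↔ (bchart E x₀).symm z.1 ∈ U ∧ z.2 ≠ 0 := by
  have hs := (tchart E x₀).map_target (mem_tchart_target.2 hz)
  rw [mem_slit_iff (mem_tchart_source.1 hs), (tchart E x₀).right_inv (mem_tchart_target.2 hz),
    proj_tchart_symm hz]

lemma isOpen_slit {U : Set M} (hU : IsOpen U) : IsOpen (slit E U) := by
  have hc : Continuous (fun q : TangentBundle 𝓘(ℝ, E) M => q.proj) :=
    FiberBundle.continuous_proj E (TangentSpace 𝓘(ℝ, E))
  rw [isOpen_iff_mem_nhds]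
  intro p hp
  have h0 : p.proj ∈ (bchart E p.proj).source := mem_extChartAt_source p.proj
  have hs := mem_tchart_source.2 h0
  have h1 : ContinuousAt (fun q => (tchart E p.proj q).2) p :=
    (continuousAt_extChartAt' hs).snd
  filter_upwards [h1.eventually_ne ((mem_slit_iff h0).1 hp).2,
    (hU.preimage hc).mem_nhds hp.1, (isOpen_extChartAt_source _).mem_nhds hs] with q h2 h3 h4
  exact (mem_slit_iff (mem_tchart_source.1 h4)).2 ⟨h3, h2⟩

end TangentCoordinates

/-! ### Sprays in coordinates -/

section LieBracket

variable {V : Type*} [NormedAddCommGroup V] [NormedSpace ℝ V]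
  {H : Type*} [TopologicalSpace H] {I : ModelWithCorners ℝ V H} [I.Boundaryless]
  {N : Type*} [TopologicalSpace N] [ChartedSpace H N] [IsManifold I ∞ N]

lemma mpullbackWithin_chart_symm (X : (p : N) → TangentSpace I p) {q : N} {z : V}
    (hz : z ∈ (extChartAt I q).target) :
    (VectorField.mpullbackWithin 𝓘(ℝ, V) I (extChartAt I q).symm X (range I) z : V) =
      coordField I X q z := by
  have h1 := mfderiv_extChartAt_comp_mfderivWithin_extChartAt_symm (I := I) hz
  have h2 := mfderivWithin_extChartAt_symm_comp_mfderiv_extChartAt (I := I) hz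
  rw [VectorField.mpullbackWithin_apply]
  exact DFunLike.congr_fun (ContinuousLinearMap.inverse_eq h2 h1) _

/-- The Lie bracket computed in the preferred chart. -/
lemma dchart_mlieBracket (X Y : (p : N) → TangentSpace I p) (q : N) :
    dchart I q q (VectorField.mlieBracket I X Y q) =
      fderiv ℝ (coordField I Y q) (extChartAt I q q) (coordField I X q (extChartAt I q q)) -
      fderiv ℝ (coordField I X q) (extChartAt I q q) (coordField I Y q (extChartAt I q q)) := by
  have hev (X : (p : N) → TangentSpace I p) :
      (fun z => (VectorField.mpullbackWithin 𝓘(ℝ, V) I (extChartAt I q).symm X (range I) z : V))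
        =ᶠ[𝓝 (extChartAt I q q)] coordField I X q := by
    filter_upwards [extChartAt_target_mem_nhds (I := I) q] with z hz
    exact mpullbackWithin_chart_symm X hz
  let P (X : (p : N) → TangentSpace I p) : V → V := fun z =>
    VectorField.mpullbackWithin 𝓘(ℝ, V) I (extChartAt I q).symm X (range I) z
  have h1 : (VectorField.mlieBracket I X Y q : V) =
      (dchart I q q).inverse (VectorField.lieBracketWithin ℝ (P X) (P Y)
      ((extChartAt I q).symm ⁻¹' univ ∩ range I) (extChartAt I q q)) := rfl
  have h3 : dchart I q q = ContinuousLinearMap.id ℝ V := mfderiv_extChartAt_self (I := I)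
  have hl (A A' B B' : V → V) (z : V) (hA : A =ᶠ[𝓝 z] A') (hB : B =ᶠ[𝓝 z] B') :
      VectorField.lieBracket ℝ A B z = fderiv ℝ B' z (A' z) - fderiv ℝ A' z (B' z) := by
    rw [VectorField.lieBracket, hA.fderiv_eq, hB.fderiv_eq, hA.eq_of_nhds, hB.eq_of_nhds]
  rw [preimage_univ, univ_inter, I.range_eq_univ, VectorField.lieBracketWithin_univ, h3,
    ContinuousLinearMap.inverse_id, hl _ _ _ _ _ (hev X) (hev Y)] at h1
  rw [h3]
  exact h1

end LieBracket

section SprayCoordinates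

variable {E : Type*} [NormedAddCommGroup E] [NormedSpace ℝ E]
  {M : Type*} [TopologicalSpace M] [ChartedSpace E M] [IsManifold 𝓘(ℝ, E) ∞ M]

/-- The expression of a vector field on `TM` in the coordinates `tchart x₀`. -/
abbrev tfield (Γ : FieldOnTM E M) (x₀ : M) : E × E → E × E :=
  coordField 𝓘(ℝ, E).tangent Γ (⟨x₀, 0⟩ : TangentBundle 𝓘(ℝ, E) M)

variable (E) in
/-- The coordinate domain of `T°U` in the chart `tchart x₀`. -/
def slitChart (x₀ : M) (U : Set M) : Set (E × E) :=
  {z | z.1 ∈ (bchart E x₀).target ∧ (bchart E x₀).symm z.1 ∈ U ∧ z.2 ≠ 0}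

lemma isOpen_slitChart {x₀ : M} {U : Set M} (hU : IsOpen U) : IsOpen (slitChart E x₀ U) := by
  have h1 : IsOpen ((bchart E x₀).target ∩ (bchart E x₀).symm ⁻¹' U) :=
    (continuousOn_extChartAt_symm x₀).isOpen_inter_preimage (isOpen_extChartAt_target x₀) hU
  have h2 : slitChart E x₀ U = ((bchart E x₀).target ∩ (bchart E x₀).symm ⁻¹' U) ×ˢ {y | y ≠ 0} := by
    ext z; simp [slitChart, and_assoc]
  rw [h2]
  exact h1.prod isOpen_ne

lemma tchart_mem_slitChart {x₀ : M} {U : Set M} {p : TangentBundle 𝓘(ℝ, E) M}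
    (hp : p.proj ∈ (bchart E x₀).source) (hU : p ∈ slit E U) :
    tchart E x₀ p ∈ slitChart E x₀ U := by
  have h := (mem_slit_iff hp).1 hU
  refine ⟨mem_tchart_target.1 ((tchart E x₀).map_source (mem_tchart_source.2 hp)), ?_, h.2⟩
  rw [tchart_apply hp]
  simpa only [(bchart E x₀).left_inv hp] using h.1

lemma symm_mem_slit_of_mem_slitChart {x₀ : M} {U : Set M} {z : E × E}
    (hz : z ∈ slitChart E x₀ U) : (tchart E x₀).symm z ∈ slit E U :=
  (tchart_symm_mem_slit hz.1).2 hz.2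

lemma proj_symm_mem_source {x₀ : M} {U : Set M} {z : E × E}
    (hz : z ∈ slitChart E x₀ U) : ((tchart E x₀).symm z).proj ∈ (bchart E x₀).source := by
  rw [proj_tchart_symm hz.1]; exact (bchart E x₀).map_target hz.1

lemma tchart_symm_right {x₀ : M} {U : Set M} {z : E × E}
    (hz : z ∈ slitChart E x₀ U) : tchart E x₀ ((tchart E x₀).symm z) = z :=
  (tchart E x₀).right_inv (mem_tchart_target.2 hz.1)

variable {Γ : FieldOnTM E M} {U : Set M}

lemma IsSpray.mono {U' : Set M} (h : IsSpray U Γ) (hU : U' ⊆ U) : IsSpray U' Γ where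
  smooth := h.smooth.mono fun _ hp => ⟨hU hp.1, hp.2⟩
  secondOrder p hp := h.secondOrder p ⟨hU hp.1, hp.2⟩
  homogeneous p hp := h.homogeneous p ⟨hU hp.1, hp.2⟩

lemma IsSpray.contDiffAt_tfield (h : IsSpray U Γ) (hU : IsOpen U) {x₀ : M} {z : E × E}
    (hz : z ∈ slitChart E x₀ U) : ContDiffAt ℝ ∞ (tfield Γ x₀) z := by
  have hs := symm_mem_slit_of_mem_slitChart hz
  have h1 := contDiffAt_coordField (I := 𝓘(ℝ, E).tangent)
    (q := (⟨x₀, 0⟩ : TangentBundle 𝓘(ℝ, E) M)) (X := Γ)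
    (mem_tchart_source.2 (proj_symm_mem_source hz))
    (h.smooth.contMDiffAt ((isOpen_slit hU).mem_nhds hs))
  rwa [tchart_symm_right hz] at h1

lemma IsSpray.fst_dtchart (h : IsSpray U Γ) {x₀ : M} {p : TangentBundle 𝓘(ℝ, E) M}
    (hp : p ∈ slit E U) (hx : p.proj ∈ (bchart E x₀).source) :
    (dtchart x₀ p (Γ p)).1 = (tchart E x₀ p).2 := by
  rw [PathSpace.fst_dtchart hx, h.secondOrder p hp, tchart_apply hx]

lemma IsSpray.fst_tfield (h : IsSpray U Γ) {x₀ : M} {z : E × E} (hz : z ∈ slitChart E x₀ U) :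
    (tfield Γ x₀ z).1 = z.2 := by
  have := h.fst_dtchart (symm_mem_slit_of_mem_slitChart hz) (proj_symm_mem_source hz)
  rwa [tchart_symm_right hz] at this

lemma tfield_liouville {x₀ : M} {z : E × E} (hz : z.1 ∈ (bchart E x₀).target) :
    tfield (liouville E M) x₀ z = (0, z.2) := by
  have hs := (tchart E x₀).map_target (mem_tchart_target.2 hz)
  have := dtchart_liouville (mem_tchart_source.1 hs)
  rwa [(tchart E x₀).right_inv (mem_tchart_target.2 hz)] at this

lemma tfield_tchart (Γ : FieldOnTM E M) {x₀ : M} {p : TangentBundle 𝓘(ℝ, E) M}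
    (hx : p.proj ∈ (bchart E x₀).source) : tfield Γ x₀ (tchart E x₀ p) = dtchart x₀ p (Γ p) :=
  coordField_extChartAt Γ (mem_tchart_source.2 hx)

/-- The homogeneity `[Δ, Γ] = Γ` as Euler's relation for the second component of `Γ`. -/
lemma IsSpray.euler (h : IsSpray U Γ) (hU : IsOpen U) {p : TangentBundle 𝓘(ℝ, E) M}
    (hp : p ∈ slit E U) :
    (fderiv ℝ (tfield Γ p.proj) (tchart E p.proj p) (0, (tchart E p.proj p).2)).2 =
      (2 : ℝ) • (tfield Γ p.proj (tchart E p.proj p)).2 := by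
  have hx : p.proj ∈ (bchart E p.proj).source := mem_extChartAt_source p.proj
  have hz := tchart_mem_slitChart hx hp
  have h1 := dchart_mlieBracket (I := 𝓘(ℝ, E).tangent) (liouville E M) Γ p
  rw [h.homogeneous p hp] at h1
  have h2 : dtchart p.proj p (Γ p) =
      fderiv ℝ (tfield Γ p.proj) (tchart E p.proj p)
        (tfield (liouville E M) p.proj (tchart E p.proj p)) -
      fderiv ℝ (tfield (liouville E M) p.proj) (tchart E p.proj p)
        (tfield Γ p.proj (tchart E p.proj p)) := h1
  have h3 : tfield (liouville E M) p.proj =ᶠ[𝓝 (tchart E p.proj p)]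
      (ContinuousLinearMap.inr ℝ E E).comp (ContinuousLinearMap.snd ℝ E E) := by
    filter_upwards [(isOpen_slitChart hU).mem_nhds hz] with w hw
    exact tfield_liouville hw.1
  rw [tfield_liouville hz.1, h3.fderiv_eq, ContinuousLinearMap.fderiv, ← tfield_tchart Γ hx] at h2
  have h4 := congrArg Prod.snd h2
  simp only [Prod.snd_sub, ContinuousLinearMap.comp_apply, ContinuousLinearMap.inr_apply,
    ContinuousLinearMap.coe_snd'] at h4
  rw [two_smul]
  exact (eq_add_of_sub_eq h4.symm)

/-- The second component of a spray is homogeneous of degree two along the fibre. -/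
lemma IsSpray.snd_homogeneous (h : IsSpray U Γ) (hU : IsOpen U) {p : TangentBundle 𝓘(ℝ, E) M}
    (hp : p ∈ slit E U) {c : ℝ} (hc : 0 < c) :
    (tfield Γ p.proj ((tchart E p.proj p).1, c • (tchart E p.proj p).2)).2 =
      c ^ 2 • (tfield Γ p.proj (tchart E p.proj p)).2 := by
  have hx : p.proj ∈ (bchart E p.proj).source := mem_extChartAt_source p.proj
  have hz := tchart_mem_slitChart hx hp
  set x := (tchart E p.proj p).1 with hxdef
  set y := (tchart E p.proj p).2 with hydef
  -- by the relation of Euler `a⁻² Γ²(x, a y)` does not depend on `a`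
  have key : ∀ a : ℝ, 0 < a → HasDerivAt (fun a : ℝ => (a ^ 2)⁻¹ • (tfield Γ p.proj (x, a • y)).2) 0 a := by
    intro a ha
    have hpa : (⟨p.proj, a • p.2⟩ : TangentBundle 𝓘(ℝ, E) M) ∈ slit E U :=
      ⟨hp.1, smul_ne_zero ha.ne' hp.2⟩
    have hta : tchart E p.proj (⟨p.proj, a • p.2⟩ : TangentBundle 𝓘(ℝ, E) M) = (x, a • y) := by
      rw [tchart_apply (p := ⟨p.proj, a • p.2⟩) hx, hxdef, hydef, tchart_apply hx]
      exact Prod.ext rfl (map_smul (dbchart E p.proj p.proj) a _)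
    have he := h.euler hU hpa
    have hm := tchart_mem_slitChart (p := ⟨p.proj, a • p.2⟩) hx hpa
    simp only [hta] at he hm
    have hd := (h.contDiffAt_tfield hU hm).differentiableAt (by simp)
    have hl : HasDerivAt (fun a : ℝ => (x, a • y)) ((0 : E), y) a := by
      have := (hasDerivAt_const a x).prodMk ((hasDerivAt_id a).smul_const y)
      simpa using this
    have h1 := hd.hasFDerivAt.snd.comp_hasDerivAt a hl
    have h2 : HasDerivAt (fun a : ℝ => (a ^ 2)⁻¹) (-(2 * a) / (a ^ 2) ^ 2) a := by
      have := (hasDerivAt_pow 2 a).fun_inv (by positivity)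
      simpa using this
    have h3 := h2.smul h1
    refine h3.congr_deriv ?_
    have h4 : (fderiv ℝ (tfield Γ p.proj) (x, a • y) (0, y)).2 =
        (2 / a) • (tfield Γ p.proj (x, a • y)).2 := by
      have : ((0 : E), a • y) = a • ((0 : E), y) := by simp
      rw [this, map_smul, Prod.smul_snd] at he
      rw [div_eq_inv_mul, mul_smul, ← he, smul_smul, inv_mul_cancel₀ ha.ne', one_smul]
    simp only [Function.comp_apply, ContinuousLinearMap.comp_apply, ContinuousLinearMap.coe_snd']
    rw [h4, smul_smul, ← add_smul]
    have : (a ^ 2)⁻¹ * (2 / a) + -(2 * a) / (a ^ 2) ^ 2 = 0 := by field_simp; ring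
    rw [this, zero_smul]
  have hconst := (isOpen_Ioi (a := (0 : ℝ))).is_const_of_deriv_eq_zero isPreconnected_Ioi
    (f := fun a : ℝ => (a ^ 2)⁻¹ • (tfield Γ p.proj (x, a • y)).2)
    (fun a ha => (key a ha).differentiableAt.differentiableWithinAt)
    (fun a ha => (key a ha).deriv) (mem_Ioi.2 hc) (mem_Ioi.2 one_pos)
  simp only [one_pow, inv_one, one_smul] at hconst
  have hxy : (x, y) = tchart E p.proj p := rfl
  rw [hxy] at hconst
  rw [← hconst, smul_smul, mul_inv_cancel₀ (by positivity), one_smul]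

end SprayCoordinates

/-! ### Semibasic one-forms -/

section Semibasic

variable {E : Type*} [NormedAddCommGroup E] [NormedSpace ℝ E]

/-- The semibasic 1-form `ϑᵢ(x, y) dxⁱ` on `E × E`. -/
def semibasic (ϑ : E × E → E →L[ℝ] ℝ) (z : E × E) : (E × E) [⋀^Fin 1]→L[ℝ] ℝ :=
  ContinuousAlternatingMap.ofSubsingleton ℝ (E × E) ℝ (0 : Fin 1)
    ((ϑ z).comp (ContinuousLinearMap.fst ℝ E E))

/-- The linear map underlying `semibasic`. -/
def semibasicL : (E →L[ℝ] ℝ) →L[ℝ] (E × E) [⋀^Fin 1]→L[ℝ] ℝ :=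
  ((ContinuousAlternatingMap.ofSubsingletonLIE (𝕜 := ℝ) (E := E × E) (F := ℝ)
    (0 : Fin 1)).toContinuousLinearEquiv : (E × E →L[ℝ] ℝ) →L[ℝ] _).comp
    ((ContinuousLinearMap.compL ℝ (E × E) E ℝ).flip (ContinuousLinearMap.fst ℝ E E))

lemma compContinuousLinearMap_pair {V W : Type*} [NormedAddCommGroup V] [NormedSpace ℝ V]
    [NormedAddCommGroup W] [NormedSpace ℝ W] (β : W [⋀^Fin 2]→L[ℝ] ℝ) (A : V →L[ℝ] W) (a b : V) :
    β.compContinuousLinearMap A ![a, b] = β ![A a, A b] := by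
  rw [ContinuousAlternatingMap.compContinuousLinearMap_apply]
  congr 1
  ext i; fin_cases i <;> rfl

lemma extDeriv_one_form_apply {V : Type*} [NormedAddCommGroup V] [NormedSpace ℝ V]
    {α : V → V [⋀^Fin 1]→L[ℝ] ℝ} {z : V} (h : DifferentiableAt ℝ α z) (a b : V) :
    extDeriv α z ![a, b] = fderiv ℝ (fun w => α w ![b]) z a - fderiv ℝ (fun w => α w ![a]) z b := by
  rw [extDeriv_apply h]
  have h0 : Fin.removeNth 0 ![a, b] = ![b] := by ext i; fin_cases i; rfl
  have h1 : Fin.removeNth 1 ![a, b] = ![a] := by ext i; fin_cases i; rfl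
  simp [Fin.sum_univ_two, sub_eq_add_neg, h0, h1]

lemma extDeriv_semibasic {ϑ : E × E → E →L[ℝ] ℝ} {z : E × E} (h : DifferentiableAt ℝ ϑ z)
    (a b : E × E) :
    extDeriv (semibasic ϑ) z ![a, b] = fderiv ℝ ϑ z a b.1 - fderiv ℝ ϑ z b a.1 := by
  have hd : DifferentiableAt ℝ (semibasic ϑ) z := (semibasicL (E := E)).differentiableAt.comp z h
  have h1 (b : E × E) : (fun w => semibasic ϑ w ![b]) = fun w => ϑ w b.1 := rfl
  rw [extDeriv_one_form_apply hd, h1, h1]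
  have h2 (b : E × E) := (h.hasFDerivAt.clm_apply (hasFDerivAt_const b.1 z)).fderiv
  rw [h2, h2]
  simp

lemma contDiffAt_semibasic {ϑ : E × E → E →L[ℝ] ℝ} {z : E × E} (h : ContDiffAt ℝ ∞ ϑ z) :
    ContDiffAt ℝ ∞ (semibasic ϑ) z := (semibasicL (E := E)).contDiff.contDiffAt.comp z h

end Semibasic

/-! ### The Hilbert form in coordinates -/

section Hilbert

variable {E : Type*} [NormedAddCommGroup E] [NormedSpace ℝ E]
  {M : Type*} [TopologicalSpace M] [ChartedSpace E M] [IsManifold 𝓘(ℝ, E) ∞ M]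

/-- The expression of the function `F` in the coordinates `tchart x₀`. -/
def tfun (F : TangentBundle 𝓘(ℝ, E) M → ℝ) (x₀ : M) (z : E × E) : ℝ := F ((tchart E x₀).symm z)

/-- The fibre derivative `∂L/∂y` of a function `L(x, y)`. -/
def fibreDeriv (L : E × E → ℝ) (z : E × E) : E →L[ℝ] ℝ :=
  (fderiv ℝ L z).comp (ContinuousLinearMap.inr ℝ E E)

lemma contDiffAt_fibreDeriv {L : E × E → ℝ} {z : E × E} (h : ContDiffAt ℝ ∞ L z) :
    ContDiffAt ℝ ∞ (fibreDeriv L) z :=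
  (h.fderiv_right (m := ∞) (by simp)).clm_comp contDiffAt_const

lemma fibreDeriv_congr {L L' : E × E → ℝ} {z : E × E} (h : L =ᶠ[𝓝 z] L') :
    fibreDeriv L =ᶠ[𝓝 z] fibreDeriv L' :=
  h.fderiv.mono fun _ hw => by rw [fibreDeriv, fibreDeriv, hw]

lemma fderiv_fibre {L : E × E → ℝ} {z : E × E} (h : DifferentiableAt ℝ L z) :
    fderiv ℝ (fun y => L (z.1, y)) z.2 = fibreDeriv L z := by
  have h1 : HasFDerivAt (fun y : E => (z.1, y)) (ContinuousLinearMap.inr ℝ E E) z.2 :=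
    (hasFDerivAt_const z.1 z.2).prodMk (hasFDerivAt_id z.2)
  exact (HasFDerivAt.comp (g := L) z.2 h.hasFDerivAt h1).fderiv

lemma inCoords_eq_tfun (F : TangentBundle 𝓘(ℝ, E) M → ℝ) {x₀ : M} {x : E}
    (hx : x ∈ (bchart E x₀).target) (y : E) : inCoords F x₀ x y = tfun F x₀ (x, y) := by
  rw [tfun, tchart_symm_apply (z := (x, y)) hx]
  rfl

variable {F : TangentBundle 𝓘(ℝ, E) M → ℝ} {U : Set M}

lemma fibre_eq_tfun (F : TangentBundle 𝓘(ℝ, E) M → ℝ) {x₀ x : M} (hx : x ∈ (bchart E x₀).source)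
    (w : E) : F ⟨x, w⟩ = tfun F x₀ (bchart E x₀ x, dbchart E x₀ x w) := by
  rw [tfun]
  exact congrArg F (tchart_symm_mk (p := ⟨x, w⟩) hx).symm

lemma contDiffAt_tfun {z : E × E} {x₀ : M} (hU : IsOpen U)
    (hF : ContMDiffOn 𝓘(ℝ, E).tangent 𝓘(ℝ, ℝ) ∞ F (slit E U)) (hz : z ∈ slitChart E x₀ U) :
    ContDiffAt ℝ ∞ (tfun F x₀) z := by
  have hs := symm_mem_slit_of_mem_slitChart hz
  have h1 := hF.contMDiffAt ((isOpen_slit hU).mem_nhds hs)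
  have h3 : ContMDiffAt 𝓘(ℝ, E × E) 𝓘(ℝ, E).tangent ∞ (tchart E x₀).symm z :=
    (contMDiffOn_extChartAt_symm (I := 𝓘(ℝ, E).tangent) (n := ∞)
      (⟨x₀, 0⟩ : TangentBundle 𝓘(ℝ, E) M)).contMDiffAt
      ((isOpen_extChartAt_target _).mem_nhds (mem_tchart_target.2 hz.1))
  exact contMDiffAt_iff_contDiffAt.1 (h1.comp z h3)

/-- Smoothness of a function on `TM` from smoothness of its coordinate expression. -/
lemma contMDiffAt_of_tfun {p : TangentBundle 𝓘(ℝ, E) M} {x₀ : M}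
    (hx : p.proj ∈ (bchart E x₀).source) (h : ContDiffAt ℝ ∞ (tfun F x₀) (tchart E x₀ p)) :
    ContMDiffAt 𝓘(ℝ, E).tangent 𝓘(ℝ, ℝ) ∞ F p := by
  have hs := mem_tchart_source.2 hx
  have h1 : ContMDiffAt 𝓘(ℝ, E).tangent 𝓘(ℝ, E × E) ∞ (tchart E x₀) p :=
    contMDiffAt_extChartAt' (by rwa [extChartAt_source] at hs)
  have h2 := (contMDiffAt_iff_contDiffAt.2 h).comp p h1
  refine h2.congr_of_eventuallyEq ?_
  filter_upwards [(isOpen_extChartAt_source _).mem_nhds hs] with q hq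
  exact congrArg F ((tchart E x₀).left_inv hq).symm

lemma fderiv_fibre_eq {x₀ x : M} (hx : x ∈ (bchart E x₀).source) (w : E)
    (h : DifferentiableAt ℝ (tfun F x₀) (bchart E x₀ x, dbchart E x₀ x w)) (v : E) :
    fderiv ℝ (fun w : E => F ⟨x, w⟩) w v =
      fibreDeriv (tfun F x₀) (bchart E x₀ x, dbchart E x₀ x w) (dbchart E x₀ x v) := by
  have h1 : (fun w : E => F ⟨x, w⟩) = fun w => tfun F x₀ (bchart E x₀ x, dbchart E x₀ x w) :=
    funext fun w => fibre_eq_tfun F hx w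
  have h2 : HasFDerivAt (fun w : E => ((bchart E x₀ x : E), dbchart E x₀ x w))
      ((ContinuousLinearMap.inr ℝ E E).comp (dbchart E x₀ x)) w :=
    (hasFDerivAt_const _ w).prodMk (dbchart E x₀ x).hasFDerivAt
  rw [h1]
  exact DFunLike.congr_fun (HasFDerivAt.comp (g := tfun F x₀) w h.hasFDerivAt h2).fderiv v

/-- In the coordinates `(x, y)` the Hilbert form is `(∂L/∂yⁱ) dxⁱ`. -/
lemma formInChart_hilbertForm {x₀ : M} (hU : IsOpen U)
    (hF : ContMDiffOn 𝓘(ℝ, E).tangent 𝓘(ℝ, ℝ) ∞ F (slit E U)) {z : E × E}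
    (hz : z ∈ slitChart E x₀ U) :
    formInChart (hilbertForm F) (⟨x₀, 0⟩ : TangentBundle 𝓘(ℝ, E) M) z =
      semibasic (fibreDeriv (tfun F x₀)) z := by
  ext m
  have hd := (contDiffAt_tfun hU hF hz).differentiableAt (by simp)
  set p := (tchart E x₀).symm z with hpdef
  have hx : p.proj ∈ (bchart E x₀).source := proj_symm_mem_source hz
  have hp : tchart E x₀ p = z := tchart_symm_right hz
  have h1 : formInChart (hilbertForm F) (⟨x₀, 0⟩ : TangentBundle 𝓘(ℝ, E) M) z m =
    fderiv ℝ (fun w : E => F ⟨p.proj, w⟩) p.2 (dτ p (dtchartSymm E x₀ z (m 0))) := rfl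
  have h2 : semibasic (fibreDeriv (tfun F x₀)) z m = fibreDeriv (tfun F x₀) z (m 0).1 := rfl
  have h3 : dbchart E x₀ p.proj (dτ p (dtchartSymm E x₀ z (m 0))) = (m 0).1 := by
    refine (fst_dtchart hx (dtchartSymm E x₀ z (m 0))).symm.trans ?_
    exact congrArg Prod.fst (dchart_dchartSymm (I := 𝓘(ℝ, E).tangent) (mem_tchart_target.2 hz.1) (m 0))
  have h4 : (bchart E x₀ p.proj, dbchart E x₀ p.proj p.2) = z := by rw [← hp, tchart_apply hx]
  have h5 := fderiv_fibre_eq (F := F) hx p.2 (h4.symm ▸ hd) (dτ p (dtchartSymm E x₀ z (m 0)))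
  rw [h4, h3] at h5
  exact h5

lemma formInChart_hilbertForm_eventuallyEq {x₀ : M} (hU : IsOpen U)
    (hF : ContMDiffOn 𝓘(ℝ, E).tangent 𝓘(ℝ, ℝ) ∞ F (slit E U)) {z : E × E}
    (hz : z ∈ slitChart E x₀ U) :
    formInChart (hilbertForm F) (⟨x₀, 0⟩ : TangentBundle 𝓘(ℝ, E) M) =ᶠ[𝓝 z]
      semibasic (fibreDeriv (tfun F x₀)) := by
  filter_upwards [(isOpen_slitChart hU).mem_nhds hz] with w hw
  exact formInChart_hilbertForm hU hF hw

lemma contDiffAt_formInChart_hilbertForm {x₀ : M} (hU : IsOpen U)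
    (hF : ContMDiffOn 𝓘(ℝ, E).tangent 𝓘(ℝ, ℝ) ∞ F (slit E U)) {z : E × E}
    (hz : z ∈ slitChart E x₀ U) :
    ContDiffAt ℝ ∞ (formInChart (hilbertForm F) (⟨x₀, 0⟩ : TangentBundle 𝓘(ℝ, E) M)) z :=
  (contDiffAt_semibasic (contDiffAt_fibreDeriv (contDiffAt_tfun hU hF hz))).congr_of_eventuallyEq
    (formInChart_hilbertForm_eventuallyEq hU hF hz)

/-- The Hilbert 2-form in coordinates. -/
lemma extD_hilbertForm {x₀ : M} (hU : IsOpen U)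
    (hF : ContMDiffOn 𝓘(ℝ, E).tangent 𝓘(ℝ, ℝ) ∞ F (slit E U)) {p : TangentBundle 𝓘(ℝ, E) M}
    (hp : p ∈ slit E U) (hx : p.proj ∈ (bchart E x₀).source) :
    (extD (hilbertForm F) p : (E × E) [⋀^Fin 2]→L[ℝ] ℝ) =
      (extDeriv (semibasic (fibreDeriv (tfun F x₀))) (tchart E x₀ p)).compContinuousLinearMap
        (dtchart x₀ p) := by
  have hz := tchart_mem_slitChart hx hp
  have h1 := extD_eq_extDeriv (I := 𝓘(ℝ, E).tangent) (mem_tchart_source.2 hx)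
    (contDiffAt_formInChart_hilbertForm hU hF hz)
  rw [(formInChart_hilbertForm_eventuallyEq hU hF hz).extDeriv_eq] at h1
  exact h1

lemma extD_hilbertForm_apply {x₀ : M} (hU : IsOpen U)
    (hF : ContMDiffOn 𝓘(ℝ, E).tangent 𝓘(ℝ, ℝ) ∞ F (slit E U)) {p : TangentBundle 𝓘(ℝ, E) M}
    (hp : p ∈ slit E U) (hx : p.proj ∈ (bchart E x₀).source) (a b : E × E) :
    (extD (hilbertForm F) p : (E × E) [⋀^Fin 2]→L[ℝ] ℝ) ![a, b] =
      fderiv ℝ (fibreDeriv (tfun F x₀)) (tchart E x₀ p) (dtchart x₀ p a) (dtchart x₀ p b).1 -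
      fderiv ℝ (fibreDeriv (tfun F x₀)) (tchart E x₀ p) (dtchart x₀ p b) (dtchart x₀ p a).1 := by
  have hz := tchart_mem_slitChart hx hp
  refine (DFunLike.congr_fun (extD_hilbertForm hU hF hp hx) ![a, b]).trans ?_
  rw [← extDeriv_semibasic
    ((contDiffAt_fibreDeriv (contDiffAt_tfun hU hF hz)).differentiableAt (by simp))]
  exact compContinuousLinearMap_pair _ _ _ _

end Hilbert

/-! ### Homogeneous functions and their fibre Hessians -/

section Homogeneous

variable {E : Type*} [NormedAddCommGroup E] [NormedSpace ℝ E]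

lemma fderiv_fibreDeriv_symm {L : E × E → ℝ} {z : E × E} (hL : ContDiffAt ℝ ∞ L z) (u w : E) :
    fderiv ℝ (fibreDeriv L) z (0, u) w = fderiv ℝ (fibreDeriv L) z (0, w) u := by
  have hd : DifferentiableAt ℝ (fderiv ℝ L) z :=
    (hL.fderiv_right (m := 1) (WithTop.coe_le_coe.2 le_top)).differentiableAt (by simp)
  have h1 (a : E × E) (w : E) :
      fderiv ℝ (fibreDeriv L) z a w = fderiv ℝ (fderiv ℝ L) z a (0, w) := by
    have := (hd.hasFDerivAt.clm_comp (hasFDerivAt_const (ContinuousLinearMap.inr ℝ E E) z)).fderiv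
    rw [show fibreDeriv L = fun z => (fderiv ℝ L z).comp (ContinuousLinearMap.inr ℝ E E) from rfl,
      this]
    simp
  rw [h1, h1]
  exact hL.isSymmSndFDerivAt minSmoothness_two_le _ _

/-- Euler's relation for a function homogeneous of degree one on the fibres. -/
lemma fibreDeriv_self {L : E × E → ℝ} {z : E × E} (hL : DifferentiableAt ℝ L z)
    (hom : ∀ c : ℝ, 0 < c → L (z.1, c • z.2) = c * L z) : fibreDeriv L z z.2 = L z := by
  have h1 : HasDerivAt (fun c : ℝ => (z.1, c • z.2)) ((0 : E), z.2) 1 := by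
    have := (hasDerivAt_const (1 : ℝ) z.1).prodMk ((hasDerivAt_id (1 : ℝ)).smul_const z.2)
    simpa using this
  have h2 : HasDerivAt (fun c : ℝ => L (z.1, c • z.2)) (fderiv ℝ L z (0, z.2)) 1 :=
    HasFDerivAt.comp_hasDerivAt (l := L) 1 (by simpa using hL.hasFDerivAt) h1
  have h3 : HasDerivAt (fun c : ℝ => L (z.1, c • z.2)) (L z) 1 := by
    have h4 : HasDerivAt (fun c : ℝ => c * L z) (L z) 1 := by
      simpa using (hasDerivAt_id (1 : ℝ)).mul_const (L z)
    refine h4.congr_of_eventuallyEq ?_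
    filter_upwards [lt_mem_nhds (zero_lt_one' ℝ)] with c hc using hom c hc
  exact h2.unique h3

/-- The derivative of Euler's relation `(∂L/∂yⁱ) yⁱ = L`. -/
lemma fderiv_fibreDeriv_self {L : E × E → ℝ} {z : E × E} (hL : ContDiffAt ℝ ∞ L z)
    (hE : ∀ᶠ w in 𝓝 z, fibreDeriv L w w.2 = L w) (a : E × E) :
    fderiv ℝ (fibreDeriv L) z a z.2 + fibreDeriv L z a.2 = fderiv ℝ L z a := by
  have hd : DifferentiableAt ℝ (fibreDeriv L) z :=
    (contDiffAt_fibreDeriv hL).differentiableAt (by simp)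
  have h1 := (hd.hasFDerivAt.clm_apply (ContinuousLinearMap.snd ℝ E E).hasFDerivAt).fderiv
  have h2 := Filter.EventuallyEq.fderiv_eq (𝕜 := ℝ) (f₁ := fun w : E × E => fibreDeriv L w w.2)
    (f := L) hE
  rw [← h2]
  refine Eq.trans ?_ (DFunLike.congr_fun h1 a).symm
  simp [add_comm]

lemma fderiv_fibreDeriv_fibre_self {L : E × E → ℝ} {z : E × E} (hL : ContDiffAt ℝ ∞ L z)
    (hE : ∀ᶠ w in 𝓝 z, fibreDeriv L w w.2 = L w) (u : E) :
    fderiv ℝ (fibreDeriv L) z (0, u) z.2 = 0 := by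
  have h := fderiv_fibreDeriv_self hL hE (0, u)
  have h2 : fibreDeriv L z u = fderiv ℝ L z (0, u) := rfl
  simpa [h2] using h

/-- The Hessian of `L²` along the image of a linear map into the fibre. -/
lemma fibre_hessian_sq_aux {L : E × E → ℝ} {x y : E} {A : E →L[ℝ] E}
    (hL : ContDiffAt ℝ ∞ L (x, A y)) (v : E) :
    fderiv ℝ (fun w : E => fderiv ℝ (fun w' : E => L (x, A w') ^ 2) w v) y v =
      2 * fibreDeriv L (x, A y) (A v) ^ 2 +
      2 * L (x, A y) * fderiv ℝ (fibreDeriv L) (x, A y) (0, A v) (A v) := by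
  have hι (w : E) : HasFDerivAt (fun w : E => (x, A w)) ((ContinuousLinearMap.inr ℝ E E).comp A) w :=
    (hasFDerivAt_const _ w).prodMk A.hasFDerivAt
  have h1 : ∀ᶠ w in 𝓝 y, fderiv ℝ (fun w' : E => L (x, A w') ^ 2) w v =
      2 * (L (x, A w) * fibreDeriv L (x, A w) (A v)) := by
    have hc : ContinuousAt (fun w : E => (x, A w)) y := (hι y).continuousAt
    filter_upwards [hc.eventually ((hL.of_le (m := 1) (WithTop.coe_le_coe.2 le_top)).eventually
      (by simp))] with w hw
    have hd := hw.differentiableAt (by simp)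
    have h2 : HasFDerivAt (fun w' : E => L (x, A w') ^ 2) _ w :=
      (HasFDerivAt.comp (g := L) w hd.hasFDerivAt (hι w)).pow 2
    have h3 := DFunLike.congr_fun h2.fderiv v
    refine Eq.trans h3 ?_
    simp [fibreDeriv]
    ring
  rw [Filter.EventuallyEq.fderiv_eq h1]
  have hg := (((hL.differentiableAt (by simp)).hasFDerivAt.mul
    (((contDiffAt_fibreDeriv hL).differentiableAt (by simp)).hasFDerivAt.clm_apply
      (hasFDerivAt_const (A v) _))).const_mul 2)
  have h4 : HasFDerivAt (fun w : E => 2 * (L (x, A w) * fibreDeriv L (x, A w) (A v))) _ y :=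
    HasFDerivAt.comp (g := fun z => 2 * (L z * fibreDeriv L z (A v))) y hg (hι y)
  refine (DFunLike.congr_fun h4.fderiv v).trans ?_
  have h5 : fderiv ℝ L (x, A y) (0, A v) = fibreDeriv L (x, A y) (A v) := rfl
  simp [h5]
  ring

end Homogeneous

section FinslerCoordinates

variable {E : Type*} [NormedAddCommGroup E] [NormedSpace ℝ E]
  {M : Type*} [TopologicalSpace M] [ChartedSpace E M] [IsManifold 𝓘(ℝ, E) ∞ M]
  {F : TangentBundle 𝓘(ℝ, E) M → ℝ} {U : Set M}

lemma tfun_homogeneous (hom : ∀ p ∈ slit E U, ∀ c : ℝ, 0 < c → F ⟨p.proj, c • p.2⟩ = c * F p)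
    {x₀ : M} {z : E × E} (hz : z ∈ slitChart E x₀ U) {c : ℝ} (hc : 0 < c) :
    tfun F x₀ (z.1, c • z.2) = c * tfun F x₀ z := by
  have h1 := hom _ (symm_mem_slit_of_mem_slitChart hz) c hc
  rw [tfun, tfun, tchart_symm_apply (z := (z.1, c • z.2)) hz.1, ← h1, tchart_symm_apply hz.1]
  exact congrArg (fun w => F ⟨_, w⟩) (map_smul (dbchartSymm E x₀ z.1) c z.2)

lemma eventually_fibreDeriv_self (hU : IsOpen U)
    (hF : ContMDiffOn 𝓘(ℝ, E).tangent 𝓘(ℝ, ℝ) ∞ F (slit E U))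
    (hom : ∀ p ∈ slit E U, ∀ c : ℝ, 0 < c → F ⟨p.proj, c • p.2⟩ = c * F p)
    {x₀ : M} {z : E × E} (hz : z ∈ slitChart E x₀ U) :
    ∀ᶠ w in 𝓝 z, fibreDeriv (tfun F x₀) w w.2 = tfun F x₀ w := by
  filter_upwards [(isOpen_slitChart hU).mem_nhds hz] with w hw
  exact fibreDeriv_self ((contDiffAt_tfun hU hF hw).differentiableAt (by simp))
    fun c hc => tfun_homogeneous hom hw hc

/-- The fibre Hessian of `F²` in coordinates. -/
lemma fibre_hessian_sq (hU : IsOpen U)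
    (hF : ContMDiffOn 𝓘(ℝ, E).tangent 𝓘(ℝ, ℝ) ∞ F (slit E U)) {x₀ : M}
    {p : TangentBundle 𝓘(ℝ, E) M} (hp : p ∈ slit E U) (hx : p.proj ∈ (bchart E x₀).source) (v : E) :
    fderiv ℝ (fun w : E => fderiv ℝ (fun w' : E => F ⟨p.proj, w'⟩ ^ 2) w v) (p.2 : E) v =
      2 * fibreDeriv (tfun F x₀) (tchart E x₀ p) (dbchart E x₀ p.proj v) ^ 2 +
      2 * tfun F x₀ (tchart E x₀ p) * fderiv ℝ (fibreDeriv (tfun F x₀)) (tchart E x₀ p)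
        (0, dbchart E x₀ p.proj v) (dbchart E x₀ p.proj v) := by
  have hz := tchart_mem_slitChart hx hp
  have hp' : tchart E x₀ p = (bchart E x₀ p.proj, dbchart E x₀ p.proj p.2) := tchart_apply hx
  rw [hp'] at hz ⊢
  have hF1 : (fun w' : E => F ⟨p.proj, w'⟩ ^ 2) =
      fun w' => tfun F x₀ (bchart E x₀ p.proj, dbchart E x₀ p.proj w') ^ 2 :=
    funext fun w => by rw [fibre_eq_tfun F hx w]
  rw [hF1]
  exact fibre_hessian_sq_aux (A := dbchart E x₀ p.proj) (contDiffAt_tfun hU hF hz) v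

/-- The fibre Hessian of a Finsler function is positive on vectors not proportional to `y`. -/
lemma IsFinsler.fibre_hessian_pos (h : IsFinsler U F) (hU : IsOpen U) {x₀ : M} {z : E × E}
    (hz : z ∈ slitChart E x₀ U) {v : E} (hv : ∀ c : ℝ, v ≠ c • z.2) :
    0 < fderiv ℝ (fibreDeriv (tfun F x₀)) z (0, v) v := by
  have hL := contDiffAt_tfun hU h.smooth hz
  have hE := eventually_fibreDeriv_self hU h.smooth h.homogeneous hz
  have hp := symm_mem_slit_of_mem_slitChart hz
  have hx := proj_symm_mem_source hz
  have hL0 : 0 < tfun F x₀ z := h.pos _ hp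
  have hE0 : fibreDeriv (tfun F x₀) z z.2 = tfun F x₀ z := hE.self_of_nhds
  have h0 (u : E) : fderiv ℝ (fibreDeriv (tfun F x₀)) z (0, u) z.2 = 0 :=
    fderiv_fibreDeriv_fibre_self hL hE u
  -- subtracting from `v` the component along `y` kills the term `(∂L/∂yⁱ vⁱ)²`
  set c : ℝ := fibreDeriv (tfun F x₀) z v / tfun F x₀ z
  set w : E := v - c • z.2
  have hw : w ≠ 0 := sub_ne_zero.2 (hv c)
  have h1 := fibre_hessian_sq hU h.smooth hp hx (dbchartSymm E x₀ z.1 w)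
  have hxz : bchart E x₀ ((tchart E x₀).symm z).proj = z.1 := by
    rw [proj_tchart_symm hz.1]; exact (bchart E x₀).right_inv hz.1
  have h2 : dbchart E x₀ ((tchart E x₀).symm z).proj (dbchartSymm E x₀ z.1 w) = w := by
    rw [← hxz]; exact dchart_dchartSymm' hx w
  have hw' : dbchartSymm E x₀ z.1 w ≠ 0 := fun h0 => hw (by rw [← h2, h0, map_zero])
  have h3 := h.convex _ hp _ hw'
  rw [h1, h2, tchart_symm_right hz] at h3
  have h4 : fibreDeriv (tfun F x₀) z w = 0 := by
    simp only [w, c, map_sub, map_smul, hE0, smul_eq_mul]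
    field_simp
    ring
  have h5 : fderiv ℝ (fibreDeriv (tfun F x₀)) z (0, w) w =
      fderiv ℝ (fibreDeriv (tfun F x₀)) z (0, v) v := by
    rw [show w = v - c • z.2 from rfl, map_sub, map_smul, h0, fderiv_fibreDeriv_symm hL, map_sub,
      map_smul, h0]
    simp
  rw [h4, h5] at h3
  have h6 : 0 < tfun F x₀ z * fderiv ℝ (fibreDeriv (tfun F x₀)) z (0, v) v := by linarith
  exact (pos_iff_pos_of_mul_pos h6).1 hL0

/-! ### The Euler–Lagrange equations -/

lemma IsLiftedGeodesic.hasDerivAt_tchart {Γ : FieldOnTM E M} {J : Set ℝ}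
    {σ : ℝ → TangentBundle 𝓘(ℝ, E) M} (h : IsLiftedGeodesic U Γ J σ) {t : ℝ} (ht : t ∈ J) {x₀ : M}
    (hx : (σ t).proj ∈ (bchart E x₀).source) :
    HasDerivAt (fun s => tchart E x₀ (σ s)) (tfield Γ x₀ (tchart E x₀ (σ t))) t := by
  rw [tfield_tchart Γ hx]
  exact hasDerivAt_chart_of_hasMFDerivAt (I := 𝓘(ℝ, E).tangent) (mem_tchart_source.2 hx)
    ((h.integral t ht).hasMFDerivAt (h.interval.1.mem_nhds ht))

lemma IsLiftedGeodesic.continuousAt {Γ : FieldOnTM E M} {J : Set ℝ}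
    {σ : ℝ → TangentBundle 𝓘(ℝ, E) M} (h : IsLiftedGeodesic U Γ J σ) {t : ℝ} (ht : t ∈ J) :
    ContinuousAt σ t :=
  ((h.integral t ht).hasMFDerivAt (h.interval.1.mem_nhds ht)).continuousAt

lemma IsLiftedGeodesic.eventually_mem_source {Γ : FieldOnTM E M} {J : Set ℝ}
    {σ : ℝ → TangentBundle 𝓘(ℝ, E) M} (h : IsLiftedGeodesic U Γ J σ) {t : ℝ} (ht : t ∈ J) {x₀ : M}
    (hx : (σ t).proj ∈ (bchart E x₀).source) :
    ∀ᶠ s in 𝓝 t, s ∈ J ∧ (σ s).proj ∈ (bchart E x₀).source := by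
  filter_upwards [h.interval.1.mem_nhds ht, (h.continuousAt ht).preimage_mem_nhds
    ((isOpen_extChartAt_source _).mem_nhds (mem_tchart_source.2 hx))] with s h1 h2
  exact ⟨h1, mem_tchart_source.1 h2⟩

/-- In coordinates the Euler–Lagrange equations hold at a point of a geodesic of `Γ` exactly if `Γ` is in
the kernel of the Hilbert 2-form there. -/
lemma eulerLagrange_iff {Γ : FieldOnTM E M} (hU : IsOpen U) (hΓ : IsSpray U Γ)
    (hF : ContMDiffOn 𝓘(ℝ, E).tangent 𝓘(ℝ, ℝ) ∞ F (slit E U))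
    (hom : ∀ p ∈ slit E U, ∀ c : ℝ, 0 < c → F ⟨p.proj, c • p.2⟩ = c * F p)
    {J : Set ℝ} {σ : ℝ → TangentBundle 𝓘(ℝ, E) M} (h : IsLiftedGeodesic U Γ J σ) {γ : ℝ → M}
    (hγ : ∀ t ∈ J, (σ t).proj = γ t) {t : ℝ} (ht : t ∈ J) {x₀ : M}
    (hx : γ t ∈ (bchart E x₀).source) :
    (let c : ℝ → E := fun s => extChartAt 𝓘(ℝ, E) x₀ (γ s)
    ∀ u : E, HasDerivAt (fun s => fderiv ℝ (fun y => inCoords F x₀ (c s) y) (deriv c s) u)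
      (fderiv ℝ (fun x => inCoords F x₀ x (deriv c t)) (c t) u) t) ↔
    ∀ b : E × E,
      (extD (hilbertForm F) (σ t) : (E × E) [⋀^Fin 2]→L[ℝ] ℝ) ![Γ (σ t), b] = 0 := by
  rw [← hγ t ht] at hx
  extract_lets c
  set L := tfun F x₀
  set z : ℝ → E × E := fun s => tchart E x₀ (σ s)
  have hev := h.eventually_mem_source ht hx
  have hzs : ∀ s, s ∈ J ∧ (σ s).proj ∈ (bchart E x₀).source → z s ∈ slitChart E x₀ U :=
    fun s hs => tchart_mem_slitChart hs.2 (h.mem s hs.1)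
  have hz := hzs t ⟨ht, hx⟩
  have hc : ∀ s, s ∈ J ∧ (σ s).proj ∈ (bchart E x₀).source → c s = (z s).1 := fun s hs => by
    simp only [c, z]; rw [tchart_apply hs.2, ← hγ s hs.1]
  -- along a base integral curve of a spray `y = dx/dt`
  have hcd : ∀ᶠ s in 𝓝 t, deriv c s = (z s).2 := by
    filter_upwards [hev] with s hs
    have h1 := (ContinuousLinearMap.fst ℝ E E).hasFDerivAt.comp_hasDerivAt s
      (h.hasDerivAt_tchart hs.1 hs.2)
    have h2 : HasDerivAt c (tfield Γ x₀ (z s)).1 s := by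
      refine h1.congr_of_eventuallyEq ?_
      filter_upwards [h.eventually_mem_source hs.1 hs.2] with s' hs' using hc s' hs'
    rw [h2.deriv, hΓ.fst_tfield (hzs s hs)]
  have hL : ContDiffAt ℝ ∞ L (z t) := contDiffAt_tfun hU hF hz
  have hE := eventually_fibreDeriv_self hU hF hom hz
  -- the two sides of the Euler–Lagrange equations as expressions on the tangent bundle
  have hleft (u : E) : (fun s => fderiv ℝ (fun y => inCoords F x₀ (c s) y) (deriv c s) u) =ᶠ[𝓝 t]
      fun s => fibreDeriv L (z s) u := by
    filter_upwards [hev, hcd] with s hs hs'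
    have h1 : (fun y => inCoords F x₀ (c s) y) = fun y => L ((z s).1, y) := by
      funext y
      rw [hc s hs, inCoords_eq_tfun F (hzs s hs).1]
    rw [h1, hs', fderiv_fibre ((contDiffAt_tfun hU hF (hzs s hs)).differentiableAt (by simp))]
  have hright (u : E) : fderiv ℝ (fun x => inCoords F x₀ x (deriv c t)) (c t) u =
      fderiv ℝ L (z t) (u, 0) := by
    have h1 : (fun x => inCoords F x₀ x (deriv c t)) =ᶠ[𝓝 (c t)] fun x => L (x, (z t).2) := by
      rw [hc t ⟨ht, hx⟩]
      filter_upwards [(isOpen_extChartAt_target x₀).mem_nhds hz.1] with x hx'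
      rw [inCoords_eq_tfun F hx', hcd.self_of_nhds]
    have h2 : HasFDerivAt (fun x : E => (x, (z t).2)) (ContinuousLinearMap.inl ℝ E E) (z t).1 :=
      (hasFDerivAt_id _).prodMk (hasFDerivAt_const _ _)
    rw [h1.fderiv_eq, hc t ⟨ht, hx⟩]
    exact DFunLike.congr_fun (HasFDerivAt.comp (g := L) (z t).1
      (hL.differentiableAt (by simp)).hasFDerivAt h2).fderiv u
  have hderiv (u : E) : HasDerivAt (fun s => fibreDeriv L (z s) u)
      (fderiv ℝ (fibreDeriv L) (z t) (tfield Γ x₀ (z t)) u) t := by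
    have h1 := ((contDiffAt_fibreDeriv hL).differentiableAt (by simp)).hasFDerivAt.clm_apply
      (hasFDerivAt_const u (z t))
    have h2 := h1.comp_hasDerivAt t (h.hasDerivAt_tchart ht hx)
    refine h2.congr_deriv ?_
    simp [z]
  have hΓz : dtchart x₀ (σ t) (Γ (σ t)) = tfield Γ x₀ (z t) := (tfield_tchart Γ hx).symm
  -- the derivative of the Euler relation for `L` turns `i_Γ dθ` into the Euler–Lagrange expression,
  -- which depends on the first component of `b` only
  have hform (b : E × E) :
      (extD (hilbertForm F) (σ t) : (E × E) [⋀^Fin 2]→L[ℝ] ℝ) ![Γ (σ t), b] =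
      fderiv ℝ (fibreDeriv L) (z t) (tfield Γ x₀ (z t)) (dtchart x₀ (σ t) b).1 -
        fderiv ℝ L (z t) ((dtchart x₀ (σ t) b).1, 0) := by
    have h1 := extD_hilbertForm_apply hU hF (h.mem t ht) hx (Γ (σ t)) b
    rw [hΓz] at h1
    rw [h1, hΓ.fst_tfield hz]
    congr 1
    have h2 := fderiv_fibreDeriv_self hL hE (dtchart x₀ (σ t) b)
    have h3 : fibreDeriv L (z t) (dtchart x₀ (σ t) b).2 =
      fderiv ℝ L (z t) (0, (dtchart x₀ (σ t) b).2) := rfl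
    have h4 : dtchart x₀ (σ t) b =
      ((dtchart x₀ (σ t) b).1, 0) + (0, (dtchart x₀ (σ t) b).2) := by simp
    have h5 : fderiv ℝ L (z t) (dtchart x₀ (σ t) b) =
        fderiv ℝ L (z t) ((dtchart x₀ (σ t) b).1, 0) +
        fderiv ℝ L (z t) (0, (dtchart x₀ (σ t) b).2) := by rw [← map_add, ← h4]
    rw [h3, h5] at h2
    exact add_right_cancel h2
  constructor
  · intro hEL b
    have h1 := (hEL (dtchart x₀ (σ t) b).1).congr_of_eventuallyEq (hleft _).symm
    rw [hright] at h1
    rw [hform, h1.unique (hderiv _), sub_self]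
  · intro hker u
    have h1 := hker (dtchartSymm E x₀ (z t) (u, 0))
    rw [hform] at h1
    have h2 : dtchart x₀ (σ t) (dtchartSymm E x₀ (z t) (u, 0)) = (u, 0) :=
      dchart_dchartSymm' (I := 𝓘(ℝ, E).tangent) (mem_tchart_source.2 hx) _
    rw [h2] at h1
    rw [hright, ← sub_eq_zero.1 h1]
    exact (hderiv u).congr_of_eventuallyEq (hleft u)

end FinslerCoordinates

/-! ### Existence of geodesics and of Jacobi fields -/

section Flow

lemma hasDerivAt_fst {V W : Type*} [NormedAddCommGroup V] [NormedSpace ℝ V] [NormedAddCommGroup W]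
    [NormedSpace ℝ W] {f : ℝ → V × W} {f' : V × W} {t : ℝ} (h : HasDerivAt f f' t) :
    HasDerivAt (fun s => (f s).1) f'.1 t :=
  (ContinuousLinearMap.fst ℝ V W).hasFDerivAt.comp_hasDerivAt t h

lemma hasDerivAt_snd {V W : Type*} [NormedAddCommGroup V] [NormedSpace ℝ V] [NormedAddCommGroup W]
    [NormedSpace ℝ W] {f : ℝ → V × W} {f' : V × W} {t : ℝ} (h : HasDerivAt f f' t) :
    HasDerivAt (fun s => (f s).2) f'.2 t :=
  (ContinuousLinearMap.snd ℝ V W).hasFDerivAt.comp_hasDerivAt t h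

/-- Local solutions of an autonomous equation together with two solutions of its linearisation. -/
lemma exists_linearised_flow {V : Type*} [NormedAddCommGroup V] [NormedSpace ℝ V] [CompleteSpace V]
    {X : V → V} {z₀ : V} (hX : ContDiffAt ℝ ∞ X z₀) {W : Set V} (hW : W ∈ 𝓝 z₀) (b₁ b₂ : V) :
    ∃ ε > (0 : ℝ), ∃ z Z₁ Z₂ : ℝ → V, z 0 = z₀ ∧ Z₁ 0 = b₁ ∧ Z₂ 0 = b₂ ∧
      ∀ t ∈ Ioo (-ε) ε, z t ∈ W ∧ HasDerivAt z (X (z t)) t ∧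
        HasDerivAt Z₁ (fderiv ℝ X (z t) (Z₁ t)) t ∧ HasDerivAt Z₂ (fderiv ℝ X (z t) (Z₂ t)) t := by
  -- the equation and its linearisation form a single autonomous system
  let Y : V × V × V → V × V × V := fun w => (X w.1, fderiv ℝ X w.1 w.2.1, fderiv ℝ X w.1 w.2.2)
  have h1 : ContDiffAt ℝ ∞ (fun w : V × V × V => X w.1) (z₀, b₁, b₂) :=
    ContDiffAt.comp (g := X) (z₀, b₁, b₂) hX contDiffAt_fst
  have h2 : ContDiffAt ℝ ∞ (fun w : V × V × V => fderiv ℝ X w.1) (z₀, b₁, b₂) :=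
    ContDiffAt.comp (g := fderiv ℝ X) (z₀, b₁, b₂) (hX.fderiv_right (by simp)) contDiffAt_fst
  have hY : ContDiffAt ℝ 1 Y (z₀, b₁, b₂) :=
    (h1.prodMk ((h2.clm_apply contDiffAt_snd.fst).prodMk
      (h2.clm_apply contDiffAt_snd.snd))).of_le (WithTop.coe_le_coe.2 le_top)
  obtain ⟨w, hw0, ε, hε, hw⟩ :=
    hY.exists_forall_mem_closedBall_exists_eq_forall_mem_Ioo_hasDerivAt₀ 0
  have hc : ContinuousAt (fun t => (w t).1) 0 :=
    (hw 0 ⟨by linarith, by linarith⟩).continuousAt.fst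
  have hW' : ∀ᶠ t in 𝓝 (0 : ℝ), (w t).1 ∈ W := hc.preimage_mem_nhds (by rwa [hw0])
  obtain ⟨δ, hδ, hball⟩ := Metric.eventually_nhds_iff.1 hW'
  refine ⟨min ε δ, lt_min hε hδ, fun t => (w t).1, fun t => (w t).2.1, fun t => (w t).2.2,
    by simp [hw0], by simp [hw0], by simp [hw0], fun t ht => ?_⟩
  have ht1 := hw t ⟨by linarith [ht.1, min_le_left ε δ], by linarith [ht.2, min_le_left ε δ]⟩
  refine ⟨hball ?_, hasDerivAt_fst ht1, hasDerivAt_fst (hasDerivAt_snd ht1),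
    hasDerivAt_snd (hasDerivAt_snd ht1)⟩
  rw [Real.dist_eq, sub_zero, abs_lt]
  exact ⟨by linarith [ht.1, min_le_right ε δ], by linarith [ht.2, min_le_right ε δ]⟩

variable {E : Type*} [NormedAddCommGroup E] [NormedSpace ℝ E]
  {M : Type*} [TopologicalSpace M] [ChartedSpace E M] [IsManifold 𝓘(ℝ, E) ∞ M]
  {Γ : FieldOnTM E M} {U : Set M}

/-- A solution of the coordinate equations is a lifted geodesic. -/
lemma IsSpray.isLiftedGeodesic_of_coords {x₀ : M} {J : Set ℝ}
    (hJ : IsOpenInterval J) {z : ℝ → E × E} (hz : ∀ t ∈ J, z t ∈ slitChart E x₀ U)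
    (h : ∀ t ∈ J, HasDerivAt z (tfield Γ x₀ (z t)) t) :
    IsLiftedGeodesic U Γ J (fun t => (tchart E x₀).symm (z t)) where
  interval := hJ
  mem t ht := symm_mem_slit_of_mem_slitChart (hz t ht)
  integral t ht := by
    have h1 := hasMFDerivAt_chart_symm (I := 𝓘(ℝ, E).tangent)
      (q := (⟨x₀, 0⟩ : TangentBundle 𝓘(ℝ, E) M)) (mem_tchart_target.2 (hz t ht).1) (h t ht)
    have h2 : dtchartSymm E x₀ (z t) (tfield Γ x₀ (z t)) = Γ ((tchart E x₀).symm (z t)) :=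
      dchartSymm_coordField Γ (mem_tchart_target.2 (hz t ht).1)
    rw [h2] at h1
    exact h1.hasMFDerivWithinAt

/-- A solution of the linearised coordinate equations is transported by the flow. -/
lemma IsSpray.isLieTransported_of_coords (hΓ : IsSpray U Γ) (hU : IsOpen U) {x₀ : M} {J : Set ℝ}
    {z Z : ℝ → E × E} (hz : ∀ t ∈ J, z t ∈ slitChart E x₀ U)
    (h : ∀ t ∈ J, HasDerivAt z (tfield Γ x₀ (z t)) t)
    (hZ : ∀ t ∈ J, HasDerivAt Z (fderiv ℝ (tfield Γ x₀) (z t) (Z t)) t) :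
    IsLieTransported Γ J (fun t => (tchart E x₀).symm (z t))
      (fun t => dtchartSymm E x₀ (z t) (Z t)) := by
  intro t ht
  extract_lets Zc
  set q : TangentBundle 𝓘(ℝ, E) M := ⟨x₀, 0⟩
  set q' : TangentBundle 𝓘(ℝ, E) M := (tchart E x₀).symm (z t)
  have hzt := mem_tchart_target.2 (hz t ht).1
  have hs : q' ∈ (extChartAt 𝓘(ℝ, E).tangent q').source := mem_extChartAt_source q'
  have hev := eventually_mem_chart (I := 𝓘(ℝ, E).tangent) (q := q) hzt hs
  have hZc : Zc =ᶠ[𝓝 t] fun s =>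
      fderiv ℝ (chartChange 𝓘(ℝ, E).tangent q q') (z s) (Z s) := by
    filter_upwards [(h t ht).continuousAt.eventually hev] with s hs
    exact (DFunLike.congr_fun (fderiv_chartChange hs.1 hs.2) (Z s)).symm
  have hslit : q' ∈ slit E U := symm_mem_slit_of_mem_slitChart (hz t ht)
  have hz' : extChartAt 𝓘(ℝ, E).tangent q' q' ∈ slitChart E q'.proj U :=
    tchart_mem_slitChart (mem_extChartAt_source q'.proj) hslit
  have hlin := hasDerivAt_linearisation_chartChange
    (X := tfield Γ x₀) (X' := coordField 𝓘(ℝ, E).tangent Γ q')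
    (contDiffAt_chartChange hzt hs)
    ((hΓ.contDiffAt_tfield hU (hz t ht)).differentiableAt (by simp))
    ((hΓ.contDiffAt_tfield hU hz').differentiableAt (by simp))
    (by filter_upwards [hev] with w hw using coordField_chartChange Γ hw.1 hw.2)
    (h t ht) (hZ t ht)
  have h1 := hlin.congr_of_eventuallyEq hZc
  have h2 : fderiv ℝ (chartChange 𝓘(ℝ, E).tangent q q') (z t) (Z t) = Zc t :=
    hZc.self_of_nhds.symm
  refine h1.congr_deriv ?_
  rw [h2]
  rfl

/-- Through every point of `T°U` passes a geodesic carrying two fields transported by the flow with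
prescribed initial values. -/
lemma IsSpray.exists_geodesic_and_transported [CompleteSpace E] (hΓ : IsSpray U Γ) (hU : IsOpen U)
    {p : TangentBundle 𝓘(ℝ, E) M} (hp : p ∈ slit E U) (b₁ b₂ : E × E) :
    ∃ ε > (0 : ℝ), ∃ (σ : ℝ → TangentBundle 𝓘(ℝ, E) M)
      (Z₁ Z₂ : (t : ℝ) → TangentSpace 𝓘(ℝ, E).tangent (σ t)), σ 0 = p ∧
      IsLiftedGeodesic U Γ (Ioo (-ε) ε) σ ∧ IsLieTransported Γ (Ioo (-ε) ε) σ Z₁ ∧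
      IsLieTransported Γ (Ioo (-ε) ε) σ Z₂ ∧
      dtchart p.proj (σ 0) (Z₁ 0) = b₁ ∧ dtchart p.proj (σ 0) (Z₂ 0) = b₂ := by
  have hx : p.proj ∈ (bchart E p.proj).source := mem_extChartAt_source p.proj
  have hz := tchart_mem_slitChart hx hp
  obtain ⟨ε, hε, z, Z₁, Z₂, hz0, hZ1, hZ2, h⟩ := exists_linearised_flow
    (hΓ.contDiffAt_tfield hU hz) ((isOpen_slitChart hU).mem_nhds hz) b₁ b₂
  have h0 : (tchart E p.proj).symm (z 0) = p := by
    rw [hz0]; exact (tchart E p.proj).left_inv (mem_tchart_source.2 hx)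
  have hright (b : E × E) :
      dtchart p.proj ((tchart E p.proj).symm (z 0)) (dtchartSymm E p.proj (z 0) b) = b := by
    rw [hz0]
    exact dchart_dchartSymm (I := 𝓘(ℝ, E).tangent) (mem_tchart_target.2 hz.1) b
  refine ⟨ε, hε, fun t => (tchart E p.proj).symm (z t), fun t => dtchartSymm E p.proj (z t) (Z₁ t),
    fun t => dtchartSymm E p.proj (z t) (Z₂ t), h0,
    IsSpray.isLiftedGeodesic_of_coords ⟨isOpen_Ioo, ordConnected_Ioo⟩ (fun t ht => (h t ht).1)
      fun t ht => (h t ht).2.1,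
    hΓ.isLieTransported_of_coords hU (fun t ht => (h t ht).1) (fun t ht => (h t ht).2.1)
      fun t ht => (h t ht).2.2.1,
    hΓ.isLieTransported_of_coords hU (fun t ht => (h t ht).1) (fun t ht => (h t ht).2.1)
      fun t ht => (h t ht).2.2.2, ?_, ?_⟩
  · exact (hright _).trans hZ1
  · exact (hright _).trans hZ2

lemma IsSpray.exists_geodesic [CompleteSpace E] (hΓ : IsSpray U Γ) (hU : IsOpen U)
    {p : TangentBundle 𝓘(ℝ, E) M} (hp : p ∈ slit E U) :
    ∃ ε > (0 : ℝ), ∃ σ : ℝ → TangentBundle 𝓘(ℝ, E) M, σ 0 = p ∧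
      IsLiftedGeodesic U Γ (Ioo (-ε) ε) σ := by
  obtain ⟨ε, hε, σ, -, -, h0, h, -⟩ := hΓ.exists_geodesic_and_transported hU hp 0 0
  exact ⟨ε, hε, σ, h0, h⟩

/-- The initial data of a Jacobi field in the coordinates at its initial point: the first component of
the linearised equation says that `dζ/dt` is the second component of the lift. -/
lemma IsSpray.covDeriv_eq (hΓ : IsSpray U Γ) (hU : IsOpen U) {J : Set ℝ}
    {σ : ℝ → TangentBundle 𝓘(ℝ, E) M} (hσ : IsLiftedGeodesic U Γ J σ) (h0 : (0 : ℝ) ∈ J)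
    {Z : (t : ℝ) → TangentSpace 𝓘(ℝ, E).tangent (σ t)} (hZ : IsLieTransported Γ J σ Z) :
    (covDeriv Γ σ (fun t => dτ (σ t) (Z t)) 0 : E) =
      dbchartSymm E (σ 0).proj (bchart E (σ 0).proj (σ 0).proj)
        ((dtchart (σ 0).proj (σ 0) (Z 0)).2 +
          connCoeff Γ (σ 0) (dtchart (σ 0).proj (σ 0) (Z 0)).1) := by
  have hx : (σ 0).proj ∈ (bchart E (σ 0).proj).source := mem_extChartAt_source _
  have hz := tchart_mem_slitChart hx (hσ.mem 0 h0)
  have h1 : HasDerivAt (fun s => dtchart (σ 0).proj (σ s) (Z s))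
      (fderiv ℝ (tfield Γ (σ 0).proj) (tchart E (σ 0).proj (σ 0))
        (dtchart (σ 0).proj (σ 0) (Z 0))) 0 := hZ 0 h0
  have hev : (fun s => dbchart E (σ 0).proj (σ s).proj (dτ (σ s) (Z s))) =ᶠ[𝓝 0]
      fun s => (dtchart (σ 0).proj (σ s) (Z s)).1 := by
    filter_upwards [hσ.eventually_mem_source h0 hx] with s hs
    exact (PathSpace.fst_dtchart hs.2 (Z s)).symm
  have h2 := (hasDerivAt_fst h1).congr_of_eventuallyEq hev
  have h3 : (fderiv ℝ (tfield Γ (σ 0).proj) (tchart E (σ 0).proj (σ 0))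
      (dtchart (σ 0).proj (σ 0) (Z 0))).1 = (dtchart (σ 0).proj (σ 0) (Z 0)).2 := by
    have hd := ((hΓ.contDiffAt_tfield hU hz).differentiableAt (by simp)).hasFDerivAt.fst
    have h4 : (fun w => (tfield Γ (σ 0).proj w).1) =ᶠ[𝓝 (tchart E (σ 0).proj (σ 0))]
        fun w => w.2 := by
      filter_upwards [(isOpen_slitChart hU).mem_nhds hz] with w hw using hΓ.fst_tfield hw
    have h5 := hd.unique ((ContinuousLinearMap.snd ℝ E E).hasFDerivAt.congr_of_eventuallyEq h4)
    exact DFunLike.congr_fun h5 _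
  have h6 : deriv (fun s => dbchart E (σ 0).proj (σ s).proj (dτ (σ s) (Z s))) 0 =
    (dtchart (σ 0).proj (σ 0) (Z 0)).2 := by
    rw [h2.deriv]
    exact h3
  have h7 : (covDeriv Γ σ (fun t => dτ (σ t) (Z t)) 0 : E) =
      dbchartSymm E (σ 0).proj (bchart E (σ 0).proj (σ 0).proj)
        (deriv (fun s => dbchart E (σ 0).proj (σ s).proj (dτ (σ s) (Z s))) 0 +
          connCoeff Γ (σ 0) (dbchart E (σ 0).proj (σ 0).proj (dτ (σ 0) (Z 0)))) := rfl
  rw [h7, h6, PathSpace.fst_dtchart hx]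

/-- A transported field is the lift of a Jacobi field with initial data `(v, w)` exactly if its initial
value in coordinates is `(v, w - Γⱼ vʲ)`. -/
lemma IsSpray.isJacobiLift_iff (hΓ : IsSpray U Γ) (hU : IsOpen U) {J : Set ℝ}
    {σ : ℝ → TangentBundle 𝓘(ℝ, E) M} (hσ : IsLiftedGeodesic U Γ J σ) (h0 : (0 : ℝ) ∈ J)
    {Z : (t : ℝ) → TangentSpace 𝓘(ℝ, E).tangent (σ t)} {v w : TangentSpace 𝓘(ℝ, E) (σ 0).proj} :
    IsJacobiLift Γ J σ Z v w ↔ IsLieTransported Γ J σ Z ∧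
      dtchart (σ 0).proj (σ 0) (Z 0) = (dbchart E (σ 0).proj (σ 0).proj v,
        dbchart E (σ 0).proj (σ 0).proj w -
          connCoeff Γ (σ 0) (dbchart E (σ 0).proj (σ 0).proj v)) := by
  have hx : (σ 0).proj ∈ (bchart E (σ 0).proj).source := mem_extChartAt_source _
  have hinj := dchart_injective (I := 𝓘(ℝ, E)) hx
  constructor
  · intro h
    have h1 : (dtchart (σ 0).proj (σ 0) (Z 0)).1 = dbchart E (σ 0).proj (σ 0).proj v := by
      rw [PathSpace.fst_dtchart hx, h.initial]
    have h2 : (covDeriv Γ σ (fun t => dτ (σ t) (Z t)) 0 : E) = w := h.initialDeriv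
    rw [hΓ.covDeriv_eq hU hσ h0 h.transported, h1] at h2
    have h3 := congrArg (dbchart E (σ 0).proj (σ 0).proj) h2
    refine ⟨h.transported, Prod.ext h1 (eq_sub_of_add_eq ?_)⟩
    exact (dchart_dchartSymm' (I := 𝓘(ℝ, E)) hx _).symm.trans h3
  · rintro ⟨h, hZ⟩
    refine ⟨h, hinj ?_, ?_⟩
    · exact (PathSpace.fst_dtchart hx (Z 0)).symm.trans (congrArg Prod.fst hZ)
    · refine (hΓ.covDeriv_eq hU hσ h0 h).trans ?_
      rw [hZ]
      simp only [sub_add_cancel]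
      exact dchartSymm_dchart (I := 𝓘(ℝ, E)) hx w

end Flow

/-! ### Projective equivalence -/

section Reparametrization

lemma exists_primitive {J : Set ℝ} (hJ : IsOpenInterval J) {k : ℝ → ℝ} (hk : ContDiffOn ℝ ∞ k J) :
    ∃ K : ℝ → ℝ, ContDiffOn ℝ ∞ K J ∧ ∀ t ∈ J, HasDerivAt K (k t) t := by
  rcases J.eq_empty_or_nonempty with rfl | ⟨t₀, ht₀⟩
  · exact ⟨0, contDiffOn_const, by simp⟩
  have h : ∀ t ∈ J, HasDerivAt (fun u => ∫ x in t₀..u, k x) (k t) t := fun t ht =>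
    intervalIntegral.integral_hasDerivAt_right
      (hk.continuousOn.mono (hJ.2.uIcc_subset ht₀ ht)).intervalIntegrable
      (hk.continuousOn.stronglyMeasurableAtFilter hJ.1 t ht)
      (hk.continuousOn.continuousAt (hJ.1.mem_nhds ht))
  refine ⟨_, (contDiffOn_infty_iff_deriv_of_isOpen hJ.1).2
    ⟨fun t ht => (h t ht).differentiableAt.differentiableWithinAt, ?_⟩, h⟩
  exact hk.congr fun t ht => (h t ht).deriv

/-- A smooth function with positive derivative on an open interval has a smooth inverse. -/
lemma exists_smooth_inverse {J : Set ℝ} (hJ : IsOpenInterval J) {ψ ψ' : ℝ → ℝ}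
    (hψ : ContDiffOn ℝ ∞ ψ J) (hd : ∀ t ∈ J, HasDerivAt ψ (ψ' t) t) (hpos : ∀ t ∈ J, 0 < ψ' t) :
    ∃ φ : ℝ → ℝ, IsOpenInterval (ψ '' J) ∧ ContDiffOn ℝ ∞ φ (ψ '' J) ∧ φ '' (ψ '' J) = J ∧
      ∀ s ∈ ψ '' J, φ s ∈ J ∧ HasDerivAt φ (ψ' (φ s))⁻¹ s := by
  have hmono : StrictMonoOn ψ J := strictMonoOn_of_deriv_pos hJ.2.convex hψ.continuousOn
    fun t ht => by
      have ht' := interior_subset ht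
      rw [(hd t ht').deriv]; exact hpos t ht'
  have hmap : ∀ t ∈ J, Filter.map ψ (𝓝 t) = 𝓝 (ψ t) := fun t ht =>
    ((hψ.contDiffAt (hJ.1.mem_nhds ht)).hasStrictDerivAt' (hd t ht) (by simp)).map_nhds_eq
      (hpos t ht).ne'
  let e : OpenPartialHomeomorph ℝ ℝ := OpenPartialHomeomorph.ofContinuousOpenRestrict
    (hmono.injOn.toPartialEquiv ψ J) hψ.continuousOn (by
      intro u hu
      rw [isOpen_iff_mem_nhds]
      rintro _ ⟨⟨t, ht⟩, htu, rfl⟩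
      have h1 : Subtype.val '' u ∈ 𝓝 t :=
        (hJ.1.isOpenMap_subtype_val u hu).mem_nhds ⟨⟨t, ht⟩, htu, rfl⟩
      have h2 := Filter.image_mem_map (m := ψ) h1
      rw [hmap t ht, image_image] at h2
      exact h2) hJ.1
  have he : ∀ t, e t = ψ t := fun _ => rfl
  have htarget : e.target = ψ '' J := rfl
  have hmem : ∀ s ∈ ψ '' J, e.symm s ∈ J := fun s hs => e.map_target hs
  have hinv : ∀ t ∈ J, e.symm (ψ t) = t := fun t ht => e.left_inv ht
  refine ⟨e.symm, ⟨htarget ▸ e.open_target, ?_⟩, fun s hs => ?_, ?_, fun s hs => ⟨hmem s hs, ?_⟩⟩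
  · exact isPreconnected_iff_ordConnected.1
      ((isPreconnected_iff_ordConnected.2 hJ.2).image ψ hψ.continuousOn)
  · exact (e.contDiffAt_symm_deriv (hpos _ (hmem s hs)).ne' hs (hd _ (hmem s hs))
      (hψ.contDiffAt (hJ.1.mem_nhds (hmem s hs)))).contDiffWithinAt
  · ext t
    simp only [image_image, mem_image]
    exact ⟨fun ⟨r, hr, h⟩ => by rwa [← h, hinv r hr], fun ht => ⟨t, ht, hinv t ht⟩⟩
  · exact e.hasDerivAt_symm hs (hpos _ (hmem s hs)).ne' (hd _ (hmem s hs))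

end Reparametrization

section ProjectiveEquivalence

variable {E : Type*} [NormedAddCommGroup E] [NormedSpace ℝ E]
  {M : Type*} [TopologicalSpace M] [ChartedSpace E M] [IsManifold 𝓘(ℝ, E) ∞ M]
  {Γ Γ' : FieldOnTM E M} {U : Set M}

/-- If a spray `Γ'` is in the distribution spanned by `Δ` and the spray `Γ`, then `Γ' = Γ + c Δ`, with a
factor `c` which does not depend on the chart. -/
lemma exists_eq_add_smul_of_mem_distD (hΓ : IsSpray U Γ) (hΓ' : IsSpray U Γ')
    {p : TangentBundle 𝓘(ℝ, E) M} (hp : p ∈ slit E U) (h : Γ' p ∈ distD Γ p) :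
    ∃ c : ℝ, ∀ x₀ : M, p.proj ∈ (bchart E x₀).source → (dtchart x₀ p (Γ' p)).2 =
      (dtchart x₀ p (Γ p)).2 + c • (tchart E x₀ p).2 := by
  obtain ⟨a, b, hab⟩ := Submodule.mem_span_pair.1 h
  have h1 (x₀ : M) (hx : p.proj ∈ (bchart E x₀).source) :
      dtchart x₀ p (Γ' p) = a • (0, (tchart E x₀ p).2) + b • dtchart x₀ p (Γ p) := by
    rw [← dtchart_liouville hx, ← hab]
    exact (map_add (dtchart x₀ p) _ _).trans
      (congrArg₂ _ (map_smul (dtchart x₀ p) _ _) (map_smul (dtchart x₀ p) _ _))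
  have hx : p.proj ∈ (bchart E p.proj).source := mem_extChartAt_source _
  have hy : (tchart E p.proj p).2 ≠ 0 := ((mem_slit_iff hx).1 hp).2
  have h2 := congrArg Prod.fst (h1 _ hx)
  simp only [Prod.fst_add, Prod.smul_fst, smul_zero, zero_add] at h2
  rw [hΓ'.fst_dtchart hp hx, hΓ.fst_dtchart hp hx] at h2
  have hb : b = 1 := by
    have h3 : (1 - b) • (tchart E p.proj p).2 = 0 := by
      rw [sub_smul, one_smul, sub_eq_zero]; exact h2
    rcases smul_eq_zero.1 h3 with h4 | h4
    · linarith
    · exact absurd h4 hy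
  refine ⟨a, fun x₀ hx => ?_⟩
  rw [h1 _ hx, hb]
  simp [add_comm]

lemma mem_distD_of_snd_eq (hΓ : IsSpray U Γ) (hΓ' : IsSpray U Γ')
    {p : TangentBundle 𝓘(ℝ, E) M} (hp : p ∈ slit E U) {c : ℝ}
    (h : (dtchart p.proj p (Γ' p)).2 =
      (dtchart p.proj p (Γ p)).2 + c • (tchart E p.proj p).2) : Γ' p ∈ distD Γ p := by
  have hx : p.proj ∈ (bchart E p.proj).source := mem_extChartAt_source _
  refine Submodule.mem_span_pair.2 ⟨c, 1, ?_⟩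
  refine dchart_injective (I := 𝓘(ℝ, E).tangent) (mem_tchart_source.2 hx) ?_
  refine ((map_add (dtchart p.proj p) _ _).trans
      (congrArg₂ _ (map_smul (dtchart p.proj p) _ _) (map_smul (dtchart p.proj p) _ _))).trans ?_
  refine Eq.trans ?_ (show _ = dtchart p.proj p (Γ' p) from rfl)
  have h1 := dtchart_liouville (E := E) hx
  refine (congrArg (fun w => c • w + (1 : ℝ) • dtchart p.proj p (Γ p)) h1).trans ?_
  refine Prod.ext ?_ ?_
  · simp only [Prod.fst_add, Prod.smul_fst, smul_zero, zero_add, one_smul]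
    rw [hΓ'.fst_dtchart hp hx, hΓ.fst_dtchart hp hx]
  · rw [h]
    simp [add_comm]

/-- Belonging to the distribution of the other spray is a symmetric relation between sprays. -/
lemma mem_distD_symm (hΓ : IsSpray U Γ) (hΓ' : IsSpray U Γ') {p : TangentBundle 𝓘(ℝ, E) M}
    (hp : p ∈ slit E U) (h : Γ' p ∈ distD Γ p) : Γ p ∈ distD Γ' p := by
  obtain ⟨c, hc⟩ := exists_eq_add_smul_of_mem_distD hΓ hΓ' hp h
  refine mem_distD_of_snd_eq hΓ' hΓ hp (c := -c) ?_
  rw [hc _ (mem_extChartAt_source _)]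
  simp

lemma IsLiftedGeodesic.contDiffAt_tchart [CompleteSpace E] (hΓ : IsSpray U Γ) (hU : IsOpen U)
    {J : Set ℝ} {σ : ℝ → TangentBundle 𝓘(ℝ, E) M} (h : IsLiftedGeodesic U Γ J σ) {t : ℝ}
    (ht : t ∈ J) {x₀ : M} (hx : (σ t).proj ∈ (bchart E x₀).source) :
    ContDiffAt ℝ ∞ (fun s => tchart E x₀ (σ s)) t := by
  obtain ⟨δ, hδ, hb⟩ := Metric.nhds_basis_closedBall.eventually_iff.1
    (h.eventually_mem_source ht hx)
  have hsub : Icc (t - δ) (t + δ) ⊆ Metric.closedBall t δ := by rw [Real.closedBall_eq_Icc]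
  have h1 : ContDiffOn ℝ ∞ (fun s => tchart E x₀ (σ s)) (Icc (t - δ) (t + δ)) := by
    refine ODE.contDiffOn_enat_Icc_of_hasDerivWithinAt (n := ⊤) (f := fun _ => tfield Γ x₀)
      (u := slitChart E x₀ U) ?_ (fun s hs => ?_) fun s hs => ?_
    · rintro ⟨s, z⟩ ⟨-, hz⟩
      exact (ContDiffAt.comp (g := tfield Γ x₀) (s, z) (hΓ.contDiffAt_tfield hU hz)
        contDiffAt_snd).contDiffWithinAt
    · exact (h.hasDerivAt_tchart (hb (hsub hs)).1 (hb (hsub hs)).2).hasDerivWithinAt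
    · exact tchart_mem_slitChart (hb (hsub hs)).2 (h.mem s (hb (hsub hs)).1)
  exact h1.contDiffAt (Icc_mem_nhds (by linarith) (by linarith))

/-- Being a lifted geodesic can be checked in the preferred charts along the curve. -/
lemma isLiftedGeodesic_of_hasDerivAt_tchart {J : Set ℝ} (hJ : IsOpenInterval J)
    {σ : ℝ → TangentBundle 𝓘(ℝ, E) M} (hmem : ∀ t ∈ J, σ t ∈ slit E U)
    (h : ∀ t ∈ J, (∀ᶠ s in 𝓝 t, (σ s).proj ∈ (bchart E (σ t).proj).source) ∧
      HasDerivAt (fun s => tchart E (σ t).proj (σ s)) (dtchart (σ t).proj (σ t) (Γ (σ t))) t) :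
    IsLiftedGeodesic U Γ J σ where
  interval := hJ
  mem := hmem
  integral t ht := by
    obtain ⟨hev, hd⟩ := h t ht
    have hx : (σ t).proj ∈ (bchart E (σ t).proj).source := mem_extChartAt_source _
    have h1 := hasMFDerivAt_chart_symm (I := 𝓘(ℝ, E).tangent)
      (q := (⟨(σ t).proj, 0⟩ : TangentBundle 𝓘(ℝ, E) M))
      (z := fun s => tchart E (σ t).proj (σ s))
      ((tchart E (σ t).proj).map_source (mem_tchart_source.2 hx)) hd
    have h2 : σ =ᶠ[𝓝 t] fun s => (tchart E (σ t).proj).symm (tchart E (σ t).proj (σ s)) := by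
      filter_upwards [hev] with s hs
      exact ((tchart E (σ t).proj).left_inv (mem_tchart_source.2 hs)).symm
    have h3 : dtchartSymm E (σ t).proj (tchart E (σ t).proj (σ t))
        (dtchart (σ t).proj (σ t) (Γ (σ t))) = Γ (σ t) :=
      dchartSymm_dchart (I := 𝓘(ℝ, E).tangent) (mem_tchart_source.2 hx) _
    have h4 := h1.congr_of_eventuallyEq h2
    have h5 : HasMFDerivAt 𝓘(ℝ, ℝ) 𝓘(ℝ, E).tangent σ t
        ((1 : ℝ →L[ℝ] ℝ).smulRight (Γ (σ t))) :=
      (congrArg (fun w : E × E => HasMFDerivAt 𝓘(ℝ, ℝ) 𝓘(ℝ, E).tangent σ t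
        ((1 : ℝ →L[ℝ] ℝ).smulRight (w : TangentSpace 𝓘(ℝ, E).tangent (σ t)))) h3).mp h4
    exact h5.hasMFDerivWithinAt

end ProjectiveEquivalence

section ProjectiveEquivalence

variable {E : Type*} [NormedAddCommGroup E] [NormedSpace ℝ E] [CompleteSpace E]
  {M : Type*} [TopologicalSpace M] [ChartedSpace E M] [IsManifold 𝓘(ℝ, E) ∞ M]
  {Γ Γ' : FieldOnTM E M} {U : Set M}

/-- After rescaling by the square of the derivative of the parameter, the accelerations of a geodesic of
`Γ` and of its reparametrization as a geodesic of `Γ'` differ by a multiple of the velocity. -/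
lemma mem_distD_of_geodesicsReparametrize (hU : IsOpen U) (hΓ : IsSpray U Γ) (hΓ' : IsSpray U Γ')
    (h : GeodesicsReparametrize U Γ Γ') {p : TangentBundle 𝓘(ℝ, E) M} (hp : p ∈ slit E U) :
    Γ' p ∈ distD Γ p := by
  obtain ⟨ε, hε, σ, rfl, hσ⟩ := hΓ.exists_geodesic hU hp
  have hx : (σ 0).proj ∈ (bchart E (σ 0).proj).source := mem_extChartAt_source _
  obtain ⟨J', φ, hφ, hpos, himg, σ', hσ', hproj⟩ := h _ (fun t => (σ t).proj) ⟨σ, hσ, fun _ _ => rfl⟩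
  have h0 : (0 : ℝ) ∈ Ioo (-ε) ε := ⟨by linarith, hε⟩
  obtain ⟨s₀, hs₀, hφ0⟩ := himg.symm ▸ h0
  have hJ' := hσ'.interval.1
  have hφd : ∀ s ∈ J', ContDiffAt ℝ ∞ φ s := fun s hs => hφ.contDiffAt (hJ'.mem_nhds hs)
  have hx' : (σ' s₀).proj ∈ (bchart E (σ 0).proj).source := by
    rw [hproj s₀ hs₀]; simp [hφ0]
  set z : ℝ → E × E := fun t => tchart E (σ 0).proj (σ t)
  set z' : ℝ → E × E := fun s => tchart E (σ 0).proj (σ' s)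
  have hev : ∀ᶠ s in 𝓝 s₀, (s ∈ J' ∧ (σ' s).proj ∈ (bchart E (σ 0).proj).source) ∧
      φ s ∈ Ioo (-ε) ε ∧ (σ (φ s)).proj ∈ (bchart E (σ 0).proj).source := by
    refine (hσ'.eventually_mem_source hs₀ hx').and ?_
    have h1 : ∀ᶠ t in 𝓝 (φ s₀), t ∈ Ioo (-ε) ε ∧ (σ t).proj ∈ (bchart E (σ 0).proj).source := by
      rw [hφ0]
      exact hσ.eventually_mem_source h0 hx
    exact (hφd s₀ hs₀).continuousAt.eventually h1
  have h1 : ∀ᶠ s in 𝓝 s₀, (z' s).1 = (z (φ s)).1 := by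
    filter_upwards [hev] with s hs
    simp only [z, z']
    rw [tchart_apply hs.1.2, tchart_apply hs.2.2, hproj s hs.1.1]
    rfl
  -- the velocity of the reparametrised geodesic
  have h2 : ∀ᶠ s in 𝓝 s₀, (z' s).2 = deriv φ s • (z (φ s)).2 := by
    filter_upwards [hev, h1.eventually_nhds] with s hs hs1
    have a1 := hasDerivAt_fst (hσ'.hasDerivAt_tchart hs.1.1 hs.1.2)
    rw [hΓ'.fst_tfield (tchart_mem_slitChart hs.1.2 (hσ'.mem s hs.1.1))] at a1
    have a2 := (hasDerivAt_fst (hσ.hasDerivAt_tchart hs.2.1 hs.2.2)).scomp s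
      ((hφd s hs.1.1).differentiableAt (by simp)).hasDerivAt
    rw [hΓ.fst_tfield (tchart_mem_slitChart hs.2.2 (hσ.mem _ hs.2.1))] at a2
    exact a1.unique (a2.congr_of_eventuallyEq hs1)
  -- the acceleration of the reparametrised geodesic
  have hφ2 : HasDerivAt (deriv φ) (deriv (deriv φ) s₀) s₀ :=
    ((((contDiffOn_infty_iff_deriv_of_isOpen hJ').1 hφ).2.contDiffAt
      (hJ'.mem_nhds hs₀)).differentiableAt (by simp)).hasDerivAt
  have a1 := hasDerivAt_snd (hσ'.hasDerivAt_tchart hs₀ hx')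
  have a2 : HasDerivAt (fun s => (z (φ s)).2) (deriv φ s₀ • (tfield Γ (σ 0).proj (z 0)).2) s₀ := by
    have := hasDerivAt_snd (hσ.hasDerivAt_tchart h0 hx)
    rw [← hφ0] at this
    have := this.scomp s₀ ((hφd s₀ hs₀).differentiableAt (by simp)).hasDerivAt
    rw [hφ0] at this
    exact this
  have a3 := (a1.unique ((hφ2.smul a2).congr_of_eventuallyEq h2))
  -- compare with the homogeneity of `Γ'` under rescaling of the velocity
  have h3 : tchart E (σ 0).proj (σ' s₀) = ((z 0).1, deriv φ s₀ • (z 0).2) := by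
    refine Prod.ext ?_ ?_
    · exact h1.self_of_nhds.trans (by rw [hφ0])
    · exact h2.self_of_nhds.trans (by rw [hφ0])
  have hc := hpos s₀ hs₀
  have h4 := hΓ'.snd_homogeneous hU hp hc
  rw [h3] at a3
  have h5 := h4.symm.trans a3
  rw [hφ0, smul_smul, ← pow_two] at h5
  refine mem_distD_of_snd_eq hΓ hΓ' hp
    (c := ((deriv φ s₀) ^ 2)⁻¹ * deriv (deriv φ) s₀) ?_
  rw [← tfield_tchart Γ hx, ← tfield_tchart Γ' hx]
  have h6 := congrArg (fun w => ((deriv φ s₀) ^ 2)⁻¹ • w) h5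
  simp only [smul_add, smul_smul] at h6
  rw [inv_mul_cancel₀ (by positivity), one_smul, one_smul] at h6
  exact h6

/-- If `Γ' = Γ + k Δ` along a geodesic of `Γ`, then reparametrizing it by the inverse of
`∫ exp(-K)`, where `K` is a primitive of `k`, gives a geodesic of `Γ'`. -/
lemma geodesicsReparametrize_of_mem_distD (hU : IsOpen U) (hΓ : IsSpray U Γ) (hΓ' : IsSpray U Γ')
    (h : ∀ p ∈ slit E U, Γ' p ∈ distD Γ p) : GeodesicsReparametrize U Γ Γ' := by
  rintro J γ ⟨σ, hσ, hγ⟩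
  have hJ := hσ.interval.1
  have hk : ∀ t, ∃ c : ℝ, t ∈ J → ∀ x₀ : M, (σ t).proj ∈ (bchart E x₀).source →
      (dtchart x₀ (σ t) (Γ' (σ t))).2 =
        (dtchart x₀ (σ t) (Γ (σ t))).2 + c • (tchart E x₀ (σ t)).2 := fun t => by
    by_cases ht : t ∈ J
    · obtain ⟨c, hc⟩ := exists_eq_add_smul_of_mem_distD hΓ hΓ' (hσ.mem t ht) (h _ (hσ.mem t ht))
      exact ⟨c, fun _ => hc⟩
    · exact ⟨0, fun h => absurd h ht⟩
  choose k hk using hk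
  -- `k` is locally a quotient of smooth functions: pair the relation with a covector which does not
  -- vanish on the velocity
  have hks : ContDiffOn ℝ ∞ k J := by
    intro t₀ ht₀
    have hx : (σ t₀).proj ∈ (bchart E (σ t₀).proj).source := mem_extChartAt_source _
    set x₀ := (σ t₀).proj
    have hz := tchart_mem_slitChart hx (hσ.mem t₀ ht₀)
    obtain ⟨l, hl⟩ := SeparatingDual.exists_ne_zero (R := ℝ) hz.2.2
    have hzs := hσ.contDiffAt_tchart hΓ hU ht₀ hx
    have h1 := ContDiffAt.comp (g := tfield Γ x₀) t₀ (hΓ.contDiffAt_tfield hU hz) hzs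
    have h2 := ContDiffAt.comp (g := tfield Γ' x₀) t₀ (hΓ'.contDiffAt_tfield hU hz) hzs
    have h3 : ContDiffAt ℝ ∞ (fun t => l ((tfield Γ' x₀ (tchart E x₀ (σ t))).2 -
        (tfield Γ x₀ (tchart E x₀ (σ t))).2) / l (tchart E x₀ (σ t)).2) t₀ :=
      (l.contDiff.contDiffAt.comp t₀ (h2.snd.sub h1.snd)).div
        (l.contDiff.contDiffAt.comp t₀ hzs.snd) hl
    refine (h3.congr_of_eventuallyEq ?_).contDiffWithinAt
    filter_upwards [hσ.eventually_mem_source ht₀ hx,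
      (l.continuous.continuousAt.comp hzs.snd.continuousAt).eventually_ne hl] with t ht hlt
    rw [tfield_tchart Γ ht.2, tfield_tchart Γ' ht.2, hk t ht.1 x₀ ht.2, add_sub_cancel_left,
      map_smul, smul_eq_mul, mul_div_assoc]
    exact (mul_div_cancel_right₀ (k t) hlt).symm.trans (mul_div_assoc _ _ _)
  obtain ⟨K, hK, hKd⟩ := exists_primitive hσ.interval hks
  obtain ⟨ψ, hψ, hψd⟩ := exists_primitive (k := fun t => Real.exp (-K t)) hσ.interval hK.neg.exp
  obtain ⟨φ, hJ', hφ, himg, hφd⟩ := exists_smooth_inverse hσ.interval hψ hψd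
    fun t _ => Real.exp_pos _
  have hφd' : ∀ s ∈ ψ '' J, HasDerivAt φ (Real.exp (K (φ s))) s := fun s hs => by
    have := (hφd s hs).2
    rwa [← Real.exp_neg, neg_neg] at this
  refine ⟨ψ '' J, φ, hφ, fun s hs => ?_, himg, fun s =>
    ⟨(σ (φ s)).proj, Real.exp (K (φ s)) • (σ (φ s)).2⟩, ?_, fun s hs => hγ _ (hφd s hs).1⟩
  · rw [(hφd' s hs).deriv]; exact Real.exp_pos _
  refine isLiftedGeodesic_of_hasDerivAt_tchart hJ' (fun s hs => ?_) fun s hs => ?_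
  · have := hσ.mem _ (hφd s hs).1
    exact ⟨this.1, smul_ne_zero (Real.exp_pos _).ne' this.2⟩
  have hs' := (hφd s hs).1
  have hx : (σ (φ s)).proj ∈ (bchart E (σ (φ s)).proj).source := mem_extChartAt_source _
  set x₀ := (σ (φ s)).proj
  have hev : ∀ᶠ r in 𝓝 s, φ r ∈ J ∧ (σ (φ r)).proj ∈ (bchart E x₀).source :=
    (hφd' s hs).continuousAt.eventually (hσ.eventually_mem_source hs' hx)
  have hcoord : ∀ r, (σ (φ r)).proj ∈ (bchart E x₀).source →
      tchart E x₀ (⟨(σ (φ r)).proj, Real.exp (K (φ r)) • (σ (φ r)).2⟩ :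
        TangentBundle 𝓘(ℝ, E) M) =
      ((tchart E x₀ (σ (φ r))).1, Real.exp (K (φ r)) • (tchart E x₀ (σ (φ r))).2) := fun r hr => by
    rw [tchart_apply (p := ⟨(σ (φ r)).proj, Real.exp (K (φ r)) • (σ (φ r)).2⟩) hr, tchart_apply hr]
    exact Prod.ext rfl (map_smul (dbchart E x₀ _) _ _)
  refine ⟨hev.mono fun _ hr => hr.2, ?_⟩
  set q : TangentBundle 𝓘(ℝ, E) M := ⟨(σ (φ s)).proj, Real.exp (K (φ s)) • (σ (φ s)).2⟩
  have hq : q ∈ slit E U :=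
    ⟨(hσ.mem _ hs').1, smul_ne_zero (Real.exp_pos _).ne' (hσ.mem _ hs').2⟩
  have hz := hσ.hasDerivAt_tchart hs' hx
  have hz1 := (hasDerivAt_fst hz).scomp s (hφd' s hs)
  have hz2 := (hasDerivAt_snd hz).scomp s (hφd' s hs)
  have he := (((hKd _ hs').comp s (hφd' s hs)).exp)
  have hd := hz1.prodMk (he.smul hz2)
  refine (hd.congr_of_eventuallyEq (hev.mono fun r hr => hcoord r hr.2)).congr_deriv ?_
  have hm := tchart_mem_slitChart hx (hσ.mem _ hs')
  refine Prod.ext ?_ ?_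
  · refine Eq.trans ?_ (hΓ'.fst_dtchart hq hx).symm
    rw [hcoord s hx]
    show _ • (tfield Γ x₀ _).1 = _
    rw [hΓ.fst_tfield hm]
  · have h1 : (dtchart x₀ q (Γ' q)).2 = Real.exp (K (φ s)) ^ 2 •
        ((dtchart x₀ (σ (φ s)) (Γ (σ (φ s)))).2 + k (φ s) • (tchart E x₀ (σ (φ s))).2) := by
      rw [← tfield_tchart Γ' (p := q) hx, hcoord s hx,
        hΓ'.snd_homogeneous hU (hσ.mem _ hs') (Real.exp_pos _), tfield_tchart Γ' hx,
        hk _ hs' _ hx]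
    refine Eq.trans ?_ h1.symm
    rw [← tfield_tchart Γ hx, smul_add, smul_smul, smul_smul]
    simp only [Function.comp_apply]
    congr 1
    · rw [pow_two]
    · congr 1; ring

/-- Projective equivalence of sprays is a pointwise condition: each belongs to the distribution
spanned by the other and the Liouville field. -/
lemma projectivelyEquivalent_iff (hU : IsOpen U) (hΓ : IsSpray U Γ) (hΓ' : IsSpray U Γ') :
    ProjectivelyEquivalent U Γ Γ' ↔ ∀ p ∈ slit E U, Γ' p ∈ distD Γ p :=
  ⟨fun h _ hp => mem_distD_of_geodesicsReparametrize hU hΓ hΓ' h.1 hp, fun h =>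
    ⟨geodesicsReparametrize_of_mem_distD hU hΓ hΓ' h, geodesicsReparametrize_of_mem_distD hU hΓ' hΓ
      fun p hp => mem_distD_symm hΓ hΓ' hp (h p hp)⟩⟩

/-- A spray is a geodesic spray of `F` exactly if it lies in the kernel of the Hilbert 2-form. -/
lemma isGeodesicSpray_iff {F : TangentBundle 𝓘(ℝ, E) M → ℝ} (hU : IsOpen U) (hΓ : IsSpray U Γ)
    (hF : IsFinsler U F) : IsGeodesicSpray U F Γ ↔ ∀ p ∈ slit E U, ∀ b : E × E,
      (extD (hilbertForm F) p : (E × E) [⋀^Fin 2]→L[ℝ] ℝ) ![Γ p, b] = 0 := by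
  constructor
  · rintro ⟨-, h⟩ p hp
    obtain ⟨ε, hε, σ, rfl, hσ⟩ := hΓ.exists_geodesic hU hp
    have h0 : (0 : ℝ) ∈ Ioo (-ε) ε := ⟨by linarith, hε⟩
    exact (eulerLagrange_iff hU hΓ hF.smooth hF.homogeneous hσ (γ := fun t => (σ t).proj)
      (fun _ _ => rfl) h0 (x₀ := (σ 0).proj) (mem_extChartAt_source _)).1
      (h _ _ ⟨σ, hσ, fun _ _ => rfl⟩ 0 h0 _ (mem_extChartAt_source _))
  · refine fun h => ⟨hΓ, ?_⟩
    rintro J γ ⟨σ, hσ, hγ⟩ t ht x₀ hx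
    exact (eulerLagrange_iff hU hΓ hF.smooth hF.homogeneous hσ hγ ht hx).2
      (h _ (hσ.mem t ht))

end ProjectiveEquivalence

/-! ### Integrals depending on a parameter -/

section ParametricIntegral

universe u

open MeasureTheory

variable {X F : Type u} [NormedAddCommGroup X] [NormedSpace ℝ X] [NormedAddCommGroup F]
  [NormedSpace ℝ F]

lemma isOpen_forall_mem_Icc {W : Set (X × ℝ)} (hW : IsOpen W) :
    IsOpen {x : X | ∀ t ∈ Icc (0 : ℝ) 1, (x, t) ∈ W} := by
  rw [isOpen_iff_eventually]
  intro x hx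
  exact isCompact_Icc.eventually_forall_of_forall_eventually fun t ht => hW.mem_nhds (hx t ht)

lemma hasFDerivAt_integral_Icc [CompleteSpace F] {W : Set (X × ℝ)} (hW : IsOpen W) {G : X × ℝ → F}
    (hG : ContDiffOn ℝ 1 G W) {x : X} (hx : ∀ t ∈ Icc (0 : ℝ) 1, (x, t) ∈ W) :
    HasFDerivAt (fun x' => ∫ t in (0 : ℝ)..1, G (x', t))
      (∫ t in (0 : ℝ)..1, (fderiv ℝ G (x, t)).comp (ContinuousLinearMap.inl ℝ X ℝ)) x := by
  have hu : uIoc (0 : ℝ) 1 ⊆ Icc 0 1 := by rw [uIoc_of_le zero_le_one]; exact Ioc_subset_Icc_self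
  have hu' : uIcc (0 : ℝ) 1 = Icc 0 1 := uIcc_of_le zero_le_one
  set G' : X → ℝ → X →L[ℝ] F := fun x t => (fderiv ℝ G (x, t)).comp (ContinuousLinearMap.inl ℝ X ℝ)
  have hG' : ContinuousOn (fun z : X × ℝ => G' z.1 z.2) W :=
    (hG.continuousOn_fderiv_of_isOpen hW le_rfl).clm_comp continuousOn_const
  have hι (x' : X) : Continuous (fun t : ℝ => (x', t)) := by fun_prop
  have hc (x' : X) (hx' : ∀ t ∈ Icc (0 : ℝ) 1, (x', t) ∈ W) :
      ContinuousOn (fun t => G (x', t)) (Icc 0 1) :=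
    hG.continuousOn.comp (hι x').continuousOn hx'
  have hc' : ContinuousOn (G' x) (Icc 0 1) := hG'.comp (hι x).continuousOn hx
  obtain ⟨C, hC⟩ := isCompact_Icc.exists_bound_of_continuousOn hc'
  have hev : ∀ᶠ x' in 𝓝 x, ∀ t ∈ Icc (0 : ℝ) 1, (x', t) ∈ W ∧ ‖G' x' t‖ ≤ C + 1 := by
    refine isCompact_Icc.eventually_forall_of_forall_eventually fun t ht => ?_
    have h1 : ContinuousAt (fun z : X × ℝ => ‖G' z.1 z.2‖) (x, t) :=
      (hG'.continuousAt (hW.mem_nhds (hx t ht))).norm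
    filter_upwards [hW.mem_nhds (hx t ht),
      h1.eventually_le_const (show ‖G' x t‖ < C + 1 by linarith [hC t ht])] with z h2 h3
    exact ⟨h2, h3⟩
  refine intervalIntegral.hasFDerivAt_integral_of_dominated_of_fderiv_le (F' := G')
    (bound := fun _ => C + 1) hev ?_ ?_ ?_ ?_ ?_ ?_
  · filter_upwards [hev] with x' hx'
    exact ((hc x' fun t ht => (hx' t ht).1).mono hu).aestronglyMeasurable measurableSet_uIoc
  · exact (hu' ▸ hc x hx).intervalIntegrable
  · exact (hc'.mono hu).aestronglyMeasurable measurableSet_uIoc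
  · exact Filter.Eventually.of_forall fun t ht x' hx' => (hx' t (hu ht)).2
  · exact intervalIntegrable_const
  · refine Filter.Eventually.of_forall fun t ht x' hx' => ?_
    have h1 : HasFDerivAt (fun x' : X => (x', t)) (ContinuousLinearMap.inl ℝ X ℝ) x' :=
      (hasFDerivAt_id x').prodMk (hasFDerivAt_const t x')
    exact HasFDerivAt.comp (g := G) x' ((hG.contDiffAt (hW.mem_nhds (hx' t (hu ht)).1)).differentiableAt
      (by simp)).hasFDerivAt h1

/-- The induction on the order of differentiability replaces `F` by `X →L[ℝ] F`; this is why `F` is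
quantified inside the statement and both spaces live in the same universe. -/
lemma contDiffOn_nat_integral_Icc {W : Set (X × ℝ)} (hW : IsOpen W) (n : ℕ) :
    ∀ {F : Type u} [NormedAddCommGroup F] [NormedSpace ℝ F] [CompleteSpace F] {G : X × ℝ → F},
    ContDiffOn ℝ (n + 1) G W → ContDiffOn ℝ n (fun x => ∫ t in (0 : ℝ)..1, G (x, t))
      {x | ∀ t ∈ Icc (0 : ℝ) 1, (x, t) ∈ W} := by
  induction n with
  | zero =>
    intro F _ _ _ G hG
    simp only [Nat.cast_zero, zero_add] at hG ⊢
    exact contDiffOn_zero.2 fun x hx =>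
      (hasFDerivAt_integral_Icc hW hG hx).continuousAt.continuousWithinAt
  | succ n ih =>
    intro F _ _ _ G hG
    have hd : ∀ x, (∀ t ∈ Icc (0 : ℝ) 1, (x, t) ∈ W) → HasFDerivAt _ _ x := fun x hx =>
      hasFDerivAt_integral_Icc hW (hG.of_le (by norm_cast; omega)) hx
    rw [Nat.cast_succ, contDiffOn_succ_iff_fderiv_of_isOpen (isOpen_forall_mem_Icc hW)]
    refine ⟨fun x hx => (hd x hx).differentiableAt.differentiableWithinAt, by simp, ?_⟩
    have h1 : ContDiffOn ℝ (n + 1)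
        (fun z => (fderiv ℝ G z).comp (ContinuousLinearMap.inl ℝ X ℝ)) W :=
      (hG.fderiv_of_isOpen hW (by push_cast; rfl)).clm_comp contDiffOn_const
    exact (ih h1).congr fun x hx => (hd x hx).fderiv

/-- Differentiation under the integral sign for a smooth integrand on a compact interval. -/
lemma contDiffAt_integral_Icc [CompleteSpace F] {W : Set (X × ℝ)} (hW : IsOpen W) {G : X × ℝ → F}
    (hG : ContDiffOn ℝ ∞ G W) {x : X} (hx : ∀ t ∈ Icc (0 : ℝ) 1, (x, t) ∈ W) :
    ContDiffAt ℝ ∞ (fun x => ∫ t in (0 : ℝ)..1, G (x, t)) x := by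
  have h : ContDiffOn ℝ ∞ (fun x => ∫ t in (0 : ℝ)..1, G (x, t))
      {x | ∀ t ∈ Icc (0 : ℝ) 1, (x, t) ∈ W} :=
    contDiffOn_infty.2 fun n => contDiffOn_nat_integral_Icc hW n
      (hG.of_le (by exact_mod_cast (le_top : ((n + 1 : ℕ) : ℕ∞) ≤ ⊤)))
  exact h.contDiffAt ((isOpen_forall_mem_Icc hW).mem_nhds hx)

lemma fderiv_integral_Icc_apply [CompleteSpace F] {W : Set (X × ℝ)} (hW : IsOpen W) {G : X × ℝ → F}
    (hG : ContDiffOn ℝ ∞ G W) {x : X} (hx : ∀ t ∈ Icc (0 : ℝ) 1, (x, t) ∈ W) (a : X) :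
    fderiv ℝ (fun x => ∫ t in (0 : ℝ)..1, G (x, t)) x a =
      ∫ t in (0 : ℝ)..1, fderiv ℝ G (x, t) (a, 0) := by
  have hG1 := hG.of_le (m := 1) (WithTop.coe_le_coe.2 le_top)
  rw [(hasFDerivAt_integral_Icc hW hG1 hx).fderiv,
    ContinuousLinearMap.intervalIntegral_apply]
  · rfl
  · have hc : ContinuousOn (fun t : ℝ => (fderiv ℝ G (x, t)).comp (ContinuousLinearMap.inl ℝ X ℝ))
        (Icc 0 1) :=
      ((hG1.continuousOn_fderiv_of_isOpen hW le_rfl).clm_comp continuousOn_const).comp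
        (by fun_prop : Continuous fun t : ℝ => (x, t)).continuousOn hx
    exact (uIcc_of_le (zero_le_one' ℝ) ▸ hc).intervalIntegrable

end ParametricIntegral

/-! ### Potentials -/

section Potentials

universe u

variable {E F : Type u} [NormedAddCommGroup E] [NormedSpace ℝ E] [NormedAddCommGroup F]
  [NormedSpace ℝ F] [CompleteSpace F]

/-- The points visible from `e` in the complement of the origin. -/
def visibleFrom (e : E) : Set E := {y | ∀ t ∈ Icc (0 : ℝ) 1, e + t • (y - e) ≠ 0}

/-- The potential obtained by integrating `H`, as a 1-form in the second variable, along the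
segments which issue from `e`. -/
def rayPotential (H : E × E → E →L[ℝ] F) (e : E) (z : E × E) : F :=
  ∫ t in (0 : ℝ)..1, H (z.1, e + t • (z.2 - e)) (z.2 - e)

/-- The Poincaré lemma on the fibres, on the star-shaped set of the points visible from `e`. -/
lemma rayPotential_spec {B : Set E} (hB : IsOpen B) {H : E × E → E →L[ℝ] F}
    (hH : ∀ z ∈ B ×ˢ {0}ᶜ, ContDiffAt ℝ ∞ H z)
    (hsymm : ∀ z ∈ B ×ˢ {0}ᶜ, ∀ w w' : E, fderiv ℝ H z (0, w) w' = fderiv ℝ H z (0, w') w)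
    {e : E} {z : E × E} (hz : z.1 ∈ B) (hz' : z.2 ∈ visibleFrom e) :
    ContDiffAt ℝ ∞ (rayPotential H e) z ∧ ∀ w, fderiv ℝ (rayPotential H e) z (0, w) = H z w := by
  let m : (E × E) × ℝ → E × E := fun s => (s.1.1, e + s.2 • (s.1.2 - e))
  have hm : ContDiff ℝ ∞ m := by fun_prop
  let W : Set ((E × E) × ℝ) := m ⁻¹' (B ×ˢ {0}ᶜ)
  have hW : IsOpen W := (hB.prod isOpen_compl_singleton).preimage hm.continuous
  have hHm : ∀ s ∈ W, ContDiffAt ℝ ∞ (fun s => H (m s)) s := fun s hs =>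
    ContDiffAt.comp (g := H) s (hH _ hs) hm.contDiffAt
  have hG : ContDiffOn ℝ ∞ (fun s : (E × E) × ℝ => H (m s) (s.1.2 - e)) W := fun s hs =>
    ((hHm s hs).clm_apply (by fun_prop)).contDiffWithinAt
  have hzW : ∀ t ∈ Icc (0 : ℝ) 1, (z, t) ∈ W := fun t ht => ⟨hz, hz' t ht⟩
  refine ⟨contDiffAt_integral_Icc hW hG hzW, fun w => ?_⟩
  refine (fderiv_integral_Icc_apply hW hG hzW (0, w)).trans ?_
  -- the integrand is the derivative of `t ↦ t H(x, e + t (y - e)) w`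
  have key : ∀ t ∈ uIcc (0 : ℝ) 1, HasDerivAt (fun t => t • H (m (z, t)) w)
      (fderiv ℝ (fun s : (E × E) × ℝ => H (m s) (s.1.2 - e)) (z, t) ((0, w), 0)) t := by
    intro t ht
    rw [uIcc_of_le zero_le_one] at ht
    have hd := ((hH _ (hzW t ht)).differentiableAt (by simp)).hasFDerivAt
    have hm1 : HasDerivAt (fun t => m (z, t)) (0, z.2 - e) t := by
      have := (hasDerivAt_const t z.1).prodMk (((hasDerivAt_id t).smul_const (z.2 - e)).const_add e)
      simpa using this
    have hA : HasDerivAt (fun t => H (m (z, t))) (fderiv ℝ H (m (z, t)) (0, z.2 - e)) t :=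
      HasFDerivAt.comp_hasDerivAt (l := H) t hd hm1
    have hA' : HasDerivAt (fun t => H (m (z, t)) w) (fderiv ℝ H (m (z, t)) (0, z.2 - e) w) t := by
      simpa using hA.clm_apply (hasDerivAt_const t w)
    have h1 : HasDerivAt (fun t => t • H (m (z, t)) w)
        (t • fderiv ℝ H (m (z, t)) (0, z.2 - e) w + (1 : ℝ) • H (m (z, t)) w) t :=
      (hasDerivAt_id t).smul hA'
    have hw : HasDerivAt (fun r : ℝ => z.2 + r • w) w 0 := by
      simpa using ((hasDerivAt_id (0 : ℝ)).smul_const w).const_add z.2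
    have hl : HasDerivAt (fun r : ℝ => (((z.1, z.2 + r • w), t) : (E × E) × ℝ)) ((0, w), 0) 0 :=
      ((hasDerivAt_const 0 z.1).prodMk hw).prodMk (hasDerivAt_const 0 t)
    have hzt : (((z.1, z.2 + (0 : ℝ) • w), t) : (E × E) × ℝ) = (z, t) := by simp
    have hGd : HasFDerivAt (fun s : (E × E) × ℝ => H (m s) (s.1.2 - e))
        (fderiv ℝ (fun s : (E × E) × ℝ => H (m s) (s.1.2 - e)) (z, t))
        ((z.1, z.2 + (0 : ℝ) • w), t) := by
      rw [hzt]
      exact ((hG.contDiffAt (hW.mem_nhds (hzW t ht))).differentiableAt (by simp)).hasFDerivAt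
    have h2 : HasDerivAt (fun r : ℝ => H (z.1, e + t • (z.2 + r • w - e)) (z.2 + r • w - e))
        (fderiv ℝ (fun s : (E × E) × ℝ => H (m s) (s.1.2 - e)) (z, t) ((0, w), 0)) 0 :=
      HasFDerivAt.comp_hasDerivAt (l := fun s : (E × E) × ℝ => H (m s) (s.1.2 - e)) 0 hGd hl
    have hm2 : HasDerivAt (fun r : ℝ => (z.1, e + t • (z.2 + r • w - e))) ((0 : E), t • w) 0 :=
      (hasDerivAt_const 0 z.1).prodMk (((hw.sub_const e).const_smul t).const_add e)
    have hd' : HasFDerivAt H (fderiv ℝ H (m (z, t))) (z.1, e + t • (z.2 + (0 : ℝ) • w - e)) := by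
      rw [zero_smul, add_zero]; exact hd
    have h3 : HasDerivAt (fun r : ℝ => H (z.1, e + t • (z.2 + r • w - e)) (z.2 + r • w - e))
        (fderiv ℝ H (m (z, t)) (0, t • w) (z.2 + (0 : ℝ) • w - e) +
          H (z.1, e + t • (z.2 + (0 : ℝ) • w - e)) w) 0 :=
      (HasFDerivAt.comp_hasDerivAt (l := H) 0 hd' hm2).clm_apply (hw.sub_const e)
    have h4 := h2.unique h3
    rw [h4]
    refine h1.congr_deriv ?_
    have h5 : ((0 : E), t • w) = t • ((0 : E), w) := by simp
    rw [h5, zero_smul, add_zero, map_smul, smul_apply, hsymm _ (hzW t ht) w (z.2 - e)]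
    simp [m, add_comm]
  have hint : IntervalIntegrable (fun t => fderiv ℝ (fun s : (E × E) × ℝ => H (m s) (s.1.2 - e))
      (z, t) ((0, w), 0)) MeasureTheory.volume 0 1 := by
    have hc : ContinuousOn (fun t : ℝ => fderiv ℝ (fun s : (E × E) × ℝ => H (m s) (s.1.2 - e))
        (z, t) ((0, w), 0)) (Icc 0 1) :=
      (((hG.of_le (m := 1) (WithTop.coe_le_coe.2 le_top)).continuousOn_fderiv_of_isOpen hW
        le_rfl).clm_apply continuousOn_const).comp
        (by fun_prop : Continuous fun t : ℝ => (z, t)).continuousOn hzW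
    exact (uIcc_of_le (zero_le_one' ℝ) ▸ hc).intervalIntegrable
  refine (intervalIntegral.integral_eq_sub_of_hasDerivAt key hint).trans ?_
  simp [m]

end Potentials

section Potentials

universe u

variable {E : Type u} [NormedAddCommGroup E] [NormedSpace ℝ E]

/-- The Poincaré lemma for 2-forms on a ball. -/
lemma exists_primitive_two_form {x₀ : E} {r : ℝ} {a : E → E →L[ℝ] E →L[ℝ] ℝ}
    (ha : ∀ x ∈ Metric.ball x₀ r, ContDiffAt ℝ ∞ a x)
    (halt : ∀ x ∈ Metric.ball x₀ r, ∀ u v, a x u v = -a x v u)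
    (hclosed : ∀ x ∈ Metric.ball x₀ r, ∀ u v w,
      fderiv ℝ a x u v w - fderiv ℝ a x v u w + fderiv ℝ a x w u v = 0) :
    ∃ b : E → E →L[ℝ] ℝ, ∀ x ∈ Metric.ball x₀ r, ContDiffAt ℝ ∞ b x ∧
      ∀ u v, fderiv ℝ b x u v - fderiv ℝ b x v u = a x u v := by
  let m : E × ℝ → E := fun s => x₀ + s.2 • (s.1 - x₀)
  have hm : ContDiff ℝ ∞ m := by fun_prop
  let W : Set (E × ℝ) := m ⁻¹' Metric.ball x₀ r
  have hW : IsOpen W := Metric.isOpen_ball.preimage hm.continuous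
  let G : E × ℝ → E →L[ℝ] ℝ := fun s => s.2 • a (m s) (s.1 - x₀)
  have hG : ContDiffOn ℝ ∞ G W := fun s hs =>
    (contDiffAt_snd.smul ((ContDiffAt.comp (g := a) s (ha _ hs) hm.contDiffAt).clm_apply
      (by fun_prop))).contDiffWithinAt
  refine ⟨fun x => ∫ t in (0 : ℝ)..1, G (x, t), fun x hx => ?_⟩
  have hxW : ∀ t ∈ Icc (0 : ℝ) 1, (x, t) ∈ W := fun t ht => by
    simp only [W, m, mem_preimage, Metric.mem_ball, dist_self_add_left, norm_smul]
    rw [Metric.mem_ball, dist_eq_norm] at hx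
    calc ‖t‖ * ‖x - x₀‖ ≤ 1 * ‖x - x₀‖ := by
          gcongr
          rw [Real.norm_of_nonneg ht.1]; exact ht.2
      _ < r := by rwa [one_mul]
  refine ⟨contDiffAt_integral_Icc hW hG hxW, fun u v => ?_⟩
  have hGu : ∀ t ∈ Icc (0 : ℝ) 1, ∀ u v, fderiv ℝ G (x, t) (u, 0) v =
      t ^ 2 * fderiv ℝ a (m (x, t)) u (x - x₀) v + t * a (m (x, t)) u v := by
    intro t ht u v
    have hu : HasDerivAt (fun s : ℝ => x + s • u) u 0 := by
      simpa using ((hasDerivAt_id (0 : ℝ)).smul_const u).const_add x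
    have hl : HasDerivAt (fun s : ℝ => ((x + s • u, t) : E × ℝ)) (u, 0) 0 :=
      hu.prodMk (hasDerivAt_const 0 t)
    have hGd : HasFDerivAt G (fderiv ℝ G (x, t)) (x + (0 : ℝ) • u, t) := by
      rw [zero_smul, add_zero]
      exact ((hG.contDiffAt (hW.mem_nhds (hxW t ht))).differentiableAt (by simp)).hasFDerivAt
    have h2 : HasDerivAt (fun s : ℝ => t • a (x₀ + t • (x + s • u - x₀)) (x + s • u - x₀))
        (fderiv ℝ G (x, t) (u, 0)) 0 := HasFDerivAt.comp_hasDerivAt (l := G) 0 hGd hl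
    have hm2 : HasDerivAt (fun s : ℝ => x₀ + t • (x + s • u - x₀)) (t • u) 0 :=
      ((hu.sub_const x₀).const_smul t).const_add x₀
    have hd' : HasFDerivAt a (fderiv ℝ a (m (x, t))) (x₀ + t • (x + (0 : ℝ) • u - x₀)) := by
      rw [zero_smul, add_zero]
      exact ((ha _ (hxW t ht)).differentiableAt (by simp)).hasFDerivAt
    have h3 : HasDerivAt (fun s : ℝ => t • a (x₀ + t • (x + s • u - x₀)) (x + s • u - x₀))
        (t • (fderiv ℝ a (m (x, t)) (t • u) (x + (0 : ℝ) • u - x₀) +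
          a (x₀ + t • (x + (0 : ℝ) • u - x₀)) u)) 0 :=
      ((HasFDerivAt.comp_hasDerivAt (l := a) 0 hd' hm2).clm_apply (hu.sub_const x₀)).const_smul t
    have hm0 : x₀ + t • (x - x₀) = m (x, t) := rfl
    rw [h2.unique h3, zero_smul, add_zero, map_smul, hm0]
    simp only [smul_apply, add_apply, smul_eq_mul]
    ring
  have hcont : ContinuousOn (fun t : ℝ => fderiv ℝ G (x, t)) (Icc 0 1) :=
    ((hG.of_le (m := 1) (WithTop.coe_le_coe.2 le_top)).continuousOn_fderiv_of_isOpen hW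
      le_rfl).comp (by fun_prop : Continuous fun t : ℝ => (x, t)).continuousOn hxW
  have hint1 (u : E) : IntervalIntegrable (fun t => fderiv ℝ G (x, t) (u, 0))
      MeasureTheory.volume 0 1 :=
    (uIcc_of_le (zero_le_one' ℝ) ▸ hcont.clm_apply continuousOn_const).intervalIntegrable
  have hint2 (u v : E) : IntervalIntegrable (fun t => fderiv ℝ G (x, t) (u, 0) v)
      MeasureTheory.volume 0 1 :=
    (uIcc_of_le (zero_le_one' ℝ) ▸ (hcont.clm_apply continuousOn_const).clm_apply
      continuousOn_const).intervalIntegrable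
  have hfd (u v : E) : fderiv ℝ (fun x => ∫ t in (0 : ℝ)..1, G (x, t)) x u v =
      ∫ t in (0 : ℝ)..1, fderiv ℝ G (x, t) (u, 0) v := by
    rw [fderiv_integral_Icc_apply hW hG hxW u, ContinuousLinearMap.intervalIntegral_apply (hint1 u)]
  rw [hfd, hfd, ← intervalIntegral.integral_sub (hint2 u v) (hint2 v u)]
  -- by closedness the integrand is the derivative of `t ↦ t² a(x₀ + t (x - x₀))(u, v)`
  have key : ∀ t ∈ uIcc (0 : ℝ) 1, HasDerivAt (fun t => t ^ 2 * a (m (x, t)) u v)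
      (fderiv ℝ G (x, t) (u, 0) v - fderiv ℝ G (x, t) (v, 0) u) t := by
    intro t ht
    rw [uIcc_of_le zero_le_one] at ht
    have hm1 : HasDerivAt (fun t => m (x, t)) (x - x₀) t := by
      have h : HasDerivAt (fun t : ℝ => x₀ + t • (x - x₀)) ((1 : ℝ) • (x - x₀)) t :=
        ((hasDerivAt_id t).smul_const (x - x₀)).const_add x₀
      rwa [one_smul] at h
    have hA : HasDerivAt (fun t => a (m (x, t))) (fderiv ℝ a (m (x, t)) (x - x₀)) t :=
      HasFDerivAt.comp_hasDerivAt (l := a) t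
        ((ha _ (hxW t ht)).differentiableAt (by simp)).hasFDerivAt hm1
    have hA' : HasDerivAt (fun t => a (m (x, t)) u v) (fderiv ℝ a (m (x, t)) (x - x₀) u v) t := by
      simpa using (hA.clm_apply (hasDerivAt_const t u)).clm_apply (hasDerivAt_const t v)
    have h1 := (hasDerivAt_pow 2 t).mul hA'
    refine h1.congr_deriv ?_
    rw [hGu t ht, hGu t ht]
    have h2 := hclosed _ (hxW t ht) (x - x₀) u v
    have h3 := halt _ (hxW t ht) v u
    simp only [Nat.cast_ofNat, Nat.add_one_sub_one, pow_one] at *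
    rw [h3]
    linear_combination (t ^ 2) * h2
  rw [intervalIntegral.integral_eq_sub_of_hasDerivAt key ((hint2 u v).sub (hint2 v u))]
  simp [m]

/-! ### The complement of a line -/

lemma mem_visibleFrom_of_notMem_span {e y : E} (he : e ≠ 0) (hy : y ∉ Submodule.span ℝ {e}) :
    y ∈ visibleFrom e := by
  intro t _ h
  refine hy (Submodule.mem_span_singleton.2 ⟨-(1 - t) / t, ?_⟩)
  have h1 : t • y = -(1 - t) • e := by
    rw [smul_sub] at h
    rw [neg_smul, sub_smul, one_smul, eq_neg_iff_add_eq_zero, ← h]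
    abel
  rcases eq_or_ne t 0 with rfl | ht
  · exact absurd (by simpa using h) he
  · rw [div_eq_inv_mul, mul_smul, ← h1, smul_smul, inv_mul_cancel₀ ht, one_smul]

lemma mem_visibleFrom_or {e y : E} (he : e ≠ 0) (hy : y ≠ 0) :
    y ∈ visibleFrom e ∨ y ∈ visibleFrom (-e) := by
  by_cases h : y ∈ Submodule.span ℝ {e}
  · obtain ⟨c, rfl⟩ := Submodule.mem_span_singleton.1 h
    have hc : c ≠ 0 := fun h0 => hy (by rw [h0, zero_smul])
    rcases lt_or_gt_of_ne hc with hc | hc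
    · right
      intro t ht h0
      have h1 : (-(1 - t) + t * c) • e = 0 := by
        rw [← h0]; module
      have := (smul_eq_zero.1 h1).resolve_right he
      nlinarith [ht.1, ht.2, mul_nonneg ht.1 (neg_nonneg.2 hc.le)]
    · left
      intro t ht h0
      have h1 : ((1 - t) + t * c) • e = 0 := by
        rw [← h0]; module
      have := (smul_eq_zero.1 h1).resolve_right he
      nlinarith [ht.1, ht.2, mul_nonneg ht.1 hc.le]
  · exact Or.inl (mem_visibleFrom_of_notMem_span he h)

/-- A point of the line spanned by `e` is separated by the origin from `e` or from `-e`. -/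
lemma notMem_span_of_mem_visibleFrom {e y : E} (h : y ∈ visibleFrom e)
    (h' : y ∈ visibleFrom (-e)) : y ∉ Submodule.span ℝ {e} := by
  intro hy
  obtain ⟨c, rfl⟩ := Submodule.mem_span_singleton.1 hy
  rcases le_or_gt 0 c with hc | hc
  · refine h' (1 / (1 + c)) ⟨by positivity, by rw [div_le_one (by positivity)]; linarith⟩ ?_
    have h1 : -e + (1 / (1 + c)) • (c • e - -e) = (-1 + (1 / (1 + c)) * (c + 1)) • e := by module
    rw [h1]
    have : -1 + (1 / (1 + c)) * (c + 1) = 0 := by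
      have : 1 + c ≠ 0 := by positivity
      field_simp; ring
    rw [this, zero_smul]
  · have hc' : 0 < 1 - c := by linarith
    refine h (1 / (1 - c)) ⟨by positivity, by rw [div_le_one hc']; linarith⟩ ?_
    have h1 : e + (1 / (1 - c)) • (c • e - e) = (1 + (1 / (1 - c)) * (c - 1)) • e := by module
    rw [h1]
    have : 1 + (1 / (1 - c)) * (c - 1) = 0 := by
      field_simp; ring
    rw [this, zero_smul]

lemma isOpen_visibleFrom (e : E) : IsOpen (visibleFrom e) :=
  isOpen_forall_mem_Icc (W := {s : E × ℝ | e + s.2 • (s.1 - e) ≠ 0})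
    (isOpen_ne_fun (by fun_prop) continuous_const)

lemma isConnected_compl_span [FiniteDimensional ℝ E] (hdim : 3 ≤ Module.finrank ℝ E) (e : E) :
    IsConnected ((Submodule.span ℝ {e} : Set E)ᶜ) := by
  refine isConnected_compl_of_one_lt_codim ?_
  rw [← Module.finrank_eq_rank]
  have h1 := Submodule.finrank_quotient_add_finrank (Submodule.span ℝ {e})
  have h2 := finrank_span_le_card (R := ℝ) ({e} : Set E)
  simp only [Set.toFinset_singleton, Finset.card_singleton] at h2
  exact_mod_cast (by omega : 1 < Module.finrank ℝ (E ⧸ Submodule.span ℝ {e}))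

variable {F : Type u} [NormedAddCommGroup F] [NormedSpace ℝ F]

/-- A function with vanishing fibre derivative does not depend on `y` in a connected part of a fibre. -/
lemma eq_of_fderiv_fibre_eq_zero {C : Set E} (hC : IsOpen C) (hC' : IsPreconnected C) {g : E × E → F}
    {x : E} (hg : ∀ y ∈ C, DifferentiableAt ℝ g (x, y)) (hg' : ∀ y ∈ C, ∀ w, fderiv ℝ g (x, y) (0, w) = 0)
    {y y' : E} (hy : y ∈ C) (hy' : y' ∈ C) : g (x, y) = g (x, y') := by
  have hd (y : E) (hy : y ∈ C) : HasFDerivAt (fun y => g (x, y))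
      ((fderiv ℝ g (x, y)).comp (ContinuousLinearMap.inr ℝ E E)) y :=
    HasFDerivAt.comp (g := g) y (hg y hy).hasFDerivAt
      ((hasFDerivAt_const x y).prodMk (hasFDerivAt_id y))
  refine hC.is_const_of_fderiv_eq_zero (𝕜 := ℝ) (f := fun y => g (x, y)) hC' (fun y hy =>
    (hd y hy).differentiableAt.differentiableWithinAt) (fun y hy => ?_) hy hy'
  rw [(hd y hy).fderiv]
  ext w
  exact hg' y hy w

/-- Every closed 1-form on the complement of the origin is exact, with parameters. The potentials
on the two star-shaped sets of points visible from `e` and `-e` differ by a function of the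
parameter, because these sets intersect in the complement of a line, which is connected in
dimension at least three. -/
lemma exists_fibre_potential [FiniteDimensional ℝ E] (hdim : 3 ≤ Module.finrank ℝ E)
    [CompleteSpace F] {B : Set E} (hB : IsOpen B) {H : E × E → E →L[ℝ] F}
    (hH : ∀ z ∈ B ×ˢ {0}ᶜ, ContDiffAt ℝ ∞ H z)
    (hsymm : ∀ z ∈ B ×ˢ {0}ᶜ, ∀ w w' : E, fderiv ℝ H z (0, w) w' = fderiv ℝ H z (0, w') w) :
    ∃ θ : E × E → F, ∀ z ∈ B ×ˢ {0}ᶜ, ContDiffAt ℝ ∞ θ z ∧ ∀ w, fderiv ℝ θ z (0, w) = H z w := by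
  classical
  have : Nontrivial E := Module.nontrivial_of_finrank_pos (R := ℝ) (by omega)
  obtain ⟨e, he⟩ := exists_ne (0 : E)
  obtain ⟨f, hf⟩ := (isConnected_compl_span hdim e).nonempty
  have hspan : Submodule.span ℝ {-e} = Submodule.span ℝ {e} := by
    rw [← Set.neg_singleton, Submodule.span_neg]
  have hvis : ∀ y, y ∉ Submodule.span ℝ {e} → y ∈ visibleFrom e ∧ y ∈ visibleFrom (-e) :=
    fun y hy => ⟨mem_visibleFrom_of_notMem_span he hy,
      mem_visibleFrom_of_notMem_span (neg_ne_zero.2 he) (hspan ▸ hy)⟩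
  have h1 {e' : E} {z : E × E} (hz : z.1 ∈ B) (hz' : z.2 ∈ visibleFrom e') :=
    rayPotential_spec hB hH hsymm hz hz'
  -- the difference of the two potentials, which does not depend on the choice of `f` off the line
  let lam : E → F := fun x => rayPotential H e (x, f) - rayPotential H (-e) (x, f)
  have hpr (x : E) : ContDiffAt ℝ ∞ (fun x : E => (x, f)) x := by fun_prop
  have hlam : ∀ x ∈ B, ContDiffAt ℝ ∞ lam x := fun x hx =>
    (ContDiffAt.comp (g := rayPotential H e) x (h1 (z := (x, f)) hx (hvis f hf).1).1 (hpr x)).sub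
      (ContDiffAt.comp (g := rayPotential H (-e)) x (h1 (z := (x, f)) hx (hvis f hf).2).1 (hpr x))
  have hopen : IsOpen ((Submodule.span ℝ {e} : Set E)ᶜ) :=
    (Submodule.closed_of_finiteDimensional _).isOpen_compl
  have hglue : ∀ x ∈ B, ∀ y ∉ Submodule.span ℝ {e},
      rayPotential H e (x, y) = rayPotential H (-e) (x, y) + lam x := by
    intro x hx y hy
    have hd : ∀ y ∈ ((Submodule.span ℝ {e} : Set E)ᶜ),
        HasFDerivAt (fun z => rayPotential H e z - rayPotential H (-e) z)
          (fderiv ℝ (rayPotential H e) (x, y) - fderiv ℝ (rayPotential H (-e)) (x, y)) (x, y) :=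
      fun y hy => ((h1 (z := (x, y)) hx (hvis y hy).1).1.differentiableAt (by simp)).hasFDerivAt.sub
        ((h1 (z := (x, y)) hx (hvis y hy).2).1.differentiableAt (by simp)).hasFDerivAt
    have h2 := eq_of_fderiv_fibre_eq_zero hopen (isConnected_compl_span hdim e).isPreconnected
      (g := fun z => rayPotential H e z - rayPotential H (-e) z) (x := x)
      (fun y hy => (hd y hy).differentiableAt) (fun y hy w => by
        rw [(hd y hy).fderiv, sub_apply, (h1 (z := (x, y)) hx (hvis y hy).1).2,
          (h1 (z := (x, y)) hx (hvis y hy).2).2, sub_self]) hy hf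
    simp only [lam]
    rw [← h2]
    abel
  refine ⟨fun z => if z.2 ∈ visibleFrom e then rayPotential H e z
    else rayPotential H (-e) z + lam z.1, fun z hz => ?_⟩
  have hlam' : HasFDerivAt (fun z : E × E => lam z.1)
      ((fderiv ℝ lam z.1).comp (ContinuousLinearMap.fst ℝ E E)) z :=
    HasFDerivAt.comp (g := lam) z ((hlam _ hz.1).differentiableAt (by simp)).hasFDerivAt hasFDerivAt_fst
  by_cases hv : z.2 ∈ visibleFrom e
  · have hev : (fun z : E × E => if z.2 ∈ visibleFrom e then rayPotential H e z
        else rayPotential H (-e) z + lam z.1) =ᶠ[𝓝 z] rayPotential H e := by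
      filter_upwards [continuousAt_snd.preimage_mem_nhds ((isOpen_visibleFrom e).mem_nhds hv)]
        with w hw
      exact if_pos hw
    refine ⟨(h1 hz.1 hv).1.congr_of_eventuallyEq hev, fun w => ?_⟩
    rw [hev.fderiv_eq]
    exact (h1 hz.1 hv).2 w
  · have hv' := (mem_visibleFrom_or he hz.2).resolve_left hv
    have hev : (fun z : E × E => if z.2 ∈ visibleFrom e then rayPotential H e z
        else rayPotential H (-e) z + lam z.1) =ᶠ[𝓝 z]
        fun z => rayPotential H (-e) z + lam z.1 := by
      filter_upwards [continuousAt_snd.preimage_mem_nhds ((isOpen_visibleFrom (-e)).mem_nhds hv'),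
        continuousAt_fst.preimage_mem_nhds (hB.mem_nhds hz.1)] with w hw hw'
      by_cases hwe : w.2 ∈ visibleFrom e
      · rw [if_pos hwe]
        exact hglue w.1 hw' w.2 (notMem_span_of_mem_visibleFrom hwe hw)
      · exact if_neg hwe
    refine ⟨((h1 hz.1 hv').1.add (ContDiffAt.comp (g := lam) z (hlam _ hz.1)
      contDiffAt_fst)).congr_of_eventuallyEq hev, fun w => ?_⟩
    rw [hev.fderiv_eq, (((h1 hz.1 hv').1.differentiableAt (by simp)).hasFDerivAt.fun_add hlam').fderiv]
    simp [(h1 hz.1 hv').2 w]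

end Potentials

/-! ### The Lagrangian of a closed 2-form -/

section Lagrangian

universe u

variable {E : Type u} [NormedAddCommGroup E] [NormedSpace ℝ E]

/-- The restriction of a bilinear form along a pair of linear maps. -/
def bilinRestrict {V : Type u} [NormedAddCommGroup V] [NormedSpace ℝ V] (A B : E →L[ℝ] V) :
    (V →L[ℝ] V →L[ℝ] ℝ) →L[ℝ] (E →L[ℝ] E →L[ℝ] ℝ) :=
  (ContinuousLinearMap.compL ℝ E (V →L[ℝ] ℝ) (E →L[ℝ] ℝ)
    ((ContinuousLinearMap.compL ℝ E V ℝ).flip B)).comp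
    ((ContinuousLinearMap.compL ℝ E V (V →L[ℝ] ℝ)).flip A)

/-- A closed 2-form on `B × (E ∖ 0)`, given as a field of alternating bilinear forms on `E × E`, with
the properties of the negative of the Hilbert 2-form of a Finsler function: the fibres are isotropic,
the Liouville field is in the kernel, there is a spray in the kernel (of which only
the first component matters here), and the form pairs `(v, 0)` and `(0, v)` positively if `v` is not
proportional to `y`. -/
structure IsFinslerTwoForm (B : Set E) (β : E × E → (E × E) →L[ℝ] (E × E) →L[ℝ] ℝ) : Prop where
  smooth : ∀ z ∈ B ×ˢ ({0}ᶜ : Set E), ContDiffAt ℝ ∞ β z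
  alt : ∀ z a b, β z a b = -β z b a
  closed : ∀ z ∈ B ×ˢ ({0}ᶜ : Set E), ∀ a b c,
    fderiv ℝ β z a b c - fderiv ℝ β z b a c + fderiv ℝ β z c a b = 0
  vertical : ∀ z ∈ B ×ˢ ({0}ᶜ : Set E), ∀ u w, β z (0, u) (0, w) = 0
  liouville : ∀ z ∈ B ×ˢ ({0}ᶜ : Set E), ∀ u, β z (u, 0) (0, z.2) = 0
  spray : ∀ z ∈ B ×ˢ ({0}ᶜ : Set E), ∀ w, β z (z.2, 0) (0, w) = 0
  pos : ∀ z ∈ B ×ˢ ({0}ᶜ : Set E), ∀ v, (∀ c : ℝ, v ≠ c • z.2) → 0 < β z (v, 0) (0, v)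

variable {β : E × E → (E × E) →L[ℝ] (E × E) →L[ℝ] ℝ}

set_option maxSynthPendingDepth 3 in
/-- A closed 2-form with isotropic fibres is `-dθ` for a semibasic 1-form `θ`. -/
lemma IsFinslerTwoForm.exists_semibasic_potential [FiniteDimensional ℝ E]
    (hdim : 3 ≤ Module.finrank ℝ E) {x₀ : E} {r : ℝ}
    (h : IsFinslerTwoForm (Metric.ball x₀ r) β) :
    ∃ θ : E × E → E →L[ℝ] ℝ, ∀ z ∈ Metric.ball x₀ r ×ˢ ({0}ᶜ : Set E), ContDiffAt ℝ ∞ θ z ∧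
      ∀ a b : E × E, fderiv ℝ θ z a b.1 - fderiv ℝ θ z b a.1 = -β z a b := by
  have : Nontrivial E := Module.nontrivial_of_finrank_pos (R := ℝ) (by omega)
  set D : Set (E × E) := Metric.ball x₀ r ×ˢ ({0}ᶜ : Set E)
  have hD : IsOpen D := Metric.isOpen_ball.prod isOpen_compl_singleton
  let ι₁ := ContinuousLinearMap.inl ℝ E E
  let ι₂ := ContinuousLinearMap.inr ℝ E E
  have hβ : ∀ z ∈ D, HasFDerivAt β (fderiv ℝ β z) z := fun z hz =>
    ((h.smooth z hz).differentiableAt (by simp)).hasFDerivAt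
  have hβe : ∀ z ∈ D, ∀ a b c, fderiv ℝ (fun z => β z a b) z c = fderiv ℝ β z c a b :=
    fun z hz a b c => by
      have h1 := (((hβ z hz).clm_apply (hasFDerivAt_const a z)).clm_apply
        (hasFDerivAt_const b z)).fderiv
      rw [h1]
      simp
  have hβalt : ∀ z ∈ D, ∀ c a b, fderiv ℝ β z c a b = -fderiv ℝ β z c b a := fun z hz c a b => by
    rw [← hβe z hz, ← hβe z hz, show (fun z => β z a b) = fun z => -β z b a from
      funext fun z => h.alt z a b, fderiv_fun_neg]
    rfl
  have hβvert : ∀ z ∈ D, ∀ c u w, fderiv ℝ β z c (0, u) (0, w) = 0 := fun z hz c u w => by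
    rw [← hβe z hz]
    have h1 : (fun z => β z (0, u) (0, w)) =ᶠ[𝓝 z] fun _ => 0 := by
      filter_upwards [hD.mem_nhds hz] with z' hz' using h.vertical z' hz' u w
    rw [h1.fderiv_eq]
    simp
  -- the mixed part of `-β`, which closedness makes a closed 1-form on the fibres
  let K := -bilinRestrict ι₂ ι₁
  let H : E × E → E →L[ℝ] E →L[ℝ] ℝ := fun z => K (β z)
  have hHa : ∀ z w u, H z w u = -β z (0, w) (u, 0) := fun z w u => rfl
  have hHd : ∀ z ∈ D, ∀ c w u, fderiv ℝ H z c w u = -fderiv ℝ β z c (0, w) (u, 0) :=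
    fun z hz c w u => by
      have h1 : fderiv ℝ H z = K.comp (fderiv ℝ β z) := (K.hasFDerivAt.comp z (hβ z hz)).fderiv
      rw [h1]; rfl
  obtain ⟨θ, hθ⟩ := exists_fibre_potential hdim Metric.isOpen_ball (H := H)
    (fun z hz => K.contDiff.contDiffAt.comp z (h.smooth z hz)) (fun z hz w w' => by
      ext u
      rw [hHd z hz, hHd z hz]
      have h1 := h.closed z hz (u, 0) (0, w) (0, w')
      rw [hβvert z hz, hβalt z hz (0, w) (u, 0), hβalt z hz (0, w') (u, 0)] at h1
      linarith)
  have hT : ∀ z ∈ D, HasFDerivAt (fderiv ℝ θ) (fderiv ℝ (fderiv ℝ θ) z) z := fun z hz =>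
    (((hθ z hz).1.fderiv_right (m := ∞) (by simp)).differentiableAt (by simp)).hasFDerivAt
  have hTsymm : ∀ z ∈ D, ∀ a b, fderiv ℝ (fderiv ℝ θ) z a b = fderiv ℝ (fderiv ℝ θ) z b a :=
    fun z hz a b => (hθ z hz).1.isSymmSndFDerivAt minSmoothness_two_le a b
  have hTw : ∀ z ∈ D, ∀ c w u, fderiv ℝ (fderiv ℝ θ) z c (0, w) u =
      -fderiv ℝ β z c (0, w) (u, 0) := fun z hz c w u => by
    have h1 : (fun z => fderiv ℝ θ z (0, w)) =ᶠ[𝓝 z] fun z => H z w := by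
      filter_upwards [hD.mem_nhds hz] with z' hz' using (hθ z' hz').2 w
    have h2 := h1.fderiv_eq (𝕜 := ℝ)
    have h3 := ((hT z hz).clm_apply (hasFDerivAt_const ((0 : E), w) z)).fderiv
    have h4 := ((K.hasFDerivAt.comp z (hβ z hz)).clm_apply (hasFDerivAt_const w z)).fderiv
    rw [h3] at h2
    have h5 := DFunLike.congr_fun (DFunLike.congr_fun (h2.trans h4) c) u
    simp only [ContinuousLinearMap.comp_zero, zero_add, ContinuousLinearMap.flip_apply] at h5
    rw [h5]
    rfl
  -- the horizontal part of `β + dθ`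
  let R : (E × E →L[ℝ] E →L[ℝ] ℝ) →L[ℝ] (E →L[ℝ] E →L[ℝ] ℝ) :=
    (ContinuousLinearMap.compL ℝ E (E × E) (E →L[ℝ] ℝ)).flip ι₁
  let fl : (E →L[ℝ] E →L[ℝ] ℝ) →L[ℝ] (E →L[ℝ] E →L[ℝ] ℝ) :=
    (ContinuousLinearMap.flipₗᵢ ℝ E E ℝ).toContinuousLinearEquiv
  let A : E × E → E →L[ℝ] E →L[ℝ] ℝ := fun z =>
    bilinRestrict ι₁ ι₁ (β z) + (R - fl.comp R) (fderiv ℝ θ z)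
  have hAa : ∀ z u v, A z u v = β z (u, 0) (v, 0) + (fderiv ℝ θ z (u, 0) v - fderiv ℝ θ z (v, 0) u) :=
    fun z u v => rfl
  have hAs : ∀ z ∈ D, ContDiffAt ℝ ∞ A z := fun z hz =>
    ((bilinRestrict ι₁ ι₁).contDiff.contDiffAt.comp z (h.smooth z hz)).add
      ((R - fl.comp R).contDiff.contDiffAt.comp z ((hθ z hz).1.fderiv_right (by simp)))
  have hAd : ∀ z ∈ D, ∀ c u v, fderiv ℝ A z c u v = fderiv ℝ β z c (u, 0) (v, 0) +
      (fderiv ℝ (fderiv ℝ θ) z c (u, 0) v - fderiv ℝ (fderiv ℝ θ) z c (v, 0) u) :=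
    fun z hz c u v => by
      have h1 : HasFDerivAt A ((bilinRestrict ι₁ ι₁).comp (fderiv ℝ β z) +
          (R - fl.comp R).comp (fderiv ℝ (fderiv ℝ θ) z)) z :=
        ((bilinRestrict ι₁ ι₁).hasFDerivAt.comp z (hβ z hz)).add
        ((R - fl.comp R).hasFDerivAt.comp z (hT z hz))
      rw [h1.fderiv]
      rfl
  -- closedness of `β` and the choice of `θ` make `A` independent of `y`
  have hAw : ∀ z ∈ D, ∀ w, fderiv ℝ A z (0, w) = 0 := fun z hz w => by
    ext u v
    rw [hAd z hz, hTsymm z hz, hTsymm z hz (0, w), hTw z hz, hTw z hz]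
    have h1 := h.closed z hz (0, w) (u, 0) (v, 0)
    simp only [zero_apply]
    linarith
  obtain ⟨f, hf⟩ := exists_ne (0 : E)
  have hAf : ∀ z ∈ D, A z = A (z.1, f) := fun z hz =>
    eq_of_fderiv_fibre_eq_zero (C := {0}ᶜ) isOpen_compl_singleton
      (isConnected_compl_singleton_of_one_lt_rank (by
        rw [← Module.finrank_eq_rank]; exact_mod_cast (by omega : 1 < Module.finrank ℝ E))
        0).isPreconnected (g := A) (x := z.1)
      (fun y hy => (hAs (z.1, y) ⟨hz.1, hy⟩).differentiableAt (by simp))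
      (fun y hy w => hAw (z.1, y) ⟨hz.1, hy⟩ w) hz.2 hf
  have hpr (x : E) : HasFDerivAt (fun x : E => (x, f)) ι₁ x :=
    (hasFDerivAt_id x).prodMk (hasFDerivAt_const f x)
  have hxf : ∀ x ∈ Metric.ball x₀ r, (x, f) ∈ D := fun x hx => ⟨hx, hf⟩
  have hafd : ∀ x ∈ Metric.ball x₀ r, ∀ u, fderiv ℝ (fun x => A (x, f)) x u =
      fderiv ℝ A (x, f) (u, 0) := fun x hx u =>
    DFunLike.congr_fun (HasFDerivAt.comp (g := A) x
      ((hAs _ (hxf x hx)).differentiableAt (by simp)).hasFDerivAt (hpr x)).fderiv u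
  -- so that `A` is a closed 2-form on the base, of which a primitive is subtracted
  obtain ⟨b, hb⟩ := exists_primitive_two_form (x₀ := x₀) (r := r) (a := fun x => A (x, f))
    (fun x hx => ContDiffAt.comp (g := A) x (hAs _ (hxf x hx)) (by fun_prop))
    (fun x hx u v => by rw [hAa, hAa, h.alt]; ring) (fun x hx u v w => by
      rw [hafd x hx, hafd x hx, hafd x hx, hAd _ (hxf x hx), hAd _ (hxf x hx), hAd _ (hxf x hx),
        hTsymm _ (hxf x hx) (u, 0) (v, 0), hTsymm _ (hxf x hx) (u, 0) (w, 0),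
        hTsymm _ (hxf x hx) (v, 0) (w, 0)]
      have h1 := h.closed _ (hxf x hx) (u, 0) (v, 0) (w, 0)
      linarith)
  refine ⟨fun z => θ z - b z.1, fun z hz => ?_⟩
  refine ⟨(hθ z hz).1.sub (ContDiffAt.comp (g := b) z (hb _ hz.1).1 contDiffAt_fst), fun a c => ?_⟩
  have hbd : HasFDerivAt (fun z : E × E => b z.1)
      ((fderiv ℝ b z.1).comp (ContinuousLinearMap.fst ℝ E E)) z :=
    HasFDerivAt.comp (g := b) z ((hb _ hz.1).1.differentiableAt (by simp)).hasFDerivAt hasFDerivAt_fst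
  have hfd := (((hθ z hz).1.differentiableAt (by simp)).hasFDerivAt.fun_sub hbd).fderiv
  rw [hfd]
  have hsplit (a : E × E) : a = (a.1, 0) + (0, a.2) := by simp
  have h1 (a : E × E) (u : E) : fderiv ℝ θ z a u = fderiv ℝ θ z (a.1, 0) u - β z (0, a.2) (u, 0) := by
    conv_lhs => rw [hsplit a, map_add, add_apply, (hθ z hz).2 a.2, hHa]
    ring
  have h2 : β z a c = β z (a.1, 0) (c.1, 0) + β z (a.1, 0) (0, c.2) + β z (0, a.2) (c.1, 0) := by
    conv_lhs => rw [hsplit a, hsplit c]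
    simp only [map_add, add_apply]
    rw [h.vertical z hz]
    ring
  have h3 := (hb z.1 hz.1).2 a.1 c.1
  rw [← hAf z hz, hAa] at h3
  simp only [sub_apply, ContinuousLinearMap.comp_apply, ContinuousLinearMap.coe_fst']
  rw [h1 a, h1 c, h2, h.alt z (a.1, 0) (0, c.2)]
  linarith

end Lagrangian

section Lagrangian

universe u

variable {E : Type u} [NormedAddCommGroup E] [NormedSpace ℝ E]
  {β : E × E → (E × E) →L[ℝ] (E × E) →L[ℝ] ℝ}

/-- `θ` is a semibasic potential of `-β` on `B × (E ∖ 0)`. -/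
def IsSemibasicPotential (B : Set E) (β : E × E → (E × E) →L[ℝ] (E × E) →L[ℝ] ℝ)
    (θ : E × E → E →L[ℝ] ℝ) : Prop :=
  ∀ z ∈ B ×ˢ ({0}ᶜ : Set E), ContDiffAt ℝ ∞ θ z ∧
    ∀ a b : E × E, fderiv ℝ θ z a b.1 - fderiv ℝ θ z b a.1 = -β z a b

namespace IsSemibasicPotential

variable {B : Set E} {θ : E × E → E →L[ℝ] ℝ}

/-- A constant covector is a closed semibasic form. -/
lemma sub_const (hθ : IsSemibasicPotential B β θ) (l : E →L[ℝ] ℝ) :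
    IsSemibasicPotential B β (fun z => θ z - l) := fun z hz =>
  ⟨(hθ z hz).1.sub contDiffAt_const, fun a b => by
    rw [fderiv_sub_const]; exact (hθ z hz).2 a b⟩

lemma fderiv_vertical (hβ : IsFinslerTwoForm B β) (hθ : IsSemibasicPotential B β θ) {z : E × E}
    (hz : z ∈ B ×ˢ ({0}ᶜ : Set E)) (w u : E) : fderiv ℝ θ z (0, w) u = β z (u, 0) (0, w) := by
  have h := (hθ z hz).2 (0, w) (u, 0)
  rw [hβ.alt, neg_neg] at h
  simpa using h

lemma hasFDerivAt (hθ : IsSemibasicPotential B β θ) {z : E × E}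
    (hz : z ∈ B ×ˢ ({0}ᶜ : Set E)) : HasFDerivAt θ (fderiv ℝ θ z) z :=
  ((hθ z hz).1.differentiableAt (by simp)).hasFDerivAt

/-- The function `L = θ(y)` has fibre derivative `θ`, as the spray condition says that the
derivatives of `θ` contribute nothing. -/
lemma fibreDeriv_apply (hβ : IsFinslerTwoForm B β) (hθ : IsSemibasicPotential B β θ) {z : E × E}
    (hz : z ∈ B ×ˢ ({0}ᶜ : Set E)) : fibreDeriv (fun z => θ z z.2) z = θ z := by
  ext w
  have h1 := ((hθ.hasFDerivAt hz).clm_apply (ContinuousLinearMap.snd ℝ E E).hasFDerivAt).fderiv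
  have h2 : fderiv ℝ (fun z : E × E => θ z z.2) z (0, w) = fderiv ℝ θ z (0, w) z.2 + θ z w := by
    refine (DFunLike.congr_fun h1 _).trans ?_
    simp [add_comm]
  refine Eq.trans (show _ = fderiv ℝ (fun z : E × E => θ z z.2) z (0, w) from rfl) ?_
  rw [h2, hθ.fderiv_vertical hβ hz, hβ.spray z hz, zero_add]

/-- The potential is homogeneous of degree zero, as the Liouville field is in the kernel of `β`. -/
lemma apply_smul (hβ : IsFinslerTwoForm B β) (hθ : IsSemibasicPotential B β θ) {z : E × E}
    (hz : z ∈ B ×ˢ ({0}ᶜ : Set E)) {c : ℝ} (hc : 0 < c) : θ (z.1, c • z.2) = θ z := by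
  have key : ∀ a ∈ Ioi (0 : ℝ), HasDerivAt (fun a : ℝ => θ (z.1, a • z.2)) 0 a := by
    intro a ha
    have ha : 0 < a := ha
    have hza : (z.1, a • z.2) ∈ B ×ˢ ({0}ᶜ : Set E) := ⟨hz.1, smul_ne_zero ha.ne' hz.2⟩
    have h1 : HasDerivAt (fun a : ℝ => (z.1, a • z.2)) ((0 : E), z.2) a := by
      simpa using (hasDerivAt_const a z.1).prodMk ((hasDerivAt_id a).smul_const z.2)
    refine (HasFDerivAt.comp_hasDerivAt (l := θ) a (hθ.hasFDerivAt hza) h1).congr_deriv ?_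
    ext u
    have h2 := hβ.liouville _ hza u
    rw [← fderiv_vertical hβ hθ hza] at h2
    have h3 : ((0 : E), a • z.2) = a • ((0 : E), z.2) := by simp
    rw [h3, map_smul, smul_apply, smul_eq_mul] at h2
    exact (mul_eq_zero.1 h2).resolve_left ha.ne'
  have h := isOpen_Ioi.is_const_of_deriv_eq_zero isPreconnected_Ioi
    (f := fun a : ℝ => θ (z.1, a • z.2))
    (fun a ha => (key a ha).differentiableAt.differentiableWithinAt)
    (fun a ha => (key a ha).deriv) (mem_Ioi.2 hc) (mem_Ioi.2 one_pos)
  simpa using h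

/-- Strict convexity of `y ↦ θ(x, y)(y)` along segments which do not point to the origin. -/
lemma apply_lt (hβ : IsFinslerTwoForm B β) (hθ : IsSemibasicPotential B β θ) {x : E} (hx : x ∈ B)
    {y y' : E} (hy : y ≠ 0) (hy' : y' ∉ Submodule.span ℝ {y}) : θ (x, y) y' < θ (x, y') y' := by
  -- the points of the segment are non-zero and its direction is not proportional to any of them
  have hli : ∀ a b : ℝ, a • y + b • y' = 0 → a = 0 ∧ b = 0 := by
    intro a b hab
    have hb : b = 0 := by
      by_contra hb
      refine hy' (Submodule.mem_span_singleton.2 ⟨-a / b, ?_⟩)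
      have h1 : b • y' = -a • y := by
        rw [neg_smul, eq_neg_iff_add_eq_zero, ← hab]; abel
      rw [div_eq_inv_mul, mul_smul, ← h1, smul_smul, inv_mul_cancel₀ hb, one_smul]
    subst hb
    exact ⟨(smul_eq_zero.1 (by simpa using hab)).resolve_right hy, rfl⟩
  set d := y' - y
  set p : ℝ → E := fun t => y + t • d
  have hp : ∀ t, (x, p t) ∈ B ×ˢ ({0}ᶜ : Set E) := fun t => ⟨hx, fun h0 => by
    have h1 : (1 - t) • y + t • y' = 0 := by
      rw [← show p t = 0 from h0]; simp only [p, d]; module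
    have := hli _ _ h1
    linarith [this.1, this.2]⟩
  have hd : ∀ t c : ℝ, d ≠ c • p t := fun t c h0 => by
    have h1 : (-1 - c * (1 - t)) • y + (1 - c * t) • y' = 0 := by
      have : d - c • p t = 0 := sub_eq_zero.2 h0
      rw [← this]; simp only [p, d]; module
    obtain ⟨h2, h3⟩ := hli _ _ h1
    have hc : c = 0 := by linarith
    rw [hc] at h3
    linarith
  have hpd : ∀ t, HasDerivAt (fun t => (x, p t)) ((0 : E), d) t := fun t => by
    have h1 : HasDerivAt p ((1 : ℝ) • d) t := ((hasDerivAt_id t).smul_const d).const_add y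
    rw [one_smul] at h1
    exact (hasDerivAt_const t x).prodMk h1
  have hθd : ∀ t, HasDerivAt (fun t => θ (x, p t)) (fderiv ℝ θ (x, p t) (0, d)) t := fun t =>
    HasFDerivAt.comp_hasDerivAt (l := θ) t (hθ.hasFDerivAt (hp t)) (hpd t)
  have hψ : ∀ t, HasDerivAt (fun t => θ (x, p t) d) (β (x, p t) (d, 0) (0, d)) t := fun t => by
    have h1 := (hθd t).clm_apply (hasDerivAt_const t d)
    rw [map_zero, add_zero, hθ.fderiv_vertical hβ (hp t)] at h1
    exact h1
  have hφ : ∀ t, HasDerivAt (fun t => θ (x, p t) (p t)) (θ (x, p t) d) t := fun t => by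
    have h1 := (hθd t).clm_apply (hasDerivAt_snd (hpd t))
    rw [hθ.fderiv_vertical hβ (hp t), hβ.spray (x, p t) (hp t), zero_add] at h1
    exact h1
  have hmono : StrictMono (fun t => θ (x, p t) d) := strictMono_of_deriv_pos fun t => by
    rw [(hψ t).deriv]
    exact hβ.pos _ (hp t) d (hd t)
  -- the slope is the derivative at an intermediate point, which exceeds the one at `0`
  obtain ⟨c, hc, hc'⟩ := exists_hasDerivAt_eq_slope (fun t => θ (x, p t) (p t))
    (fun t => θ (x, p t) d) zero_lt_one
    (fun t _ => (hφ t).continuousAt.continuousWithinAt) (fun t _ => hφ t)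
  have h1 := hmono hc.1
  have hp0 : p 0 = y := by simp [p]
  have hp1 : p 1 = y' := by simp [p, d]
  simp only [hc', hp0, hp1, d, map_sub] at h1
  linarith

end IsSemibasicPotential

/-- A closed 2-form of the type of a Hilbert form is, near a point of the base, the
Hilbert 2-form of a positive homogeneous Lagrangian. The potential `θ` is normalised by a constant
covector for positivity at the given point: strict convexity of `θ(y)` makes the mean of
the covectors at two opposite directions a lower bound. -/
lemma IsFinslerTwoForm.exists_lagrangian [FiniteDimensional ℝ E]
    (hdim : 3 ≤ Module.finrank ℝ E) {x₀ : E} {r : ℝ} (hr : 0 < r)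
    (h : IsFinslerTwoForm (Metric.ball x₀ r) β) :
    ∃ δ > 0, δ ≤ r ∧ ∃ L : E × E → ℝ, ∀ z ∈ Metric.ball x₀ δ ×ˢ ({0}ᶜ : Set E),
      ContDiffAt ℝ ∞ L z ∧ 0 < L z ∧ (∀ c : ℝ, 0 < c → L (z.1, c • z.2) = c * L z) ∧
      ∀ a b : E × E, fderiv ℝ (fibreDeriv L) z a b.1 - fderiv ℝ (fibreDeriv L) z b a.1 =
        -β z a b := by
  have : Nontrivial E := Module.nontrivial_of_finrank_pos (R := ℝ) (by omega)
  have : ProperSpace E := FiniteDimensional.proper ℝ E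
  obtain ⟨θ₀, hθ₀⟩ := h.exists_semibasic_potential hdim
  change IsSemibasicPotential _ _ _ at hθ₀
  have hx₀ : x₀ ∈ Metric.ball x₀ r := Metric.mem_ball_self hr
  obtain ⟨y₁, hy₁⟩ := exists_ne (0 : E)
  -- convexity along the segments from an auxiliary direction `e` to `y₁` and to `-y₁` shows that the
  -- sum of the values of `θ₀(y)` at `y₁` and `-y₁` is positive
  obtain ⟨e, he⟩ := (isConnected_compl_span hdim y₁).nonempty
  have he : e ∉ Submodule.span ℝ {y₁} := he
  have hy₁e : y₁ ∉ Submodule.span ℝ {e} := by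
    intro h1
    obtain ⟨c, hc⟩ := Submodule.mem_span_singleton.1 h1
    have hc0 : c ≠ 0 := fun h0 => hy₁ (by rw [← hc, h0, zero_smul])
    exact he (Submodule.mem_span_singleton.2 ⟨c⁻¹, by rw [← hc, smul_smul, inv_mul_cancel₀ hc0,
      one_smul]⟩)
  have he0 : e ≠ 0 := fun h0 => he (h0 ▸ Submodule.zero_mem _)
  have hspan (y : E) : Submodule.span ℝ {-y} = Submodule.span ℝ {y} := by
    rw [← Set.neg_singleton, Submodule.span_neg]
  have hneg : -y₁ ∉ Submodule.span ℝ {e} := fun h1 => hy₁e (by simpa using Submodule.neg_mem _ h1)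
  have hsum : θ₀ (x₀, -y₁) y₁ < θ₀ (x₀, y₁) y₁ := by
    have h1 := hθ₀.apply_lt h hx₀ he0 hy₁e
    have h2 := hθ₀.apply_lt h hx₀ he0 hneg
    simp only [map_neg] at h2
    linarith
  -- the mean of the covectors at `y₁` and `-y₁`
  set l : E →L[ℝ] ℝ := (1 / 2 : ℝ) • (θ₀ (x₀, y₁) + θ₀ (x₀, -y₁))
  have hl : ∀ y, l y = (θ₀ (x₀, y₁) y + θ₀ (x₀, -y₁) y) / 2 := fun y => by
    simp only [l, smul_apply, add_apply, smul_eq_mul]; ring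
  have hθ := hθ₀.sub_const l
  set L : E × E → ℝ := fun z => (θ₀ z - l) z.2
  have hLs : ∀ z ∈ Metric.ball x₀ r ×ˢ ({0}ᶜ : Set E), ContDiffAt ℝ ∞ L z := fun z hz =>
    (hθ z hz).1.clm_apply contDiffAt_snd
  have hLh : ∀ z ∈ Metric.ball x₀ r ×ˢ ({0}ᶜ : Set E), ∀ c : ℝ, 0 < c →
      L (z.1, c • z.2) = c * L z := fun z hz c hc => by
    simp only [L]
    rw [hθ₀.apply_smul h hz hc, map_smul, smul_eq_mul]
  have hpos₀ : ∀ y ≠ 0, 0 < L (x₀, y) := by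
    intro y hy
    simp only [L, sub_apply, hl]
    by_cases hys : y ∈ Submodule.span ℝ {y₁}
    · obtain ⟨c, rfl⟩ := Submodule.mem_span_singleton.1 hys
      have hc : c ≠ 0 := fun h0 => hy (by rw [h0, zero_smul])
      rcases lt_or_gt_of_ne hc with hc | hc
      · have h1 : c • y₁ = (-c) • (-y₁) := by module
        have h2 := hθ₀.apply_smul h (z := (x₀, -y₁)) ⟨hx₀, neg_ne_zero.2 hy₁⟩ (neg_pos.2 hc)
        simp only at h2
        rw [h1, h2]
        simp only [map_smul, map_neg, smul_eq_mul]
        nlinarith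
      · have h2 := hθ₀.apply_smul h (z := (x₀, y₁)) ⟨hx₀, hy₁⟩ hc
        simp only at h2
        rw [h2]
        simp only [map_smul, smul_eq_mul]
        nlinarith
    · have h1 := hθ₀.apply_lt h hx₀ hy₁ hys
      have h2 := hθ₀.apply_lt h hx₀ (neg_ne_zero.2 hy₁) (hspan y₁ ▸ hys)
      linarith
  -- by homogeneity it suffices to have positivity on the unit sphere, which is compact
  have hev : ∀ᶠ x in 𝓝 x₀, ∀ y ∈ Metric.sphere (0 : E) 1, 0 < L (x, y) := by
    refine (isCompact_sphere (0 : E) 1).eventually_forall_of_forall_eventually fun y hy => ?_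
    have hy0 : y ≠ 0 := ne_zero_of_mem_unit_sphere ⟨y, hy⟩
    exact (hLs (x₀, y) ⟨hx₀, hy0⟩).continuousAt.eventually_const_lt (hpos₀ y hy0)
  obtain ⟨δ, hδ, hball⟩ := Metric.eventually_nhds_iff_ball.1 hev
  refine ⟨min δ r, lt_min hδ hr, min_le_right _ _, L, fun z hz => ?_⟩
  have hzδ : z.1 ∈ Metric.ball x₀ δ := Metric.ball_subset_ball (min_le_left _ _) hz.1
  have hsub : Metric.ball x₀ (min δ r) ×ˢ ({0}ᶜ : Set E) ⊆ Metric.ball x₀ r ×ˢ ({0}ᶜ : Set E) :=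
    prod_mono_left (Metric.ball_subset_ball (min_le_right _ _))
  have hzr := hsub hz
  refine ⟨hLs z hzr, ?_, hLh z hzr, fun a b => ?_⟩
  · have hn : 0 < ‖z.2‖ := norm_pos_iff.2 hz.2
    have h1 := hball z.1 hzδ (‖z.2‖⁻¹ • z.2) (by
      rw [mem_sphere_zero_iff_norm, norm_smul, norm_inv, norm_norm, inv_mul_cancel₀ hn.ne'])
    rw [hLh z hzr _ (inv_pos.2 hn)] at h1
    exact (pos_iff_pos_of_mul_pos h1).1 (inv_pos.2 hn)
  · have h1 : fibreDeriv L =ᶠ[𝓝 z] fun z => θ₀ z - l := by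
      filter_upwards [(Metric.isOpen_ball.prod isOpen_compl_singleton).mem_nhds hzr] with w hw
      exact hθ.fibreDeriv_apply h hw
    rw [h1.fderiv_eq]
    exact (hθ z hzr).2 a b

end Lagrangian

/-! ### Alternating forms of degree two as bilinear forms -/

section TwoForms

variable {V W : Type*} [NormedAddCommGroup V] [NormedSpace ℝ V] [NormedAddCommGroup W]
  [NormedSpace ℝ W]

lemma pair_swap (α : V [⋀^Fin 2]→L[ℝ] ℝ) (a b : V) : α ![a, b] = -α ![b, a] := by
  have h := α.toAlternatingMap.map_swap ![b, a] (i := 0) (j := 1) (by decide)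
  have h2 : (![b, a] ∘ Equiv.swap (0 : Fin 2) 1) = ![a, b] := by
    ext i; fin_cases i <;> rfl
  rw [h2] at h
  exact h

lemma pair_add_left (α : V [⋀^Fin 2]→L[ℝ] ℝ) (a a' b : V) :
    α ![a + a', b] = α ![a, b] + α ![a', b] :=
  α.toAlternatingMap.map_vecCons_add ![b] a a'

lemma pair_smul_left (α : V [⋀^Fin 2]→L[ℝ] ℝ) (c : ℝ) (a b : V) :
    α ![c • a, b] = c * α ![a, b] :=
  α.toAlternatingMap.map_vecCons_smul ![b] c a

lemma pair_add_right (α : V [⋀^Fin 2]→L[ℝ] ℝ) (a b b' : V) :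
    α ![a, b + b'] = α ![a, b] + α ![a, b'] := by
  rw [pair_swap, pair_add_left, pair_swap α b, pair_swap α b']; ring

lemma pair_smul_right (α : V [⋀^Fin 2]→L[ℝ] ℝ) (c : ℝ) (a b : V) :
    α ![a, c • b] = c * α ![a, b] := by
  rw [pair_swap, pair_smul_left, pair_swap α b]; ring

lemma form_ext_pair {α α' : V [⋀^Fin 2]→L[ℝ] ℝ} (h : ∀ a b, α ![a, b] = α' ![a, b]) : α = α' := by
  ext m
  rw [show m = ![m 0, m 1] by ext i; fin_cases i <;> rfl]
  exact h _ _

variable [FiniteDimensional ℝ V]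

/-- An alternating form of degree two as a bilinear form. -/
def toBilin (α : V [⋀^Fin 2]→L[ℝ] ℝ) : V →L[ℝ] V →L[ℝ] ℝ :=
  LinearMap.toContinuousLinearMap
    { toFun := fun a => LinearMap.toContinuousLinearMap
        { toFun := fun b => α ![a, b]
          map_add' := pair_add_right α a
          map_smul' := fun c b => pair_smul_right α c a b }
      map_add' := fun a a' => by ext b; exact pair_add_left α a a' b
      map_smul' := fun c a => by ext b; exact pair_smul_left α c a b }

set_option maxSynthPendingDepth 3 in
lemma contDiffAt_toBilin {X : Type*} [NormedAddCommGroup X] [NormedSpace ℝ X] {n : WithTop ℕ∞}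
    {α : X → V [⋀^Fin 2]→L[ℝ] ℝ} {z : X} (h : ContDiffAt ℝ n α z) :
    ContDiffAt ℝ n (fun w => toBilin (α w)) z := by
  let L : (V [⋀^Fin 2]→L[ℝ] ℝ) →ₗ[ℝ] (V →L[ℝ] V →L[ℝ] ℝ) :=
    { toFun := toBilin, map_add' := fun _ _ => rfl, map_smul' := fun _ _ => rfl }
  exact L.toContinuousLinearMap.contDiff.contDiffAt.comp z h

set_option maxSynthPendingDepth 3 in
lemma differentiableAt_toBilin {X : Type*} [NormedAddCommGroup X] [NormedSpace ℝ X]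
    {α : X → V [⋀^Fin 2]→L[ℝ] ℝ} {z : X} (h : DifferentiableAt ℝ α z) :
    DifferentiableAt ℝ (fun w => toBilin (α w)) z := by
  let L : (V [⋀^Fin 2]→L[ℝ] ℝ) →ₗ[ℝ] (V →L[ℝ] V →L[ℝ] ℝ) :=
    { toFun := toBilin, map_add' := fun _ _ => rfl, map_smul' := fun _ _ => rfl }
  exact L.toContinuousLinearMap.differentiableAt.comp z h

lemma extDeriv_two_form_apply {α : V → V [⋀^Fin 2]→L[ℝ] ℝ} {z : V} (h : DifferentiableAt ℝ α z)
    (a b c : V) : extDeriv α z ![a, b, c] =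
      fderiv ℝ (fun w => toBilin (α w)) z a b c - fderiv ℝ (fun w => toBilin (α w)) z b a c +
        fderiv ℝ (fun w => toBilin (α w)) z c a b := by
  have hB : HasFDerivAt (fun w => toBilin (α w)) (fderiv ℝ (fun w => toBilin (α w)) z) z :=
    (differentiableAt_toBilin h).hasFDerivAt
  have h3 (u v w : V) : fderiv ℝ (fun z => α z ![u, v]) z w =
      fderiv ℝ (fun w => toBilin (α w)) z w u v := by
    have h1 := ((hB.clm_apply (hasFDerivAt_const u z)).clm_apply (hasFDerivAt_const v z)).fderiv
    refine (DFunLike.congr_fun h1 w).trans ?_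
    simp
  rw [extDeriv_apply h]
  have e0 : Fin.removeNth 0 ![a, b, c] = ![b, c] := by ext i; fin_cases i <;> rfl
  have e1 : Fin.removeNth 1 ![a, b, c] = ![a, c] := by ext i; fin_cases i <;> rfl
  have e2 : Fin.removeNth 2 ![a, b, c] = ![a, b] := by ext i; fin_cases i <;> rfl
  simp [Fin.sum_univ_three, e0, e1, e2, h3]
  ring

end TwoForms

/-! ### Descent of a closed 2-form through a submersion -/

section Descent

variable {V W : Type*} [NormedAddCommGroup V] [NormedSpace ℝ V] [FiniteDimensional ℝ V]
  [NormedAddCommGroup W] [NormedSpace ℝ W] [FiniteDimensional ℝ W]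

/-- The local straightening of a submersion: a smooth local inverse `Ψ` of `z ↦ (f z, B z)`, where `B`
is a projection to the kernel of the differential. -/
lemma exists_straightening {f : V → W} {z₀ : V} (hf : ContDiffAt ℝ ∞ f z₀)
    (hsurj : Function.Surjective (fderiv ℝ f z₀)) :
    ∃ (N : Submodule ℝ V) (B : V →L[ℝ] N) (e : OpenPartialHomeomorph V (W × N)), z₀ ∈ e.source ∧
      (∀ z, e z = (f z, B z)) ∧ ContDiffAt ℝ ∞ e.symm (e z₀) := by
  let A := fderiv ℝ f z₀
  let N : Submodule ℝ V := LinearMap.ker (A : V →ₗ[ℝ] W)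
  obtain ⟨B, hB⟩ := Submodule.ClosedComplemented.of_finiteDimensional N
  have hinj : Function.Injective (A.prod B) := by
    rw [injective_iff_map_eq_zero]
    intro a ha
    have h1 : A a = 0 := congrArg Prod.fst ha
    have h2 : B a = 0 := congrArg Prod.snd ha
    have h3 := hB ⟨a, h1⟩
    have h4 : (⟨a, h1⟩ : N) = 0 := h3.symm.trans h2
    exact congrArg Subtype.val h4
  have hsur : Function.Surjective (A.prod B) := by
    rintro ⟨w, k⟩
    obtain ⟨a, ha⟩ := hsurj w
    have hk : A (k - B a : N) = 0 := (k - B a : N).2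
    refine ⟨a + (k - B a : N), Prod.ext ?_ ?_⟩
    · show A (a + (k - B a : N)) = w
      rw [map_add, hk, add_zero]; exact ha
    · show B (a + (k - B a : N)) = k
      rw [map_add, hB]; abel
  let Φ' : V ≃L[ℝ] W × N :=
    (LinearEquiv.ofBijective (A.prod B : V →ₗ[ℝ] W × N) ⟨hinj, hsur⟩).toContinuousLinearEquiv
  have hΦ : ContDiffAt ℝ ∞ (fun z => (f z, B z)) z₀ := hf.prodMk B.contDiff.contDiffAt
  have hΦ' : HasFDerivAt (fun z => (f z, B z)) (Φ' : V →L[ℝ] W × N) z₀ :=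
    (hf.differentiableAt (by simp)).hasFDerivAt.prodMk B.hasFDerivAt
  exact ⟨N, B, hΦ.toOpenPartialHomeomorph _ hΦ' (by simp),
    hΦ.mem_toOpenPartialHomeomorph_source hΦ' (by simp), fun z => rfl,
    hΦ.to_localInverse hΦ' (by simp)⟩

/-- A closed 2-form annihilated by the kernel of the differential of a submersion `f` is locally the
pullback by `f` of a closed form: after straightening, closedness says that its coefficients do
not depend on the coordinates along the fibres. -/
lemma exists_local_descent {f : V → W} {z₀ : V} (hf : ContDiffAt ℝ ∞ f z₀)
    (hsurj : Function.Surjective (fderiv ℝ f z₀)) {α : V → V [⋀^Fin 2]→L[ℝ] ℝ}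
    (hα : ∀ᶠ z in 𝓝 z₀, ContDiffAt ℝ ∞ f z ∧ ContDiffAt ℝ ∞ α z ∧ extDeriv α z = 0 ∧
      ∀ a, fderiv ℝ f z a = 0 → ∀ b, α z ![a, b] = 0) :
    ∃ κ : W → W [⋀^Fin 2]→L[ℝ] ℝ, ContDiffAt ℝ ∞ κ (f z₀) ∧ extDeriv κ (f z₀) = 0 ∧
      ∀ᶠ z in 𝓝 z₀, α z = (κ (f z)).compContinuousLinearMap (fderiv ℝ f z) := by
  obtain ⟨N, B, e, hz₀, he, hΨ⟩ := exists_straightening hf hsurj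
  have hfst : ∀ᶠ w in 𝓝 (e z₀), f (e.symm w) = w.1 := by
    filter_upwards [e.open_target.mem_nhds (e.map_source hz₀)] with w hw
    have h1 := he (e.symm w)
    rw [e.right_inv hw] at h1
    exact (congrArg Prod.fst h1).symm
  have hΨ0 : e.symm (e z₀) = z₀ := e.left_inv hz₀
  have hΨs : ∀ᶠ w in 𝓝 (e z₀), ContDiffAt ℝ 2 e.symm w :=
    (hΨ.of_le (m := 2) (WithTop.coe_le_coe.2 le_top)).eventually (by simp)
  -- the form in the straightened coordinates
  set ω' : W × N → (W × N) [⋀^Fin 2]→L[ℝ] ℝ := fun w =>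
    (α (e.symm w)).compContinuousLinearMap (fderiv ℝ e.symm w)
  have hcont : Filter.Tendsto e.symm (𝓝 (e z₀)) (𝓝 z₀) := by
    have := hΨ.continuousAt.tendsto
    rwa [hΨ0] at this
  have hω'1 : ∀ᶠ w in 𝓝 (e z₀), ContDiffAt ℝ 1 ω' w ∧ extDeriv ω' w = 0 ∧
      ∀ k b, ω' w ![(0, k), b] = 0 := by
    filter_upwards [hcont.eventually hα, hΨs, hfst.eventually_nhds,
      e.open_target.mem_nhds (e.map_source hz₀)] with w hw hws hwf hwt
    obtain ⟨hw1, hw2, hw3, hw4⟩ := hw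
    refine ⟨contDiffAt_pullbackForm ?_ ?_, ?_, fun k b => ?_⟩
    · exact ContDiffAt.comp (g := α) w (hw2.of_le (WithTop.coe_le_coe.2 le_top))
        (hws.of_le (by norm_num))
    · exact hws.fderiv_right (by norm_num)
    · refine (extDeriv_pullback (r := 2) (hw2.differentiableAt (by simp)) hws (by
        rw [minSmoothness_of_isRCLikeNormedField])).trans ?_
      rw [hw3]; rfl
    · have h1 : HasFDerivAt (fun w => f (e.symm w)) _ w :=
        HasFDerivAt.comp (g := f) w (hw1.differentiableAt (by simp)).hasFDerivAt
          (hws.differentiableAt (by simp)).hasFDerivAt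
      have h2 : HasFDerivAt (fun w => f (e.symm w)) (ContinuousLinearMap.fst ℝ W N) w :=
        hasFDerivAt_fst.congr_of_eventuallyEq hwf
      have h3 := DFunLike.congr_fun (h1.unique h2) (0, k)
      refine (compContinuousLinearMap_pair _ _ _ _).trans (hw4 _ ?_ _)
      exact h3
  obtain ⟨ε, hε, hball⟩ := Metric.eventually_nhds_iff_ball.1 hω'1
  -- `dω' = 0` on a vector `(0, v)` along the fibre, which annihilates `ω'` identically, says that the
  -- derivative of the coefficients in that direction vanishes
  have hconst : ∀ w ∈ Metric.ball (e z₀) ε, ω' w = ω' (w.1, (e z₀).2) := by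
    intro w hw
    have hw' : ∀ k ∈ Metric.ball (e z₀).2 ε, (w.1, k) ∈ Metric.ball (e z₀) ε := fun k hk => by
      rw [Metric.mem_ball, Prod.dist_eq] at hw ⊢
      exact max_lt (lt_of_le_of_lt (le_max_left _ _) hw) hk
    have hd (k : N) (hk : k ∈ Metric.ball (e z₀).2 ε) := ((hball _ (hw' k hk)).1.differentiableAt
      (by simp))
    have hder : ∀ k ∈ Metric.ball (e z₀).2 ε, ∀ v, fderiv ℝ (fun w => toBilin (ω' w)) (w.1, k) (0, v)
        = 0 := by
      intro k hk v
      have hv (u b c) : fderiv ℝ (fun w => toBilin (ω' w)) (w.1, k) u (0, b) c = 0 := by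
        have hB : HasFDerivAt (fun w => toBilin (ω' w)) (fderiv ℝ (fun w => toBilin (ω' w)) (w.1, k))
          (w.1, k) := (differentiableAt_toBilin (hd k hk)).hasFDerivAt
        have h1 := ((hB.clm_apply (hasFDerivAt_const ((0 : W), b) (w.1, k))).clm_apply
          (hasFDerivAt_const c (w.1, k))).fderiv
        have h2 : (fun w => toBilin (ω' w) (0, b) c) =ᶠ[𝓝 (w.1, k)] fun _ => 0 := by
          filter_upwards [Metric.isOpen_ball.mem_nhds (hw' k hk)] with w hw
            using (hball w hw).2.2 b c
        rw [h2.fderiv_eq] at h1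
        have h3 := DFunLike.congr_fun h1 u
        simpa using h3.symm
      refine ContinuousLinearMap.ext fun a => ContinuousLinearMap.ext fun b => ?_
      have h1 := extDeriv_two_form_apply (hd k hk) (0, v) a b
      rw [(hball _ (hw' k hk)).2.1, hv, hv] at h1
      simpa using h1.symm
    have hBd (k : N) (hk : k ∈ Metric.ball (e z₀).2 ε) : HasFDerivAt (fun k => toBilin (ω' (w.1, k)))
        ((fderiv ℝ (fun w => toBilin (ω' w)) (w.1, k)).comp (ContinuousLinearMap.inr ℝ W N)) k :=
      have h1 : HasFDerivAt (fun k : N => (w.1, k)) (ContinuousLinearMap.inr ℝ W N) k :=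
        (hasFDerivAt_const _ _).prodMk (hasFDerivAt_id _)
      HasFDerivAt.comp (g := fun w => toBilin (ω' w)) k
        (differentiableAt_toBilin (hd k hk)).hasFDerivAt h1
    have h2 := (Metric.isOpen_ball (x := (e z₀).2) (ε := ε)).is_const_of_fderiv_eq_zero (𝕜 := ℝ)
      (f := fun k => toBilin (ω' (w.1, k))) (convex_ball _ _).isPreconnected
      (fun k hk => (hBd k hk).differentiableAt.differentiableWithinAt) (fun k hk => by
        rw [(hBd k hk).fderiv]
        exact ContinuousLinearMap.ext fun v => hder k hk v)
      (x := w.2) (y := (e z₀).2) (by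
        rw [Metric.mem_ball, Prod.dist_eq] at hw
        exact lt_of_le_of_lt (le_max_right _ _) hw) (Metric.mem_ball_self hε)
    exact form_ext_pair fun a b => DFunLike.congr_fun (DFunLike.congr_fun h2 a) b
  -- the pullback by the local section `s` of `f`
  set s : W → V := fun w => e.symm (w, (e z₀).2)
  have hj (w : W) : HasFDerivAt (fun w : W => (w, (e z₀).2)) (ContinuousLinearMap.inl ℝ W N) w :=
    (hasFDerivAt_id w).prodMk (hasFDerivAt_const _ _)
  have hez : (f z₀, (e z₀).2) = e z₀ := by rw [he]
  have hs : ContDiffAt ℝ ∞ s (f z₀) :=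
    ContDiffAt.comp (g := e.symm) (f z₀) (by rwa [hez]) (by fun_prop)
  have hs0 : s (f z₀) = z₀ := by simp only [s]; rw [hez, hΨ0]
  obtain ⟨-, hα1, hα2, -⟩ := hα.self_of_nhds
  refine ⟨fun w => (α (s w)).compContinuousLinearMap (fderiv ℝ s w),
    contDiffAt_pullbackForm (ContDiffAt.comp (g := α) _ (by rwa [hs0]) hs) (hs.fderiv_right (by simp)),
    ?_, ?_⟩
  · refine (extDeriv_pullback (r := ∞) (by rw [hs0]; exact hα1.differentiableAt (by simp)) hs
      minSmoothness_two_le).trans ?_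
    rw [hs0, hα2]; rfl
  · have hcont' : ContinuousAt e z₀ := e.continuousAt hz₀
    have hcont2 : ContinuousAt (fun z => (f z, (e z₀).2)) z₀ :=
      hf.continuousAt.prodMk continuousAt_const
    have hΨs2 : ∀ᶠ w in 𝓝 (f z₀, (e z₀).2), ContDiffAt ℝ 2 e.symm w := by rwa [hez]
    filter_upwards [hcont'.eventually (Metric.isOpen_ball.mem_nhds (Metric.mem_ball_self hε)),
      e.open_source.mem_nhds hz₀, hcont'.eventually hΨs, hcont2.eventually hΨs2, hα]
      with z hz hzs hzΨ hzΨ2 hzf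
    have he1 : HasFDerivAt e ((fderiv ℝ f z).prod B) z := by
      rw [show (e : V → W × N) = fun z => (f z, B z) from funext he]
      exact (hzf.1.differentiableAt (by simp)).hasFDerivAt.prodMk B.hasFDerivAt
    have h1 : HasFDerivAt (fun z => e.symm (e z)) _ z :=
      HasFDerivAt.comp (g := e.symm) z (hzΨ.differentiableAt (by simp)).hasFDerivAt he1
    have h2 : HasFDerivAt (fun z => e.symm (e z)) (ContinuousLinearMap.id ℝ V) z := by
      refine (hasFDerivAt_id z).congr_of_eventuallyEq ?_
      filter_upwards [e.open_source.mem_nhds hzs] with w hw using e.left_inv hw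
    have h3 := h1.unique h2
    have h4 : fderiv ℝ s (f z) = (fderiv ℝ e.symm (f z, (e z₀).2)).comp
        (ContinuousLinearMap.inl ℝ W N) :=
      (HasFDerivAt.comp (g := e.symm) (f z) (hzΨ2.differentiableAt (by simp)).hasFDerivAt
        (hj (f z))).fderiv
    have h5 := hconst (e z) hz
    have h6 : (e z).1 = f z := by rw [he]
    rw [h6] at h5
    refine form_ext_pair fun a b => ?_
    have h7 (a : V) : a = fderiv ℝ e.symm (e z) (fderiv ℝ f z a, B a) :=
      (DFunLike.congr_fun h3 a).symm
    have h8 : α z ![a, b] = ω' (e z) ![(fderiv ℝ f z a, B a), (fderiv ℝ f z b, B b)] := by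
      have h9 := compContinuousLinearMap_pair (α (e.symm (e z))) (fderiv ℝ e.symm (e z))
        (fderiv ℝ f z a, B a) (fderiv ℝ f z b, B b)
      rw [← h7 a, ← h7 b, e.left_inv hzs] at h9
      simp only [ω']
      rw [e.left_inv hzs, h9]
    have hmem := hball (f z, (e z₀).2) (by
      have hz' : dist (e z) (e z₀) < ε := hz
      rw [Prod.dist_eq] at hz'
      rw [Metric.mem_ball, Prod.dist_eq]
      refine max_lt ?_ (by simpa using hε)
      have := lt_of_le_of_lt (le_max_left _ _) hz'
      rwa [h6] at this)
    have hv (a : W × N) (b : W × N) : ω' (f z, (e z₀).2) ![a, b] =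
        ω' (f z, (e z₀).2) ![(a.1, 0), (b.1, 0)] := by
      have ha : a = (a.1, 0) + (0, a.2) := by simp
      have hb : b = (b.1, 0) + (0, b.2) := by simp
      conv_lhs => rw [ha, hb]
      rw [pair_add_left, pair_add_right, hmem.2.2, pair_swap _ (a.1, 0) (0, b.2), hmem.2.2]
      ring
    rw [h8, h5, hv]
    refine (compContinuousLinearMap_pair _ _ _ _).trans ?_
    refine Eq.trans ?_ (compContinuousLinearMap_pair _ _ _ _).symm
    refine Eq.trans ?_ (compContinuousLinearMap_pair _ _ _ _).symm
    rw [h4]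
    rfl

end Descent

/-! ### Smooth maps in charts and the pullback of forms -/

section MapCoordinates

variable {V : Type*} [NormedAddCommGroup V] [NormedSpace ℝ V]
  {H : Type*} [TopologicalSpace H] (I : ModelWithCorners ℝ V H)
  {N : Type*} [TopologicalSpace N] [ChartedSpace H N]
  {V' : Type*} [NormedAddCommGroup V'] [NormedSpace ℝ V']
  {H' : Type*} [TopologicalSpace H'] (I' : ModelWithCorners ℝ V' H')
  {N' : Type*} [TopologicalSpace N'] [ChartedSpace H' N']

/-- The expression of a map in the preferred charts at `q` and `q'`. -/
def mapInCharts (f : N → N') (q : N) (q' : N') (z : V) : V' :=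
  extChartAt I' q' (f ((extChartAt I q).symm z))

/-- The pullback of a form by a map. -/
def pullForm {k : ℕ} (f : N → N') (α : FormField I' N' k) : FormField I N k := fun p =>
  (α (f p)).compContinuousLinearMap (mfderiv I I' f p)

variable {I I'} {f : N → N'} {q : N} {q' : N'} {p : N}
  [IsManifold I ∞ N] [IsManifold I' ∞ N']

lemma contDiffAt_mapInCharts [I.Boundaryless] (hp : p ∈ (extChartAt I q).source)
    (hfp : f p ∈ (extChartAt I' q').source) (hf : ContMDiffAt I I' ∞ f p) :
    ContDiffAt ℝ ∞ (mapInCharts I I' f q q') (extChartAt I q p) := by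
  rw [extChartAt_source] at hp hfp
  have h := ((contMDiffAt_iff_of_mem_source hp hfp).1 hf).2
  rw [I.range_eq_univ, contDiffWithinAt_univ] at h
  exact h

lemma fderiv_mapInCharts [I.Boundaryless] {z : V} (hz : z ∈ (extChartAt I q).target)
    (hfp : f ((extChartAt I q).symm z) ∈ (extChartAt I' q').source)
    (hf : MDifferentiableAt I I' f ((extChartAt I q).symm z)) (a : V) :
    fderiv ℝ (mapInCharts I I' f q q') z a = dchart I' q' (f ((extChartAt I q).symm z))
      (mfderiv I I' f ((extChartAt I q).symm z) (dchartSymm I q z a)) := by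
  rw [← mfderiv_eq_fderiv]
  have h1 := mfderiv_comp z hf (mdifferentiableAt_chart_symm hz)
  have h2 := mfderiv_comp (I'' := 𝓘(ℝ, V')) (g := extChartAt I' q') z (mdifferentiableAt_chart hfp)
    (hf.comp z (mdifferentiableAt_chart_symm hz))
  refine (DFunLike.congr_fun h2 a).trans ?_
  exact congrArg (dchart I' q' (f ((extChartAt I q).symm z))) (DFunLike.congr_fun h1 a)

lemma fderiv_mapInCharts_dchart [I.Boundaryless] (hp : p ∈ (extChartAt I q).source)
    (hfp : f p ∈ (extChartAt I' q').source) (hf : MDifferentiableAt I I' f p)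
    (a : TangentSpace I p) :
    fderiv ℝ (mapInCharts I I' f q q') (extChartAt I q p) (dchart I q p a) =
      dchart I' q' (f p) (mfderiv I I' f p a) := by
  have key : ∀ p', p' = p → ∀ b : V, b = a →
      dchart I' q' (f p') (mfderiv I I' f p' b) = dchart I' q' (f p) (mfderiv I I' f p a) := by
    rintro _ rfl _ rfl; rfl
  have hl := (extChartAt I q).left_inv hp
  have h := fderiv_mapInCharts (f := f) (q' := q') ((extChartAt I q).map_source hp) (by rwa [hl])
    (by rwa [hl]) (dchart I q p a)
  exact h.trans (key _ hl _ (dchartSymm_dchart hp a))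

lemma formInChart_pullForm [I.Boundaryless] [I'.Boundaryless] {k : ℕ} (α : FormField I' N' k)
    {z : V} (hz : z ∈ (extChartAt I q).target)
    (hfp : f ((extChartAt I q).symm z) ∈ (extChartAt I' q').source)
    (hf : MDifferentiableAt I I' f ((extChartAt I q).symm z)) :
    formInChart (pullForm I I' f α) q z =
      (formInChart α q' (mapInCharts I I' f q q' z)).compContinuousLinearMap
        (fderiv ℝ (mapInCharts I I' f q q') z) := by
  ext m
  have h := form_eq_formInChart α hfp
    (fun i => mfderiv I I' f ((extChartAt I q).symm z) (dchartSymm I q z (m i)))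
  refine Eq.trans (show _ = _ from rfl) (h.trans ?_)
  exact congrArg (formInChart α q' (mapInCharts I I' f q q' z))
    (funext fun i => (fderiv_mapInCharts hz hfp hf (m i)).symm)

lemma formInChart_pullForm_eventuallyEq [I.Boundaryless] [I'.Boundaryless] {k : ℕ}
    (α : FormField I' N' k) (hp : p ∈ (extChartAt I q).source)
    (hfp : f p ∈ (extChartAt I' q').source) (hf : ContMDiffAt I I' ∞ f p) :
    formInChart (pullForm I I' f α) q =ᶠ[𝓝 (extChartAt I q p)] fun z =>
      (formInChart α q' (mapInCharts I I' f q q' z)).compContinuousLinearMap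
        (fderiv ℝ (mapInCharts I I' f q q') z) := by
  have : IsManifold I 1 N := IsManifold.of_le (n := ∞) (WithTop.coe_le_coe.2 le_top)
  have : IsManifold I' 1 N' := IsManifold.of_le (n := ∞) (WithTop.coe_le_coe.2 le_top)
  have h1 : ∀ᶠ p' in 𝓝 p, ContMDiffAt I I' 1 f p' :=
    (contMDiffAt_iff_contMDiffAt_nhds (by simp)).1
      (hf.of_le (m := 1) (WithTop.coe_le_coe.2 le_top))
  have h2 : ∀ᶠ p' in 𝓝 p, f p' ∈ (extChartAt I' q').source :=
    hf.continuousAt.eventually ((isOpen_extChartAt_source q').mem_nhds hfp)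
  have hc : Filter.Tendsto (extChartAt I q).symm (𝓝 (extChartAt I q p)) (𝓝 p) := by
    have := continuousAt_extChartAt_symm' hp
    rwa [ContinuousAt, (extChartAt I q).left_inv hp] at this
  filter_upwards [hc.eventually (h1.and h2), (isOpen_extChartAt_target q).mem_nhds
    ((extChartAt I q).map_source hp)] with z hz hzt
  exact formInChart_pullForm α hzt hz.2 (hz.1.mdifferentiableAt (by simp))

lemma mapInCharts_extChartAt (hp : p ∈ (extChartAt I q).source) :
    mapInCharts I I' f q q' (extChartAt I q p) = extChartAt I' q' (f p) := by
  rw [mapInCharts, (extChartAt I q).left_inv hp]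

lemma contDiffAt_formInChart_pullForm [I.Boundaryless] [I'.Boundaryless] [FiniteDimensional ℝ V]
    [FiniteDimensional ℝ V'] {k : ℕ} {α : FormField I' N' k} (hp : p ∈ (extChartAt I q).source)
    (hf : ContMDiffAt I I' ∞ f p) (hα : SmoothFormAt I' α (f p)) :
    ContDiffAt ℝ ∞ (formInChart (pullForm I I' f α) q) (extChartAt I q p) := by
  have hfp := mem_extChartAt_source (I := I') (f p)
  have h1 := contDiffAt_mapInCharts hp hfp hf
  refine ContDiffAt.congr_of_eventuallyEq ?_ (formInChart_pullForm_eventuallyEq α hp hfp hf)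
  refine contDiffAt_pullbackForm (ContDiffAt.comp (g := formInChart α (f p)) _ ?_ h1)
    (h1.fderiv_right (by simp))
  rw [mapInCharts_extChartAt hp]
  exact hα

lemma extDeriv_formInChart_eq_zero [I.Boundaryless] [FiniteDimensional ℝ V] {k : ℕ}
    {α : FormField I N k} (hp : p ∈ (extChartAt I q).source) (hα : SmoothFormAt I α p)
    (hd : extD α p = 0) : extDeriv (formInChart α q) (extChartAt I q p) = 0 := by
  rw [← formInChart_extD ((extChartAt I q).map_source hp) (hα.contDiffAt_formInChart hp)]
  have hl := (extChartAt I q).left_inv hp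
  have h1 : extD α ((extChartAt I q).symm (extChartAt I q p)) = 0 := by rw [hl]; exact hd
  ext m
  exact DFunLike.congr_fun h1 _

lemma extDeriv_formInChart_pullForm [I.Boundaryless] [I'.Boundaryless] [FiniteDimensional ℝ V]
    [FiniteDimensional ℝ V'] {k : ℕ} {α : FormField I' N' k} (hp : p ∈ (extChartAt I q).source)
    (hf : ContMDiffAt I I' ∞ f p) (hα : SmoothFormAt I' α (f p)) (hd : extD α (f p) = 0) :
    extDeriv (formInChart (pullForm I I' f α) q) (extChartAt I q p) = 0 := by
  have hfp := mem_extChartAt_source (I := I') (f p)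
  have hm := mapInCharts_extChartAt (I := I) (I' := I') (f := f) (q' := f p) hp
  rw [(formInChart_pullForm_eventuallyEq α hp hfp hf).extDeriv_eq]
  refine (extDeriv_pullback (r := ∞) (by rw [hm]; exact hα.differentiableAt (by simp))
    (contDiffAt_mapInCharts hp hfp hf) minSmoothness_two_le).trans ?_
  rw [hm, extDeriv_formInChart_eq_zero hfp hα hd]
  rfl

end MapCoordinates

/-! ### The distribution spanned by the Liouville field and the spray -/

section Distribution

variable {E : Type*} [NormedAddCommGroup E] [NormedSpace ℝ E]
  {M : Type*} [TopologicalSpace M] [ChartedSpace E M] [IsManifold 𝓘(ℝ, E) ∞ M]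
  {Γ : FieldOnTM E M} {p : TangentBundle 𝓘(ℝ, E) M}

lemma dtchart_injective {x₀ : M} (hx : p.proj ∈ (bchart E x₀).source) :
    Function.Injective (dtchart x₀ p) :=
  dchart_injective (I := 𝓘(ℝ, E).tangent) (mem_tchart_source.2 hx)

lemma exists_dtchart_eq {x₀ : M} (hx : p.proj ∈ (bchart E x₀).source) (a : E × E) :
    ∃ ξ : TangentSpace 𝓘(ℝ, E).tangent p, dtchart x₀ p ξ = a :=
  ⟨_, dchart_dchartSymm' (I := 𝓘(ℝ, E).tangent) (mem_tchart_source.2 hx) a⟩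

lemma dτ_vlift (v : TangentSpace 𝓘(ℝ, E) p.proj) : dτ p (vlift p v) = 0 := by
  have hx : p.proj ∈ (bchart E p.proj).source := mem_extChartAt_source _
  refine dchart_injective hx ?_
  refine (fst_dtchart hx _).symm.trans ?_
  rw [dtchart_vlift hx]
  exact (map_zero (dbchart E p.proj p.proj)).symm

lemma eq_vlift_of_dτ_eq_zero {ξ : TangentSpace 𝓘(ℝ, E).tangent p} (h : dτ p ξ = 0) :
    ∃ v : TangentSpace 𝓘(ℝ, E) p.proj, ξ = vlift p v := by
  have hx : p.proj ∈ (bchart E p.proj).source := mem_extChartAt_source _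
  refine ⟨dbchartSymm E p.proj (bchart E p.proj p.proj) (dtchart p.proj p ξ).2,
    dtchart_injective hx (Eq.trans ?_ (dtchart_vlift hx _).symm)⟩
  refine Prod.ext ?_ ?_
  · refine (fst_dtchart hx ξ).trans ?_
    rw [h]; exact map_zero (dbchart E p.proj p.proj)
  · exact (dchart_dchartSymm' (I := 𝓘(ℝ, E)) hx _).symm

lemma vlift_injective : Function.Injective (vlift (E := E) p) := by
  have hx : p.proj ∈ (bchart E p.proj).source := mem_extChartAt_source _
  intro v w h
  have h1 := congrArg (dtchart p.proj p) h
  rw [dtchart_vlift hx, dtchart_vlift hx] at h1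
  exact dchart_injective hx (congrArg Prod.snd h1)

lemma vlift_smul (c : ℝ) (v : TangentSpace 𝓘(ℝ, E) p.proj) :
    vlift p (c • v) = c • vlift p v :=
  map_smul (mfderiv 𝓘(ℝ, E) 𝓘(ℝ, E).tangent
    (fun w : E => (⟨p.proj, w⟩ : TangentBundle 𝓘(ℝ, E) M)) (p.2 : E)) c v

lemma IsSpray.dτ_of_mem_distD (hΓ : IsSpray univ Γ) (hp : p ∈ slit E univ)
    {ξ : TangentSpace 𝓘(ℝ, E).tangent p} (h : ξ ∈ distD Γ p) :
    ∃ c : ℝ, dτ p ξ = c • p.2 := by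
  obtain ⟨a, b, rfl⟩ := Submodule.mem_span_pair.1 h
  refine ⟨b, ?_⟩
  rw [map_add, map_smul, map_smul, hΓ.secondOrder p hp, liouville, dτ_vlift, smul_zero, zero_add]

/-- The vertical vectors in the distribution are the multiples of the Liouville field. -/
lemma IsSpray.eq_smul_of_vlift_mem_distD (hΓ : IsSpray univ Γ) (hp : p ∈ slit E univ)
    {v : TangentSpace 𝓘(ℝ, E) p.proj} (h : vlift p v ∈ distD Γ p) : ∃ c : ℝ, v = c • p.2 := by
  obtain ⟨a, b, hab⟩ := Submodule.mem_span_pair.1 h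
  have h1 := congrArg (dτ p) hab
  rw [map_add, map_smul, map_smul, hΓ.secondOrder p hp, liouville, dτ_vlift, dτ_vlift, smul_zero,
    zero_add] at h1
  have hb : b = 0 := (smul_eq_zero.1 h1).resolve_right hp.2
  refine ⟨a, vlift_injective ?_⟩
  rw [vlift_smul, ← hab, hb, zero_smul, add_zero, liouville]

lemma vlift_smul_mem_distD (c : ℝ) : vlift p (c • p.2) ∈ distD Γ p := by
  rw [vlift_smul]
  exact Submodule.smul_mem _ _ (Submodule.subset_span (Or.inl rfl))

/-- The lift of a Jacobi field with data `(0, v)` starts with the vertical lift of `v`, since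
`∇ζ = dζ/dt` where `ζ` vanishes. -/
lemma IsSpray.vlift_eq_of_isJacobiLift (hΓ : IsSpray univ Γ) {J : Set ℝ}
    {σ : ℝ → TangentBundle 𝓘(ℝ, E) M} (hσ : IsLiftedGeodesic univ Γ J σ) (h0 : (0 : ℝ) ∈ J)
    {Z : (t : ℝ) → TangentSpace 𝓘(ℝ, E).tangent (σ t)} {v : TangentSpace 𝓘(ℝ, E) (σ 0).proj}
    (h : IsJacobiLift Γ J σ Z 0 v) : Z 0 = vlift (σ 0) v := by
  have hx : (σ 0).proj ∈ (bchart E (σ 0).proj).source := mem_extChartAt_source _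
  have h1 := ((hΓ.isJacobiLift_iff isOpen_univ hσ h0).1 h).2
  refine dtchart_injective hx (h1.trans ?_)
  rw [dtchart_vlift hx]
  have h2 : dbchart E (σ 0).proj (σ 0).proj (0 : E) = 0 := map_zero _
  refine Prod.ext h2 ?_
  have h3 : connCoeff Γ (σ 0) (dbchart E (σ 0).proj (σ 0).proj (0 : E)) = 0 := by
    rw [h2]; exact map_zero (fderiv ℝ _ _)
  show _ - connCoeff Γ (σ 0) (dbchart E (σ 0).proj (σ 0).proj (0 : E)) = _
  rw [h3, sub_zero]

variable {E' : Type*} [NormedAddCommGroup E'] [NormedSpace ℝ E']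
  {P : Type*} [TopologicalSpace P] [ChartedSpace E' P]
  {π : TangentBundle 𝓘(ℝ, E) M → P}

lemma IsPathSpace.contMDiffAt (hπ : IsPathSpace E' Γ π) (hp : p ∈ slit E univ) :
    ContMDiffAt 𝓘(ℝ, E).tangent 𝓘(ℝ, E') ∞ π p :=
  (hπ.smooth p hp).contMDiffAt ((isOpen_slit isOpen_univ).mem_nhds hp)

lemma IsPathSpace.dπ_eq_zero_iff (hπ : IsPathSpace E' Γ π) (hp : p ∈ slit E univ)
    (ξ : TangentSpace 𝓘(ℝ, E).tangent p) : dπ (E' := E') π p ξ = 0 ↔ ξ ∈ distD Γ p := by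
  rw [← hπ.ker_eq p hp]
  exact Iff.rfl

lemma IsLagrangianHat.apply_vlift {Ω : FormField 𝓘(ℝ, E') P 2}
    (h : IsLagrangianHat π Ω p.proj) (hp : p ∈ slit E univ) (v w : TangentSpace 𝓘(ℝ, E) p.proj) :
    Ω (π p) ![dπ π p (vlift p v), dπ π p (vlift p w)] = 0 :=
  (h p ⟨rfl, hp.2⟩ _).1 ⟨_, dτ_vlift v, rfl⟩ _ ⟨_, dτ_vlift w, rfl⟩

end Distribution

section Positivity

variable {E : Type*} [NormedAddCommGroup E] [NormedSpace ℝ E] [CompleteSpace E]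
  {M : Type*} [TopologicalSpace M] [ChartedSpace E M] [IsManifold 𝓘(ℝ, E) ∞ M]
  {Γ : FieldOnTM E M} {p : TangentBundle 𝓘(ℝ, E) M}
  {E' : Type*} [NormedAddCommGroup E'] [NormedSpace ℝ E']
  {P : Type*} [TopologicalSpace P] [ChartedSpace E' P]
  {π : TangentBundle 𝓘(ℝ, E) M → P} {Ω : FormField 𝓘(ℝ, E') P 2}

/-- Positivity on Jacobi fields, freed of Jacobi fields: a Jacobi field with data `(0, v)`
starts with the vertical lift of `v`, and as the fibres are isotropic, of a Jacobi field with data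
`(v, 0)` only `v` matters. -/
lemma IsPositiveOnJacobi.apply_vlift_pos (h : IsPositiveOnJacobi Γ π Ω) (hΓ : IsSpray univ Γ)
    (hπ : IsPathSpace E' Γ π) (hL : ∀ x, IsLagrangianHat π Ω x) (hp : p ∈ slit E univ)
    (ξ : TangentSpace 𝓘(ℝ, E).tangent p) (hv : ∀ c : ℝ, dτ p ξ ≠ c • p.2) :
    0 < Ω (π p) ![dπ π p ξ, dπ π p (vlift p (dτ p ξ))] := by
  have hx : p.proj ∈ (bchart E p.proj).source := mem_extChartAt_source _
  obtain ⟨ε, hε, σ, Z₁, Z₂, rfl, hσ, hZ₁, hZ₂, hb₁, hb₂⟩ :=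
    hΓ.exists_geodesic_and_transported isOpen_univ hp
      (dbchart E p.proj p.proj (dτ p ξ),
        dbchart E p.proj p.proj (0 : E) - connCoeff Γ p (dbchart E p.proj p.proj (dτ p ξ)))
      (dbchart E p.proj p.proj (0 : E), dbchart E p.proj p.proj (dτ p ξ) -
        connCoeff Γ p (dbchart E p.proj p.proj (0 : E)))
  have h0 : (0 : ℝ) ∈ Ioo (-ε) ε := ⟨by linarith, hε⟩
  have hJ₁ : IsJacobiLift Γ (Ioo (-ε) ε) σ Z₁ (dτ (σ 0) ξ) 0 :=
    (hΓ.isJacobiLift_iff isOpen_univ hσ h0).2 ⟨hZ₁, hb₁⟩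
  have hJ₂ : IsJacobiLift Γ (Ioo (-ε) ε) σ Z₂ 0 (dτ (σ 0) ξ) :=
    (hΓ.isJacobiLift_iff isOpen_univ hσ h0).2 ⟨hZ₂, hb₂⟩
  have hZ₂0 := hΓ.vlift_eq_of_isJacobiLift hσ h0 hJ₂
  have hpos := h _ σ hσ h0 _ Z₁ Z₂ hJ₁ hJ₂ (fun h1 => by
    obtain ⟨c, hc⟩ := hΓ.dτ_of_mem_distD hp ((hπ.dπ_eq_zero_iff hp _).1 h1)
    exact hv c (hJ₁.initial.symm.trans hc)) (fun h1 => by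
    rw [hZ₂0] at h1
    obtain ⟨c, hc⟩ := hΓ.eq_smul_of_vlift_mem_distD hp ((hπ.dπ_eq_zero_iff hp _).1 h1)
    exact hv c hc)
  have h2 : dτ (σ 0) (ξ - Z₁ 0) = 0 := by rw [map_sub, hJ₁.initial, sub_self]
  obtain ⟨w, hw⟩ := eq_vlift_of_dτ_eq_zero h2
  have h3 : dπ π (σ 0) ξ = dπ (E' := E') π (σ 0) (Z₁ 0) + dπ π (σ 0) (vlift (σ 0) w) := by
    rw [← map_add, ← hw, add_sub_cancel]
  have h4 := pair_add_left (V := E') (Ω (π (σ 0))) (dπ (E' := E') π (σ 0) (Z₁ 0))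
    (dπ π (σ 0) (vlift (σ 0) w)) (dπ π (σ 0) (vlift (σ 0) (dτ (σ 0) ξ)))
  rw [h3]
  refine lt_of_lt_of_eq ?_ h4.symm
  have h5 := (hL (σ 0).proj).apply_vlift hp w (dτ (σ 0) ξ)
  have h6 : 0 < Ω (π (σ 0)) ![dπ (E' := E') π (σ 0) (Z₁ 0), dπ π (σ 0) (vlift (σ 0) (dτ (σ 0) ξ))] := by
    rw [← hZ₂0]; exact hpos
  exact lt_of_lt_of_eq (add_pos_of_pos_of_nonneg h6 h5.ge) rfl

end Positivity

/-! ### From a symplectic form on path space to Finsler functions -/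

section PathSpaceForm

universe u

variable {E : Type u} [NormedAddCommGroup E] [NormedSpace ℝ E] [FiniteDimensional ℝ E]
  {M : Type*} [TopologicalSpace M] [ChartedSpace E M] [IsManifold 𝓘(ℝ, E) ∞ M]
  {Γ : FieldOnTM E M}
  {E' : Type*} [NormedAddCommGroup E'] [NormedSpace ℝ E'] [FiniteDimensional ℝ E']
  {P : Type*} [TopologicalSpace P] [ChartedSpace E' P] [IsManifold 𝓘(ℝ, E') ∞ P]
  {π : TangentBundle 𝓘(ℝ, E) M → P} {Ω : FormField 𝓘(ℝ, E') P 2}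

/-- The pullback of a 2-form on path space, in the coordinates of `TM` induced by the chart at `x₀`. -/
def pullBilin (π : TangentBundle 𝓘(ℝ, E) M → P) (Ω : FormField 𝓘(ℝ, E') P 2) (x₀ : M)
    (z : E × E) : (E × E) →L[ℝ] (E × E) →L[ℝ] ℝ :=
  toBilin (formInChart (pullForm 𝓘(ℝ, E).tangent 𝓘(ℝ, E') π Ω)
    (⟨x₀, 0⟩ : TangentBundle 𝓘(ℝ, E) M) z)

lemma pullBilin_dtchart {x₀ : M} {p : TangentBundle 𝓘(ℝ, E) M}
    (hx : p.proj ∈ (bchart E x₀).source) (ξ η : TangentSpace 𝓘(ℝ, E).tangent p) :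
    pullBilin π Ω x₀ (tchart E x₀ p) (dtchart x₀ p ξ) (dtchart x₀ p η) =
      Ω (π p) ![dπ (E' := E') π p ξ, dπ π p η] := by
  have h := form_eq_formInChart (pullForm 𝓘(ℝ, E).tangent 𝓘(ℝ, E') π Ω)
    (q := (⟨x₀, 0⟩ : TangentBundle 𝓘(ℝ, E) M)) (mem_tchart_source.2 hx) ![ξ, η]
  have h1 : (fun i => dtchart x₀ p ((![ξ, η] : Fin 2 → E × E) i)) =
      ![dtchart x₀ p ξ, dtchart x₀ p η] := by
    ext1 i; fin_cases i <;> rfl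
  rw [h1] at h
  refine h.symm.trans ?_
  exact compContinuousLinearMap_pair (V := E × E) (W := E') (Ω (π p)) (dπ (E' := E') π p) ξ η

/-- The pullback of a symplectic form as in the theorem has the properties which make it the negative
of the Hilbert 2-form of a Finsler function. -/
lemma isFinslerTwoForm_pullBilin (hΓ : IsSpray univ Γ) (hπ : IsPathSpace E' Γ π)
    (hΩ : IsSymplectic Ω) (hL : ∀ x, IsLagrangianHat π Ω x) (hpos : IsPositiveOnJacobi Γ π Ω)
    {x₀ : M} {B : Set E} (hB : B ⊆ (bchart E x₀).target) :
    IsFinslerTwoForm B (pullBilin π Ω x₀) := by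
  -- all points and vectors in question come from the tangent bundle
  have hpt : ∀ z ∈ B ×ˢ ({0}ᶜ : Set E), ∃ p : TangentBundle 𝓘(ℝ, E) M,
      p.proj ∈ (bchart E x₀).source ∧ p ∈ slit E univ ∧ tchart E x₀ p = z := fun z hz => by
    have hz' : z ∈ slitChart E x₀ (univ : Set M) := ⟨hB hz.1, mem_univ _, hz.2⟩
    exact ⟨_, proj_symm_mem_source hz', symm_mem_slit_of_mem_slitChart hz', tchart_symm_right hz'⟩
  have hvl {p : TangentBundle 𝓘(ℝ, E) M} (hx : p.proj ∈ (bchart E x₀).source) (w : E) :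
      ∃ v : TangentSpace 𝓘(ℝ, E) p.proj, dtchart x₀ p (vlift p v) = (0, w) := by
    refine ⟨dbchartSymm E x₀ (bchart E x₀ p.proj) w, (dtchart_vlift hx _).trans ?_⟩
    exact Prod.ext rfl (dchart_dchartSymm' (I := 𝓘(ℝ, E)) hx w)
  have hvert : ∀ z ∈ B ×ˢ ({0}ᶜ : Set E), ∀ u w, pullBilin π Ω x₀ z (0, u) (0, w) = 0 := by
    intro z hz u w
    obtain ⟨p, hx, hp, rfl⟩ := hpt z hz
    obtain ⟨v, hv⟩ := hvl hx u
    obtain ⟨v', hv'⟩ := hvl hx w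
    rw [← hv, ← hv']
    exact (pullBilin_dtchart hx _ _).trans ((hL p.proj).apply_vlift hp v v')
  have halt : ∀ z a b, pullBilin π Ω x₀ z a b = -pullBilin π Ω x₀ z b a := fun z a b =>
    pair_swap (V := E × E) (formInChart (pullForm 𝓘(ℝ, E).tangent 𝓘(ℝ, E') π Ω)
      (⟨x₀, 0⟩ : TangentBundle 𝓘(ℝ, E) M) z) a b
  -- vectors of the distribution are in the kernel, being annihilated by `π_*`
  have hzero {p : TangentBundle 𝓘(ℝ, E) M} (hx : p.proj ∈ (bchart E x₀).source)
      (hp : p ∈ slit E univ) {ξ : TangentSpace 𝓘(ℝ, E).tangent p} (hξ : ξ ∈ distD Γ p) (b : E × E) :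
      pullBilin π Ω x₀ (tchart E x₀ p) (dtchart x₀ p ξ) b = 0 := by
    obtain ⟨η, rfl⟩ := exists_dtchart_eq hx b
    refine (pullBilin_dtchart hx _ _).trans ?_
    rw [(hπ.dπ_eq_zero_iff hp ξ).2 hξ]
    have h := pair_smul_left (V := E') (Ω (π p)) 0 (0 : E') (dπ (E' := E') π p η)
    rw [zero_smul, zero_mul] at h
    exact h
  refine ⟨fun z hz => ?_, halt, fun z hz a b c => ?_, hvert, fun z hz u => ?_, fun z hz w => ?_,
    fun z hz v hv => ?_⟩
  · obtain ⟨p, hx, hp, rfl⟩ := hpt z hz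
    exact contDiffAt_toBilin (contDiffAt_formInChart_pullForm (mem_tchart_source.2 hx)
      (hπ.contMDiffAt hp) (isSmoothForm_iff.1 hΩ.smooth _))
  · obtain ⟨p, hx, hp, rfl⟩ := hpt z hz
    have h1 := contDiffAt_formInChart_pullForm (q := (⟨x₀, 0⟩ : TangentBundle 𝓘(ℝ, E) M))
      (mem_tchart_source.2 hx) (hπ.contMDiffAt hp) (isSmoothForm_iff.1 hΩ.smooth _)
    have h2 := extDeriv_two_form_apply (h1.differentiableAt (by simp)) a b c
    rw [extDeriv_formInChart_pullForm (mem_tchart_source.2 hx) (hπ.contMDiffAt hp)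
      (isSmoothForm_iff.1 hΩ.smooth _) (hΩ.closed _)] at h2
    exact h2.symm
  · obtain ⟨p, hx, hp, rfl⟩ := hpt z hz
    rw [halt, ← dtchart_liouville hx]
    exact neg_eq_zero.2 (hzero hx hp (Submodule.subset_span (Or.inl rfl)) _)
  · obtain ⟨p, hx, hp, rfl⟩ := hpt z hz
    have h1 := hzero hx hp (ξ := Γ p) (Submodule.subset_span (Or.inr rfl)) (0, w)
    rw [show dtchart x₀ p (Γ p) = ((tchart E x₀ p).2, 0) + (0, (dtchart x₀ p (Γ p)).2) by
      rw [Prod.mk_add_mk, add_zero, zero_add, ← hΓ.fst_dtchart hp hx], map_add, add_apply,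
      hvert _ hz, add_zero] at h1
    exact h1
  · obtain ⟨p, hx, hp, rfl⟩ := hpt z hz
    obtain ⟨ξ, hξ⟩ := exists_dtchart_eq hx (v, 0)
    have hv1 : dbchart E x₀ p.proj (dτ p ξ) = v :=
      (PathSpace.fst_dtchart hx ξ).symm.trans (congrArg Prod.fst hξ)
    have h1 := hpos.apply_vlift_pos hΓ hπ hL hp ξ (fun c hc => hv c (by
      rw [← hv1, hc, tchart_apply hx]; exact map_smul (dbchart E x₀ p.proj) c p.2))
    refine lt_of_lt_of_eq h1 ((pullBilin_dtchart hx _ _).symm.trans ?_)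
    rw [hξ]
    refine congrArg _ ((dtchart_vlift hx _).trans (Prod.ext rfl hv1))

end PathSpaceForm

section LocalFinsler

universe u

variable {E : Type u} [NormedAddCommGroup E] [NormedSpace ℝ E] [FiniteDimensional ℝ E]
  {M : Type*} [TopologicalSpace M] [ChartedSpace E M] [IsManifold 𝓘(ℝ, E) ∞ M]
  {Γ : FieldOnTM E M}
  {E' : Type*} [NormedAddCommGroup E'] [NormedSpace ℝ E'] [FiniteDimensional ℝ E']
  {P : Type*} [TopologicalSpace P] [ChartedSpace E' P] [IsManifold 𝓘(ℝ, E') ∞ P]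
  {π : TangentBundle 𝓘(ℝ, E) M → P} {Ω : FormField 𝓘(ℝ, E') P 2}

/-- If the pullback of `Ω` is the negative of the Hilbert 2-form of `F`, the geodesic class of `F` is
the given projective class: both consist of the sprays annihilated by `π_*`. -/
lemma isGeodesicClass_of_hilbertForm_eq (hΓ : IsSpray univ Γ) (hπ : IsPathSpace E' Γ π)
    (hΩ : IsSymplectic Ω) {U : Set M} (hU : IsOpen U) {F : TangentBundle 𝓘(ℝ, E) M → ℝ}
    (hF : IsFinsler U F) (h : ∀ p ∈ slit E U, ∀ a b : TangentSpace 𝓘(ℝ, E).tangent p,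
      (extD (hilbertForm F) p : (E × E) [⋀^Fin 2]→L[ℝ] ℝ) ![a, b] =
        -Ω (π p) ![dπ (E' := E') π p a, dπ π p b]) : IsGeodesicClass U F Γ := by
  intro Γ' hΓ'
  rw [projectivelyEquivalent_iff hU (hΓ.mono (subset_univ U)) hΓ', isGeodesicSpray_iff hU hΓ' hF]
  refine forall₂_congr fun p hp => ?_
  have hp' : p ∈ slit E (univ : Set M) := ⟨mem_univ _, hp.2⟩
  rw [← hπ.dπ_eq_zero_iff hp']
  constructor
  · intro h1 b
    refine (h p hp (Γ' p) b).trans ?_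
    rw [h1, neg_eq_zero]
    have h2 := pair_smul_left (V := E') (Ω (π p)) 0 (0 : E') (dπ (E' := E') π p b)
    rw [zero_smul, zero_mul] at h2
    exact h2
  · intro h1
    refine hΩ.nondegenerate _ _ fun η => ?_
    obtain ⟨b, rfl⟩ := hπ.submersion p hp' η
    exact neg_eq_zero.1 ((h p hp (Γ' p) b).symm.trans (h1 b))

/-- Near each point the pullback of `Ω` is the negative of the Hilbert 2-form of a Finsler function. -/
lemma exists_isFinsler_of_isSymplectic (hdim : 3 ≤ Module.finrank ℝ E) (hΓ : IsSpray univ Γ)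
    (hπ : IsPathSpace E' Γ π) (hΩ : IsSymplectic Ω) (hL : ∀ x, IsLagrangianHat π Ω x)
    (hpos : IsPositiveOnJacobi Γ π Ω) (x₀ : M) :
    ∃ (U : Set M) (F : TangentBundle 𝓘(ℝ, E) M → ℝ), IsOpen U ∧ x₀ ∈ U ∧ IsFinsler U F ∧
      ∀ p ∈ slit E U, ∀ a b : TangentSpace 𝓘(ℝ, E).tangent p,
        (extD (hilbertForm F) p : (E × E) [⋀^Fin 2]→L[ℝ] ℝ) ![a, b] =
          -Ω (π p) ![dπ (E' := E') π p a, dπ π p b] := by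
  obtain ⟨r, hr, hB⟩ := Metric.isOpen_iff.1 (isOpen_extChartAt_target (I := 𝓘(ℝ, E)) x₀) _
    (mem_extChartAt_target (I := 𝓘(ℝ, E)) x₀)
  have hβ := isFinslerTwoForm_pullBilin hΓ hπ hΩ hL hpos hB
  obtain ⟨δ, hδ, hδr, L, hLδ⟩ := hβ.exists_lagrangian hdim hr
  set β := pullBilin π Ω x₀
  set U : Set M := (bchart E x₀).source ∩ bchart E x₀ ⁻¹' Metric.ball (bchart E x₀ x₀) δ
  have hU : IsOpen U := isOpen_extChartAt_preimage' x₀ Metric.isOpen_ball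
  set F : TangentBundle 𝓘(ℝ, E) M → ℝ := fun p => L (tchart E x₀ p)
  have hmem {z : E × E} (hz : z ∈ slitChart E x₀ U) :
      z ∈ Metric.ball (bchart E x₀ x₀) δ ×ˢ ({0}ᶜ : Set E) := by
    refine ⟨?_, hz.2.2⟩
    have h1 := hz.2.1.2
    rwa [mem_preimage, (bchart E x₀).right_inv hz.1] at h1
  have hmem' {z : E × E} (hz : z ∈ slitChart E x₀ U) :
      z ∈ Metric.ball (bchart E x₀ x₀) r ×ˢ ({0}ᶜ : Set E) :=
    ⟨Metric.ball_subset_ball hδr (hmem hz).1, hz.2.2⟩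
  have htfun {z : E × E} (hz : z ∈ slitChart E x₀ U) : tfun F x₀ =ᶠ[𝓝 z] L := by
    filter_upwards [(isOpen_slitChart hU).mem_nhds hz] with w hw
    exact congrArg L (tchart_symm_right hw)
  have hchart {p : TangentBundle 𝓘(ℝ, E) M} (hp : p ∈ slit E U) :
      tchart E x₀ p ∈ slitChart E x₀ U := tchart_mem_slitChart hp.1.1 hp
  have hsmooth : ContMDiffOn 𝓘(ℝ, E).tangent 𝓘(ℝ, ℝ) ∞ F (slit E U) := fun p hp =>
    (contMDiffAt_of_tfun hp.1.1 (((hLδ _ (hmem (hchart hp))).1).congr_of_eventuallyEq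
      (htfun (hchart hp)))).contMDiffWithinAt
  have hhom : ∀ p ∈ slit E U, ∀ c : ℝ, 0 < c → F ⟨p.proj, c • p.2⟩ = c * F p := by
    intro p hp c hc
    have h1 := (hLδ _ (hmem (hchart hp))).2.2.1 c hc
    refine Eq.trans (congrArg L ?_) h1
    rw [tchart_apply (p := ⟨p.proj, c • p.2⟩) hp.1.1, tchart_apply hp.1.1]
    exact Prod.ext rfl (map_smul (dbchart E x₀ p.proj) c p.2)
  -- the Hilbert 2-form of `F` in coordinates
  have hd {z : E × E} (hz : z ∈ slitChart E x₀ U) (a b : E × E) :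
      fderiv ℝ (fibreDeriv (tfun F x₀)) z a b.1 - fderiv ℝ (fibreDeriv (tfun F x₀)) z b a.1 =
        -β z a b := by
    rw [(fibreDeriv_congr (htfun hz)).fderiv_eq]
    exact (hLδ z (hmem hz)).2.2.2 a b
  have hvert {z : E × E} (hz : z ∈ slitChart E x₀ U) (w : E) :
      fderiv ℝ (fibreDeriv (tfun F x₀)) z (0, w) w = β z (w, 0) (0, w) := by
    have h1 := hd hz (0, w) (w, 0)
    rw [hβ.alt, neg_neg] at h1
    simpa using h1
  have hF : IsFinsler U F := by
    refine ⟨hsmooth, fun p hp => (hLδ _ (hmem (hchart hp))).2.1, hhom, fun p hp v hv => ?_⟩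
    have hz := hchart hp
    have hLp : tfun F x₀ (tchart E x₀ p) = L (tchart E x₀ p) := (htfun hz).self_of_nhds
    have hLpos := (hLδ _ (hmem hz)).2.1
    rw [fibre_hessian_sq hU hsmooth hp hp.1.1, hLp, hvert hz]
    set w := dbchart E x₀ p.proj v
    have hw : w ≠ 0 := dbchart_ne_zero hp.1.1 hv
    by_cases hc : ∃ c : ℝ, w = c • (tchart E x₀ p).2
    · -- in the direction of `y` the Hessian of `F ^ 2` is positive since `F` is
      obtain ⟨c, hc⟩ := hc
      have hc0 : c ≠ 0 := by rintro rfl; exact hw (by rw [hc, zero_smul])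
      have h1 : β (tchart E x₀ p) (w, 0) (0, w) = 0 := by
        have h2 := hβ.liouville _ (hmem' hz) w
        have h3 : ((0 : E), w) = c • ((0 : E), (tchart E x₀ p).2) := by
          rw [Prod.smul_mk, smul_zero, ← hc]
        rw [h3, map_smul, h2, smul_zero]
      have h2 : fibreDeriv (tfun F x₀) (tchart E x₀ p) w = c * L (tchart E x₀ p) := by
        rw [hc, map_smul, (eventually_fibreDeriv_self hU hsmooth hhom hz).self_of_nhds, hLp,
          smul_eq_mul]
      rw [h1, h2]
      positivity
    · have h1 := hβ.pos _ (hmem' hz) w (not_exists.1 hc)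
      positivity
  refine ⟨U, F, hU, ⟨mem_extChartAt_source x₀, Metric.mem_ball_self hδ⟩, hF, fun p hp a b => ?_⟩
  refine (extD_hilbertForm_apply hU hsmooth hp hp.1.1 a b).trans ?_
  rw [hd (hchart hp)]
  exact congrArg Neg.neg (pullBilin_dtchart hp.1.1 a b)

/-- The local Finsler functions obtained near the various points have the same Hilbert 2-form on
overlaps, the negative of the pullback of `Ω`. -/
lemma isGeodesicClassOfLocalFinsler_of_isSymplectic (hdim : 3 ≤ Module.finrank ℝ E)
    (hΓ : IsSpray univ Γ) (hπ : IsPathSpace E' Γ π) (hΩ : IsSymplectic Ω)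
    (hL : ∀ x, IsLagrangianHat π Ω x) (hpos : IsPositiveOnJacobi Γ π Ω) :
    IsGeodesicClassOfLocalFinsler Γ := by
  choose U F hU hx hF h using exists_isFinsler_of_isSymplectic hdim hΓ hπ hΩ hL hpos
  refine ⟨U, F, fun x => ⟨hU x, hx x, hF x,
    isGeodesicClass_of_hilbertForm_eq hΓ hπ hΩ (hU x) (hF x) (h x)⟩, fun x x' p hp => ?_⟩
  exact form_ext_pair (V := E × E) fun a b =>
    (h x p ⟨hp.1.1, hp.2⟩ a b).trans (h x' p ⟨hp.1.2, hp.2⟩ a b).symm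

end LocalFinsler

/-! ### Descent of a closed 2-form to the base of a submersion with connected fibres -/

section GlobalDescent

variable {V : Type*} [NormedAddCommGroup V] [NormedSpace ℝ V] [FiniteDimensional ℝ V]
  {H : Type*} [TopologicalSpace H] {I : ModelWithCorners ℝ V H} [I.Boundaryless]
  {N : Type*} [TopologicalSpace N] [ChartedSpace H N] [IsManifold I ∞ N]
  {V' : Type*} [NormedAddCommGroup V'] [NormedSpace ℝ V'] [FiniteDimensional ℝ V']
  {H' : Type*} [TopologicalSpace H'] {I' : ModelWithCorners ℝ V' H'} [I'.Boundaryless]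
  {N' : Type*} [TopologicalSpace N'] [ChartedSpace H' N'] [IsManifold I' ∞ N']
  {f : N → N'} {S : Set N} {α : FormField I N 2}

lemma form_pair_eq_formInChart (α : FormField I N 2) {q p : N} (hp : p ∈ (extChartAt I q).source)
    (a b : V) : (α p : V [⋀^Fin 2]→L[ℝ] ℝ) ![a, b] =
      formInChart α q (extChartAt I q p) ![dchart I q p a, dchart I q p b] := by
  have h1 : (fun i => dchart I q p ((![a, b] : Fin 2 → V) i)) = ![dchart I q p a, dchart I q p b] := by
    ext1 i; fin_cases i <;> rfl
  rw [← h1]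
  exact form_eq_formInChart α hp ![a, b]

/-- A 2-form annihilated by the kernel of a surjective linear map descends to its target. -/
lemma exists_form_on_quotient {W W' : Type*} [NormedAddCommGroup W] [NormedSpace ℝ W]
    [FiniteDimensional ℝ W] [NormedAddCommGroup W'] [NormedSpace ℝ W'] [FiniteDimensional ℝ W']
    {A : W →L[ℝ] W'} (hA : Function.Surjective A) {β : W [⋀^Fin 2]→L[ℝ] ℝ}
    (hβ : ∀ a, A a = 0 → ∀ b, β ![a, b] = 0) :
    ∃ κ : W' [⋀^Fin 2]→L[ℝ] ℝ, ∀ a b, κ ![A a, A b] = β ![a, b] := by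
  obtain ⟨s, hs⟩ := (A : W →ₗ[ℝ] W').exists_rightInverse_of_surjective (LinearMap.range_eq_top.2 hA)
  have hs' (w : W') : A (s w) = w := DFunLike.congr_fun hs w
  have hl (a b : W) : β ![s (A a), b] = β ![a, b] := by
    have h := hβ (s (A a) - a) (by rw [map_sub, hs', sub_self]) b
    rw [sub_eq_add_neg, ← neg_one_smul ℝ, pair_add_left, pair_smul_left] at h
    linarith
  refine ⟨β.compContinuousLinearMap (LinearMap.toContinuousLinearMap s), fun a b => ?_⟩
  refine (compContinuousLinearMap_pair _ _ _ _).trans ?_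
  show β ![s (A a), s (A b)] = _
  rw [hl, pair_swap, hl, ← pair_swap]

variable (I I') in
/-- Near each point the forms `κ p` to which `α` descends are the values of a smooth closed form `κ'` in
the chart of the base. -/
lemma exists_descended_form_in_chart (hS : IsOpen S) (hf : ∀ p ∈ S, ContMDiffAt I I' ∞ f p)
    (hsub : ∀ p ∈ S, Function.Surjective (mfderiv I I' f p)) (hα : ∀ p ∈ S, SmoothFormAt I α p)
    (hd : ∀ p ∈ S, extD α p = 0) {κ : N → V' [⋀^Fin 2]→L[ℝ] ℝ}
    (hκ : ∀ p ∈ S, ∀ a b : TangentSpace I p,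
      κ p ![mfderiv I I' f p a, mfderiv I I' f p b] = α p ![a, b]) {p₀ : N} (hp₀ : p₀ ∈ S) :
    ∃ κ' : V' → V' [⋀^Fin 2]→L[ℝ] ℝ, ContDiffAt ℝ ∞ κ' (extChartAt I' (f p₀) (f p₀)) ∧
      extDeriv κ' (extChartAt I' (f p₀) (f p₀)) = 0 ∧ ∀ᶠ p in 𝓝 p₀, p ∈ S ∧
        f p ∈ (extChartAt I' (f p₀)).source ∧ κ p = (κ' (extChartAt I' (f p₀)
          (f p))).compContinuousLinearMap (dchart I' (f p₀) (f p)) := by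
  set g := mapInCharts I I' f p₀ (f p₀)
  have hg0 : g (extChartAt I p₀ p₀) = extChartAt I' (f p₀) (f p₀) :=
    mapInCharts_extChartAt (mem_extChartAt_source p₀)
  have hev : ∀ᶠ p in 𝓝 p₀, p ∈ S ∧ p ∈ (extChartAt I p₀).source ∧
      f p ∈ (extChartAt I' (f p₀)).source :=
    Filter.Eventually.and (hS.mem_nhds hp₀) (Filter.Eventually.and
      ((isOpen_extChartAt_source p₀).mem_nhds (mem_extChartAt_source p₀)) ((hf p₀ hp₀).continuousAt.eventually
        ((isOpen_extChartAt_source _).mem_nhds (mem_extChartAt_source _))))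
  have hc : Filter.Tendsto (extChartAt I p₀).symm (𝓝 (extChartAt I p₀ p₀)) (𝓝 p₀) := by
    have := continuousAt_extChartAt_symm (I := I) p₀
    rwa [ContinuousAt, (extChartAt I p₀).left_inv (mem_extChartAt_source p₀)] at this
  have hgd {p : N} (hp : p ∈ S) (hps : p ∈ (extChartAt I p₀).source)
      (hfp : f p ∈ (extChartAt I' (f p₀)).source) (a : TangentSpace I p) :
      fderiv ℝ g (extChartAt I p₀ p) (dchart I p₀ p a) = dchart I' (f p₀) (f p) (mfderiv I I' f p a) :=
    fderiv_mapInCharts_dchart hps hfp ((hf p hp).mdifferentiableAt (by simp)) a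
  obtain ⟨κ', hκ'1, hκ'2, hκ'3⟩ := exists_local_descent (f := g) (α := formInChart α p₀)
    (contDiffAt_mapInCharts (mem_extChartAt_source p₀) (mem_extChartAt_source _) (hf p₀ hp₀))
    (by
      intro w
      obtain ⟨a, ha⟩ := hsub p₀ hp₀ (dchartSymm I' (f p₀) (extChartAt I' (f p₀) (f p₀)) w)
      refine ⟨dchart I p₀ p₀ a,
        (hgd hp₀ (mem_extChartAt_source p₀) (mem_extChartAt_source _) a).trans ?_⟩
      rw [ha]
      exact dchart_dchartSymm' (mem_extChartAt_source _) w)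
    (by
      filter_upwards [hc.eventually hev, (isOpen_extChartAt_target p₀).mem_nhds
        (mem_extChartAt_target p₀)] with z hz hzt
      obtain ⟨p, hps, rfl⟩ : ∃ p ∈ (extChartAt I p₀).source, extChartAt I p₀ p = z :=
        ⟨_, (extChartAt I p₀).map_target hzt, (extChartAt I p₀).right_inv hzt⟩
      rw [(extChartAt I p₀).left_inv hps] at hz
      obtain ⟨hp, -, hfp⟩ := hz
      refine ⟨contDiffAt_mapInCharts hps hfp (hf p hp), (hα p hp).contDiffAt_formInChart hps,
        extDeriv_formInChart_eq_zero hps (hα p hp) (hd p hp), fun a ha b => ?_⟩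
      obtain ⟨ξ, rfl⟩ : ∃ ξ : V, dchart I p₀ p ξ = a := ⟨_, dchart_dchartSymm' hps a⟩
      obtain ⟨η, rfl⟩ : ∃ η : V, dchart I p₀ p η = b := ⟨_, dchart_dchartSymm' hps b⟩
      refine (form_pair_eq_formInChart α hps ξ η).symm.trans ?_
      have h1 : dchart I' (f p₀) (f p) (mfderiv I I' f p ξ) = 0 := (hgd hp hps hfp ξ).symm.trans ha
      have h2 : mfderiv I I' f p ξ = 0 := dchart_injective hfp (h1.trans (map_zero _).symm)
      refine (hκ p hp ξ η).symm.trans ?_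
      rw [h2]
      have h3 := pair_smul_left (κ p) 0 (0 : V') (mfderiv I I' f p η)
      rw [zero_smul, zero_mul] at h3
      exact h3)
  rw [hg0] at hκ'1 hκ'2
  refine ⟨κ', hκ'1, hκ'2, ?_⟩
  filter_upwards [hev, (continuousAt_extChartAt (I := I) p₀).eventually hκ'3] with p ⟨hp, hps, hfp⟩ hp3
  refine ⟨hp, hfp, form_ext_pair fun w w' => ?_⟩
  obtain ⟨a, rfl⟩ := hsub p hp w
  obtain ⟨b, rfl⟩ := hsub p hp w'
  refine (hκ p hp a b).trans ((form_pair_eq_formInChart α hps a b).trans ?_)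
  rw [hp3]
  refine (compContinuousLinearMap_pair _ _ _ _).trans
    (Eq.trans ?_ (compContinuousLinearMap_pair _ _ _ _).symm)
  have h1 : g (extChartAt I p₀ p) = extChartAt I' (f p₀) (f p) := mapInCharts_extChartAt hps
  rw [h1, hgd hp hps hfp, hgd hp hps hfp]

/-- A closed 2-form annihilated by the kernel of the differential of a surjective submersion `f` with
connected fibres is the pullback of a closed form on the base. At each point `p` it descends to a form
`κ p` at `f p`, which along a fibre is locally constant and hence constant. -/
lemma exists_descended_form (hS : IsOpen S) (hf : ∀ p ∈ S, ContMDiffAt I I' ∞ f p)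
    (hsub : ∀ p ∈ S, Function.Surjective (mfderiv I I' f p)) (hsurj : SurjOn f S univ)
    (hfib : ∀ p ∈ S, ∀ q ∈ S, f p = f q →
      ∃ c : ℝ → N, Continuous c ∧ (∀ t, c t ∈ S ∧ f (c t) = f p) ∧ c 0 = p ∧ c 1 = q)
    (hα : ∀ p ∈ S, SmoothFormAt I α p) (hd : ∀ p ∈ S, extD α p = 0)
    (hker : ∀ p ∈ S, ∀ a : TangentSpace I p, mfderiv I I' f p a = 0 → ∀ b : TangentSpace I p,
      α p ![a, b] = 0) :
    ∃ Ω : FormField I' N' 2, IsSmoothForm Ω ∧ (∀ q, extD Ω q = 0) ∧ ∀ p ∈ S,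
      ∀ a b : TangentSpace I p, Ω (f p) ![mfderiv I I' f p a, mfderiv I I' f p b] = α p ![a, b] := by
  have hκ : ∀ p : N, ∃ κ : V' [⋀^Fin 2]→L[ℝ] ℝ, p ∈ S → ∀ a b : TangentSpace I p,
      κ ![mfderiv I I' f p a, mfderiv I I' f p b] = α p ![a, b] := fun p => by
    by_cases hp : p ∈ S
    · obtain ⟨κ, h⟩ := exists_form_on_quotient (W := V) (W' := V') (A := mfderiv I I' f p) (β := α p)
        (hsub p hp) (hker p hp)
      exact ⟨κ, fun _ => h⟩
    · exact ⟨0, fun h => absurd h hp⟩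
  choose κ hκ using hκ
  have hconst : ∀ p ∈ S, ∀ q ∈ S, f p = f q → κ p = κ q := by
    intro p hp q hq hpq
    obtain ⟨c, hc, hcS, rfl, rfl⟩ := hfib p hp q hq hpq
    have h1 : IsLocallyConstant fun t => κ (c t) := by
      rw [IsLocallyConstant.iff_eventually_eq]
      intro t
      obtain ⟨κ', -, -, h⟩ := exists_descended_form_in_chart I I' hS hf hsub hα hd hκ (hcS t).1
      filter_upwards [hc.continuousAt.eventually h] with s hs
      rw [hs.2.2, h.self_of_nhds.2.2, (hcS s).2, (hcS t).2]
    exact h1.apply_eq_of_preconnectedSpace 0 1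
  choose s hsS hs using fun q => hsurj (mem_univ q)
  let Ω : FormField I' N' 2 := fun q => (κ (s q) : V' [⋀^Fin 2]→L[ℝ] ℝ)
  have hΩ : ∀ p ∈ S, Ω (f p) = (κ p : V' [⋀^Fin 2]→L[ℝ] ℝ) := fun p hp =>
    hconst _ (hsS _) p hp (hs _)
  have hloc : ∀ p ∈ S, SmoothFormAt I' Ω (f p) ∧ extD Ω (f p) = 0 := by
    intro p hp
    obtain ⟨κ', hκ1, hκ2, h⟩ := exists_descended_form_in_chart I I' hS hf hsub hα hd hκ hp
    set g := mapInCharts I I' f p (f p)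
    have hg0 : g (extChartAt I p p) = extChartAt I' (f p) (f p) :=
      mapInCharts_extChartAt (mem_extChartAt_source p)
    have hg : HasStrictFDerivAt g (fderiv ℝ g (extChartAt I p p)) (extChartAt I p p) :=
      (contDiffAt_mapInCharts (mem_extChartAt_source p) (mem_extChartAt_source _)
        (hf p hp)).hasStrictFDerivAt (by simp)
    have hrange : (fderiv ℝ g (extChartAt I p p)).range = ⊤ := by
      refine LinearMap.range_eq_top.2 fun w => ?_
      obtain ⟨a, ha⟩ := hsub p hp (dchartSymm I' (f p) (extChartAt I' (f p) (f p)) w)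
      refine ⟨dchart I p p a, (fderiv_mapInCharts_dchart (mem_extChartAt_source p)
        (mem_extChartAt_source _) ((hf p hp).mdifferentiableAt (by simp)) a).trans ?_⟩
      rw [ha]
      exact dchart_dchartSymm' (mem_extChartAt_source _) w
    have hmap := hg.map_nhds_eq_of_surj hrange
    rw [hg0] at hmap
    have hc : Filter.Tendsto (extChartAt I p).symm (𝓝 (extChartAt I p p)) (𝓝 p) := by
      have := continuousAt_extChartAt_symm (I := I) p
      rwa [ContinuousAt, (extChartAt I p).left_inv (mem_extChartAt_source p)] at this
    -- as `f` is open, the equality of `κ` and `κ'` along `f` gives one on a neighbourhood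
    have hev : formInChart Ω (f p) =ᶠ[𝓝 (extChartAt I' (f p) (f p))] κ' := by
      rw [Filter.EventuallyEq, ← hmap, Filter.eventually_map]
      filter_upwards [hc.eventually h] with z hz
      set q := (extChartAt I p).symm z
      have h1 : g z = extChartAt I' (f p) (f q) := rfl
      refine form_ext_pair fun a b => ?_
      obtain ⟨ξ, rfl⟩ : ∃ ξ : V', dchart I' (f p) (f q) ξ = a := ⟨_, dchart_dchartSymm' hz.2.1 a⟩
      obtain ⟨η, rfl⟩ : ∃ η : V', dchart I' (f p) (f q) η = b := ⟨_, dchart_dchartSymm' hz.2.1 b⟩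
      rw [h1]
      refine (form_pair_eq_formInChart Ω hz.2.1 ξ η).symm.trans ?_
      rw [hΩ q hz.1, hz.2.2]
      exact compContinuousLinearMap_pair _ _ _ _
    have hsm : ContDiffAt ℝ ∞ (formInChart Ω (f p)) (extChartAt I' (f p) (f p)) :=
      hκ1.congr_of_eventuallyEq hev
    refine ⟨hsm, ?_⟩
    refine (extD_eq_extDeriv (mem_extChartAt_source _) hsm).trans ?_
    rw [hev.extDeriv_eq, hκ2]
    rfl
  refine ⟨Ω, isSmoothForm_iff.2 fun q => ?_, fun q => ?_, fun p hp a b => ?_⟩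
  · rw [← hs q]; exact (hloc _ (hsS q)).1
  · rw [← hs q]; exact (hloc _ (hsS q)).2
  · rw [hΩ p hp]; exact hκ p hp a b

end GlobalDescent

/-! ### From local Finsler functions to a symplectic form on path space -/

section HilbertTwoForm

variable {E : Type*} [NormedAddCommGroup E] [NormedSpace ℝ E] [FiniteDimensional ℝ E]
  {M : Type*} [TopologicalSpace M] [ChartedSpace E M] [IsManifold 𝓘(ℝ, E) ∞ M]
  {Γ : FieldOnTM E M} {U : Set M} {F : TangentBundle 𝓘(ℝ, E) M → ℝ}
  {p : TangentBundle 𝓘(ℝ, E) M}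

lemma contDiffAt_extDeriv {V : Type*} [NormedAddCommGroup V] [NormedSpace ℝ V] {k : ℕ}
    {α : V → V [⋀^Fin k]→L[ℝ] ℝ} {z : V} (h : ContDiffAt ℝ ∞ α z) :
    ContDiffAt ℝ ∞ (extDeriv α) z := by
  have h1 : ContDiffAt ℝ ∞ (fderiv ℝ α) z := h.fderiv_right (by simp)
  exact (ContinuousAlternatingMap.alternatizeUncurryFinCLM ℝ V ℝ).contDiff.contDiffAt.comp z h1

lemma formInChart_neg {V : Type*} [NormedAddCommGroup V] [NormedSpace ℝ V] {H : Type*}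
    [TopologicalSpace H] {I : ModelWithCorners ℝ V H} {N : Type*} [TopologicalSpace N]
    [ChartedSpace H N] {k : ℕ} (α : FormField I N k) (q : N) (z : V) :
    formInChart (fun p => -α p) q z = -formInChart α q z := by
  ext m; rfl

lemma exists_dτ_eq (v : TangentSpace 𝓘(ℝ, E) p.proj) :
    ∃ ξ : TangentSpace 𝓘(ℝ, E).tangent p, dτ p ξ = v := by
  have hx : p.proj ∈ (bchart E p.proj).source := mem_extChartAt_source _
  obtain ⟨ξ, hξ⟩ := exists_dtchart_eq hx (dbchart E p.proj p.proj v, 0)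
  refine ⟨ξ, dchart_injective hx ((fst_dtchart hx ξ).symm.trans ?_)⟩
  rw [hξ]

/-- The negative of the Hilbert 2-form, in coordinates, is the exterior derivative of a smooth form. -/
lemma formInChart_neg_extD_hilbertForm_eventuallyEq (hU : IsOpen U) (hF : IsFinsler U F)
    (hp : p ∈ slit E U) :
    formInChart (fun q => -extD (hilbertForm F) q) (⟨p.proj, 0⟩ : TangentBundle 𝓘(ℝ, E) M)
      =ᶠ[𝓝 (tchart E p.proj p)]
      fun z => (-1 : ℝ) • extDeriv (semibasic (fibreDeriv (tfun F p.proj))) z := by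
  have hx : p.proj ∈ (bchart E p.proj).source := mem_extChartAt_source _
  filter_upwards [(isOpen_slitChart hU).mem_nhds (tchart_mem_slitChart hx hp)] with z hz
  rw [formInChart_neg, formInChart_extD (mem_tchart_target.2 hz.1)
    (contDiffAt_formInChart_hilbertForm hU hF.smooth hz),
    (formInChart_hilbertForm_eventuallyEq hU hF.smooth hz).extDeriv_eq, neg_one_smul]

lemma contDiffAt_semibasic_fibreDeriv (hU : IsOpen U) (hF : IsFinsler U F) (hp : p ∈ slit E U) :
    ContDiffAt ℝ ∞ (semibasic (fibreDeriv (tfun F p.proj))) (tchart E p.proj p) :=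
  contDiffAt_semibasic (contDiffAt_fibreDeriv (contDiffAt_tfun hU hF.smooth
    (tchart_mem_slitChart (mem_extChartAt_source _) hp)))

lemma smoothFormAt_neg_extD_hilbertForm (hU : IsOpen U) (hF : IsFinsler U F) (hp : p ∈ slit E U) :
    SmoothFormAt 𝓘(ℝ, E).tangent (fun q => -extD (hilbertForm F) q) p := by
  refine smoothFormAt_of_contDiffAt (q := (⟨p.proj, 0⟩ : TangentBundle 𝓘(ℝ, E) M))
    (mem_tchart_source.2 (mem_extChartAt_source _)) ?_
  exact ((contDiffAt_extDeriv (contDiffAt_semibasic_fibreDeriv hU hF hp)).const_smul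
    (-1 : ℝ)).congr_of_eventuallyEq (formInChart_neg_extD_hilbertForm_eventuallyEq hU hF hp)

lemma extD_neg_extD_hilbertForm (hU : IsOpen U) (hF : IsFinsler U F) (hp : p ∈ slit E U) :
    extD (fun q => -extD (hilbertForm F) q) p = 0 := by
  have hx : p ∈ (tchart E p.proj).source := mem_tchart_source.2 (mem_extChartAt_source _)
  have h1 := extD_eq_extDeriv hx
    ((smoothFormAt_neg_extD_hilbertForm hU hF hp).contDiffAt_formInChart hx)
  have h2 : extDeriv (formInChart (fun q => -extD (hilbertForm F) q)
      (⟨p.proj, 0⟩ : TangentBundle 𝓘(ℝ, E) M)) (tchart E p.proj p) = 0 := by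
    rw [(formInChart_neg_extD_hilbertForm_eventuallyEq hU hF hp).extDeriv_eq]
    refine (extDeriv_fun_smul (-1 : ℝ) (extDeriv (semibasic (fibreDeriv (tfun F p.proj))))).trans ?_
    rw [extDeriv_extDeriv_apply (contDiffAt_semibasic_fibreDeriv hU hF hp) minSmoothness_two_le,
      smul_zero]
  exact h1.trans (congrArg (fun β => β.compContinuousLinearMap (dtchart p.proj p)) h2)

/-- With one entry vertical the Hilbert 2-form is the fibre Hessian of `F`. -/
lemma extD_hilbertForm_vlift (hU : IsOpen U) (hF : IsFinsler U F) (hp : p ∈ slit E U)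
    (v : TangentSpace 𝓘(ℝ, E) p.proj) (ξ : TangentSpace 𝓘(ℝ, E).tangent p) :
    (extD (hilbertForm F) p : (E × E) [⋀^Fin 2]→L[ℝ] ℝ) ![vlift p v, ξ] =
      fderiv ℝ (fibreDeriv (tfun F p.proj)) (tchart E p.proj p) (0, dbchart E p.proj p.proj v)
        (dbchart E p.proj p.proj (dτ p ξ)) := by
  have hx : p.proj ∈ (bchart E p.proj).source := mem_extChartAt_source _
  refine (extD_hilbertForm_apply hU hF.smooth hp hx (vlift p v) ξ).trans ?_
  have h1 : dtchart p.proj p (vlift p v) = (0, dbchart E p.proj p.proj v) := dtchart_vlift hx v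
  have h2 : (dtchart p.proj p ξ).1 = dbchart E p.proj p.proj (dτ p ξ) := fst_dtchart hx ξ
  exact (congrArg₂ _ (congrArg₂ _ (congrArg _ h1) h2) (congrArg _ (congrArg Prod.fst h1))).trans
    (by rw [map_zero, sub_zero])

lemma extD_hilbertForm_vlift_pos (hU : IsOpen U) (hF : IsFinsler U F) (hp : p ∈ slit E U)
    {ξ : TangentSpace 𝓘(ℝ, E).tangent p} (hξ : ∀ c : ℝ, dτ p ξ ≠ c • p.2) :
    0 < (extD (hilbertForm F) p : (E × E) [⋀^Fin 2]→L[ℝ] ℝ) ![vlift p (dτ p ξ), ξ] := by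
  have hx : p.proj ∈ (bchart E p.proj).source := mem_extChartAt_source _
  refine lt_of_lt_of_eq ?_ (extD_hilbertForm_vlift hU hF hp _ _).symm
  refine hF.fibre_hessian_pos hU (tchart_mem_slitChart hx hp) fun c hc => hξ c ?_
  refine dchart_injective hx (hc.trans ?_)
  rw [tchart_apply hx]
  exact (map_smul (dbchart E p.proj p.proj) c p.2).symm

lemma extD_hilbertForm_vlift_vlift (hU : IsOpen U) (hF : IsFinsler U F) (hp : p ∈ slit E U)
    (v w : TangentSpace 𝓘(ℝ, E) p.proj) :
    (extD (hilbertForm F) p : (E × E) [⋀^Fin 2]→L[ℝ] ℝ) ![vlift p v, vlift p w] = 0 := by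
  refine (extD_hilbertForm_vlift hU hF hp _ _).trans ?_
  rw [dτ_vlift]
  have h : dbchart E p.proj p.proj (0 : E) = 0 := map_zero _
  exact (congrArg _ h).trans (map_zero _)

/-- The Hilbert 2-form is annihilated by the distribution: by the Liouville field since `F` is homogeneous
and by the spray because of the Euler-Lagrange equations. -/
lemma IsGeodesicClass.extD_hilbertForm_of_mem_distD (h : IsGeodesicClass U F Γ)
    (hΓ : IsSpray univ Γ) (hU : IsOpen U) (hF : IsFinsler U F) (hp : p ∈ slit E U)
    {ξ : TangentSpace 𝓘(ℝ, E).tangent p} (hξ : ξ ∈ distD Γ p) (η : TangentSpace 𝓘(ℝ, E).tangent p) :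
    (extD (hilbertForm F) p : (E × E) [⋀^Fin 2]→L[ℝ] ℝ) ![ξ, η] = 0 := by
  have hx : p.proj ∈ (bchart E p.proj).source := mem_extChartAt_source _
  have hΓU : IsSpray U Γ := hΓ.mono (subset_univ U)
  have hspray := (isGeodesicSpray_iff hU hΓU hF).1 ((h Γ hΓU).1
    ((projectivelyEquivalent_iff hU hΓU hΓU).2 fun q _ => Submodule.subset_span (Or.inr rfl))) p hp η
  have hz := tchart_mem_slitChart hx hp
  have hliou : (extD (hilbertForm F) p : (E × E) [⋀^Fin 2]→L[ℝ] ℝ) ![liouville E M p, η] = 0 := by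
    have hL := contDiffAt_tfun hU hF.smooth hz
    refine (extD_hilbertForm_vlift hU hF hp _ _).trans ?_
    refine (fderiv_fibreDeriv_symm hL _ _).trans ?_
    have h1 := fderiv_fibreDeriv_fibre_self hL
      (eventually_fibreDeriv_self hU hF.smooth hF.homogeneous hz) (dbchart E p.proj p.proj (dτ p η))
    rwa [show (tchart E p.proj p).2 = dbchart E p.proj p.proj p.2 by rw [tchart_apply hx]] at h1
  obtain ⟨a, b, rfl⟩ := Submodule.mem_span_pair.1 hξ
  have h1 := pair_add_left (V := E × E) (extD (hilbertForm F) p) (a • liouville E M p) (b • Γ p) η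
  have h2 := pair_smul_left (V := E × E) (extD (hilbertForm F) p) a (liouville E M p) η
  have h3 := pair_smul_left (V := E × E) (extD (hilbertForm F) p) b (Γ p) η
  refine h1.trans ((congrArg₂ _ (h2.trans (congrArg _ hliou)) (h3.trans (congrArg _ hspray))).trans ?_)
  simp

/-- Modulo the distribution the Hilbert 2-form is nondegenerate. -/
lemma IsGeodesicClass.mem_distD_of_extD_hilbertForm (h : IsGeodesicClass U F Γ)
    (hΓ : IsSpray univ Γ) (hU : IsOpen U) (hF : IsFinsler U F) (hp : p ∈ slit E U)
    {ξ : TangentSpace 𝓘(ℝ, E).tangent p} (hξ : ∀ η : TangentSpace 𝓘(ℝ, E).tangent p,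
      (extD (hilbertForm F) p : (E × E) [⋀^Fin 2]→L[ℝ] ℝ) ![ξ, η] = 0) : ξ ∈ distD Γ p := by
  have hΓm : Γ p ∈ distD Γ p := Submodule.subset_span (Or.inr rfl)
  have h1 : ∃ c : ℝ, dτ p ξ = c • p.2 := by
    by_contra hc
    have h2 := extD_hilbertForm_vlift_pos hU hF hp (not_exists.1 hc)
    exact h2.ne' ((pair_swap (V := E × E) (extD (hilbertForm F) p) _ _).trans
      (neg_eq_zero.2 (hξ _)))
  obtain ⟨c, hc⟩ := h1
  obtain ⟨u, hu⟩ := eq_vlift_of_dτ_eq_zero (p := p) (ξ := ξ - c • Γ p)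
    (by rw [map_sub, map_smul, hΓ.secondOrder p ⟨mem_univ _, hp.2⟩, hc, sub_self])
  have hξ' : ξ = vlift p u + c • Γ p := by rw [← hu, sub_add_cancel]
  have h3 : ∃ c' : ℝ, u = c' • p.2 := by
    by_contra hc'
    obtain ⟨η, rfl⟩ := exists_dτ_eq u
    have h2 := extD_hilbertForm_vlift_pos hU hF hp (not_exists.1 hc')
    have h4 := pair_add_left (V := E × E) (extD (hilbertForm F) p) (vlift p (dτ p η)) (c • Γ p) η
    have h5 := h.extD_hilbertForm_of_mem_distD hΓ hU hF hp (Submodule.smul_mem _ c hΓm) η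
    have h6 := hξ η
    rw [hξ'] at h6
    exact h2.ne' ((add_zero _).symm.trans ((congrArg _ h5.symm).trans (h4.symm.trans h6)))
  obtain ⟨c', rfl⟩ := h3
  rw [hξ']
  exact Submodule.add_mem _ (vlift_smul_mem_distD c') (Submodule.smul_mem _ c hΓm)

end HilbertTwoForm

section SymplecticForm

variable {E : Type*} [NormedAddCommGroup E] [NormedSpace ℝ E]
  {M : Type*} [TopologicalSpace M] [ChartedSpace E M] [IsManifold 𝓘(ℝ, E) ∞ M]
  {Γ : FieldOnTM E M} {p q : TangentBundle 𝓘(ℝ, E) M}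
  {E' : Type*} [NormedAddCommGroup E'] [NormedSpace ℝ E']
  {P : Type*} [TopologicalSpace P] [ChartedSpace E' P]
  {π : TangentBundle 𝓘(ℝ, E) M → P}

/-- Points of the same fibre of `π` are joined by a curve in that fibre. -/
lemma IsPathSpace.exists_curve (hπ : IsPathSpace E' Γ π) (hp : p ∈ slit E univ)
    (hq : q ∈ slit E univ) (h : π p = π q) : ∃ c : ℝ → TangentBundle 𝓘(ℝ, E) M, Continuous c ∧
      (∀ t, c t ∈ slit E univ ∧ π (c t) = π p) ∧ c 0 = p ∧ c 1 = q := by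
  obtain ⟨c, hc, hcs, hcD, rfl, rfl⟩ := (hπ.fibre_eq_leaf p hp q hq).1 h
  refine ⟨c, hc.continuous, fun t => ⟨hcs t, ?_⟩, rfl, rfl⟩
  -- the initial part of the curve, up to time `t`, parametrised by `[0, 1]`
  refine ((hπ.fibre_eq_leaf _ (hcs 0) _ (hcs t)).2 ⟨fun s => c (t * s), ?_, fun s => hcs _,
    fun s => ?_, congrArg c (mul_zero t), congrArg c (mul_one t)⟩).symm
  · exact hc.comp (contMDiff_iff_contDiff.2 (contDiff_const.mul contDiff_id))
  · have h1 : HasMFDerivAt 𝓘(ℝ, ℝ) 𝓘(ℝ, ℝ) (fun s : ℝ => t * s) s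
        ((1 : ℝ →L[ℝ] ℝ).smulRight t) := by
      have h2 : HasDerivAt (fun s : ℝ => t * s) t s := by
        simpa using (hasDerivAt_id s).const_mul t
      exact h2.hasFDerivAt.hasMFDerivAt
    have h2 := (hc.mdifferentiable (by simp) (t * s)).hasMFDerivAt
    have h3 := (HasMFDerivAt.comp (g := c) s h2 h1).mfderiv
    have h4 : mfderiv 𝓘(ℝ, ℝ) 𝓘(ℝ, E).tangent (fun s => c (t * s)) s (1 : ℝ) =
        t • mfderiv 𝓘(ℝ, ℝ) 𝓘(ℝ, E).tangent c (t * s) (1 : ℝ) := by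
      refine (DFunLike.congr_fun h3 (1 : ℝ)).trans ?_
      refine Eq.trans ?_ (map_smul (mfderiv 𝓘(ℝ, ℝ) 𝓘(ℝ, E).tangent c (t * s)) t (1 : ℝ))
      refine congrArg (mfderiv 𝓘(ℝ, ℝ) 𝓘(ℝ, E).tangent c (t * s)) ?_
      show (1 : ℝ) • t = t • (1 : ℝ)
      simp
    exact h4 ▸ Submodule.smul_mem _ t (hcD (t * s))

variable [FiniteDimensional ℝ E] [FiniteDimensional ℝ E'] [IsManifold 𝓘(ℝ, E') ∞ P]

lemma formInChart_congr_of_eventuallyEq {V : Type*} [NormedAddCommGroup V] [NormedSpace ℝ V] {H : Type*}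
    [TopologicalSpace H] {I : ModelWithCorners ℝ V H} {N : Type*} [TopologicalSpace N]
    [ChartedSpace H N] {k : ℕ} {α α' : FormField I N k} {p : N} (h : ∀ᶠ q in 𝓝 p, α q = α' q) :
    formInChart α p =ᶠ[𝓝 (extChartAt I p p)] formInChart α' p := by
  have hc : Filter.Tendsto (extChartAt I p).symm (𝓝 (extChartAt I p p)) (𝓝 p) := by
    have := continuousAt_extChartAt_symm (I := I) p
    rwa [ContinuousAt, (extChartAt I p).left_inv (mem_extChartAt_source p)] at this
  filter_upwards [hc.eventually h] with z hz
  rw [formInChart, formInChart, hz]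

/-- The Hilbert 2-forms of the members of a local Finsler function fit together, and the
negative of the form they make up descends to path space. -/
lemma exists_descended_hilbertForm (hΓ : IsSpray univ Γ) (hπ : IsPathSpace E' Γ π)
    {U : M → Set M} {F : M → TangentBundle 𝓘(ℝ, E) M → ℝ}
    (h : ∀ x, IsOpen (U x) ∧ x ∈ U x ∧ IsFinsler (U x) (F x) ∧ IsGeodesicClass (U x) (F x) Γ)
    (hov : ∀ x x' : M, ∀ p ∈ slit E (U x ∩ U x'),
      extD (hilbertForm (F x)) p = extD (hilbertForm (F x')) p) :
    ∃ Ω : FormField 𝓘(ℝ, E') P 2, IsSmoothForm Ω ∧ (∀ q, extD Ω q = 0) ∧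
      ∀ p ∈ slit E univ, ∀ ξ η : TangentSpace 𝓘(ℝ, E).tangent p,
        Ω (π p) ![dπ (E' := E') π p ξ, dπ π p η] =
          -(extD (hilbertForm (F p.proj)) p : (E × E) [⋀^Fin 2]→L[ℝ] ℝ) ![ξ, η] := by
  let α : FormField 𝓘(ℝ, E).tangent (TangentBundle 𝓘(ℝ, E) M) 2 :=
    fun p => -extD (hilbertForm (F p.proj)) p
  have hself : ∀ p ∈ slit E (univ : Set M), p ∈ slit E (U p.proj) := fun p hp => ⟨(h _).2.1, hp.2⟩
  have hev : ∀ p ∈ slit E (univ : Set M),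
      formInChart α p =ᶠ[𝓝 (extChartAt 𝓘(ℝ, E).tangent p p)]
        formInChart (fun q => -extD (hilbertForm (F p.proj)) q) p := fun p hp => by
    refine formInChart_congr_of_eventuallyEq ?_
    filter_upwards [(isOpen_slit (h p.proj).1).mem_nhds (hself p hp)] with q hq
    exact congrArg Neg.neg (hov _ _ q ⟨⟨(h _).2.1, hq.1⟩, hq.2⟩)
  obtain ⟨Ω, h1, h2, h3⟩ := exists_descended_form (I := 𝓘(ℝ, E).tangent) (I' := 𝓘(ℝ, E')) (f := π)
    (α := α) (isOpen_slit isOpen_univ) (fun p hp => hπ.contMDiffAt hp) hπ.submersion hπ.surjective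
    (fun p hp q hq hpq => hπ.exists_curve hp hq hpq)
    (fun p hp => ContDiffAt.congr_of_eventuallyEq
      (smoothFormAt_neg_extD_hilbertForm (h p.proj).1 (h p.proj).2.2.1 (hself p hp)) (hev p hp))
    (fun p hp => by
      have h4 := extD_neg_extD_hilbertForm (h p.proj).1 (h p.proj).2.2.1 (hself p hp)
      rw [extD, (hev p hp).extDeriv_eq]
      exact h4)
    (fun p hp ξ hξ η => neg_eq_zero.2 ((h p.proj).2.2.2.extD_hilbertForm_of_mem_distD hΓ
      (h p.proj).1 (h p.proj).2.2.1 (hself p hp) ((hπ.dπ_eq_zero_iff hp ξ).1 hξ) η))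
  exact ⟨Ω, h1, h2, h3⟩

/-- The fibre Hessians of a local Finsler function make the descended form nondegenerate, the fibres
Lagrangian and the values on Jacobi fields positive. -/
lemma exists_isSymplectic_of_isGeodesicClassOfLocalFinsler (hΓ : IsSpray univ Γ)
    (hπ : IsPathSpace E' Γ π) (h : IsGeodesicClassOfLocalFinsler Γ) :
    ∃ Ω : FormField 𝓘(ℝ, E') P 2, IsSymplectic Ω ∧ (∀ x : M, IsLagrangianHat π Ω x) ∧
      IsPositiveOnJacobi Γ π Ω := by
  obtain ⟨U, F, h, hov⟩ := h
  obtain ⟨Ω, hsm, hcl, hΩ⟩ := exists_descended_hilbertForm hΓ hπ h hov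
  have hself : ∀ p ∈ slit E (univ : Set M), p ∈ slit E (U p.proj) := fun p hp => ⟨(h _).2.1, hp.2⟩
  have hpos : ∀ p ∈ slit E (univ : Set M), ∀ ξ : TangentSpace 𝓘(ℝ, E).tangent p,
      (∀ c : ℝ, dτ p ξ ≠ c • p.2) →
      0 < Ω (π p) ![dπ (E' := E') π p ξ, dπ π p (vlift p (dτ p ξ))] := by
    intro p hp ξ hξ
    refine lt_of_lt_of_eq (extD_hilbertForm_vlift_pos (h p.proj).1 (h p.proj).2.2.1 (hself p hp) hξ)
      (Eq.trans ?_ (hΩ p hp _ _).symm)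
    exact pair_swap (V := E × E) (extD (hilbertForm (F p.proj)) p) (vlift p (dτ p ξ)) ξ
  refine ⟨Ω, ⟨hsm, hcl, fun q ξ' hξ' => ?_⟩, fun x p hp ξ' => ?_, ?_⟩
  · obtain ⟨p, hp, rfl⟩ := hπ.surjective (mem_univ q)
    obtain ⟨ξ, rfl⟩ := hπ.submersion p hp ξ'
    refine (hπ.dπ_eq_zero_iff hp ξ).2 ((h p.proj).2.2.2.mem_distD_of_extD_hilbertForm hΓ
      (h p.proj).1 (h p.proj).2.2.1 (hself p hp) fun η => ?_)
    exact neg_eq_zero.1 ((hΩ p hp ξ η).symm.trans (hξ' _))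
  · have hp' : p ∈ slit E (univ : Set M) := ⟨mem_univ _, hp.2⟩
    obtain ⟨ξ, rfl⟩ := hπ.submersion p hp' ξ'
    constructor
    · rintro ⟨ζ, hζ, hζ'⟩ η' ⟨η, hη, rfl⟩
      obtain ⟨v, rfl⟩ := eq_vlift_of_dτ_eq_zero hζ
      obtain ⟨w, rfl⟩ := eq_vlift_of_dτ_eq_zero hη
      refine (congrArg (fun a => Ω (π p) ![a, _]) hζ'.symm).trans ((hΩ p hp' _ _).trans ?_)
      exact neg_eq_zero.2 (extD_hilbertForm_vlift_vlift (h p.proj).1 (h p.proj).2.2.1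
        (hself p hp') v w)
    · intro hξ
      -- `ξ` is vertical up to a multiple of the spray, by positivity
      obtain ⟨c, hc⟩ : ∃ c : ℝ, dτ p ξ = c • p.2 := by
        by_contra hc
        exact (hpos p hp' ξ (not_exists.1 hc)).ne' (hξ _ ⟨_, dτ_vlift _, rfl⟩)
      refine ⟨ξ - c • Γ p, ?_, ?_⟩
      · show dτ p (ξ - c • Γ p) = 0
        rw [map_sub, map_smul, hΓ.secondOrder p hp', hc, sub_self]
      · show dπ π p (ξ - c • Γ p) = dπ π p ξ
        rw [map_sub, map_smul, (hπ.dπ_eq_zero_iff hp' (Γ p)).2 (Submodule.subset_span (Or.inr rfl)),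
          smul_zero, sub_zero]
  · intro J σ hσ h0 v Z₁ Z₂ hZ₁ hZ₂ _ hne
    rw [hΓ.vlift_eq_of_isJacobiLift hσ h0 hZ₂] at hne ⊢
    have h1 := hpos (σ 0) (hσ.mem 0 h0) (Z₁ 0) (by
      rw [hZ₁.initial]
      rintro c rfl
      exact hne ((hπ.dπ_eq_zero_iff (hσ.mem 0 h0) _).2 (vlift_smul_mem_distD c)))
    rw [hZ₁.initial] at h1
    exact h1

end SymplecticForm

end PathSpace

end

theorem mainTheorem10
    {E : Type*} [NormedAddCommGroup E] [NormedSpace ℝ E] [FiniteDimensional ℝ E]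
    (hdim : 3 ≤ Module.finrank ℝ E)
    {M : Type*} [TopologicalSpace M] [T2Space M] [ParacompactSpace M]
    [ChartedSpace E M] [IsManifold 𝓘(ℝ, E) ∞ M]
    (Γ : PathSpace.FieldOnTM E M) (hΓ : PathSpace.IsSpray univ Γ)
    {E' : Type*} [NormedAddCommGroup E'] [NormedSpace ℝ E'] [FiniteDimensional ℝ E']
    {P : Type*} [TopologicalSpace P] [ChartedSpace E' P] [IsManifold 𝓘(ℝ, E') ∞ P]
    (π : TangentBundle 𝓘(ℝ, E) M → P) (hπ : PathSpace.IsPathSpace E' Γ π) :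
    PathSpace.IsGeodesicClassOfLocalFinsler Γ ↔
      ∃ Ω : PathSpace.FormField 𝓘(ℝ, E') P 2,
        PathSpace.IsSymplectic Ω ∧
        (∀ x : M, PathSpace.IsLagrangianHat π Ω x) ∧
        PathSpace.IsPositiveOnJacobi Γ π Ω := by
  constructor
  · exact PathSpace.exists_isSymplectic_of_isGeodesicClassOfLocalFinsler hΓ hπ
  · rintro ⟨Ω, hΩ, hL, hpos⟩
    exact PathSpace.isGeodesicClassOfLocalFinsler_of_isSymplectic hdim hΓ hπ hΩ hL hpos
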